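/- Let $M$ be a smooth $m$-dimensional manifold, $\tau:LM\to M$ its frame bundle and $\tau_1:J^1\tau\to M$ the bundle of $1$-jets of local sections of $\tau$, with fibered coordinates $(x^\mu,e^\nu_k,e^\nu_{k\sigma})$; let $(e^k_\mu)$ be the inverse matrix of $(e^\mu_k)$. Let $\eta=\mathrm{diag}(\pm1,\dots,\pm1)$ (any signature), and let $r\ge 1$ be an integer with $2r\le m$. Summation over repeated indices is understood. On $J^1\tau$ consider the canonical forms $\theta^k=e^k_\mu\,dx^\mu$, the universal connection $\omega^i_j=e^i_\mu(de^\mu_j-e^\mu_{j\sigma}dx^\sigma)$, its curvature $\Omega^i_j=d\omega^i_j+\omega^i_k\wedge\omega^k_j$, $\Omega^{ab}=\eta^{bq}\Omega^a_q$, the Sparling forms $$\theta_{i_1\dots i_p}=\frac1{(m-p)!}\,\varepsilon_{i_1\dots i_m}\,\theta^{i_{p+1}}\wedge\dots\wedge\theta^{i_m},$$ and the $m$-forms $$\Psi^{ab}=\Big(\Omega^{sa}\eta^{tb}+\Omega^{sb}\eta^{ta}-\frac1r\,\eta^{ab}\Omega^{st}\Big)\wedge\theta_{st\,i_2\dots i_r\,j_2\dots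 j_r}\wedge\Omega^{i_2j_2}\wedge\dots\wedge\Omega^{i_rj_r}.$$ Let $\sigma$ be a smooth local section of $\tau_1$ over an open set $U\subseteq M$ (not necessarily holonomic) which takes its values in the torsionless jets, $T_0=\{e^\mu_{i\nu}e^i_\sigma=e^\mu_{i\sigma}e^i_\nu\}$, and satisfies the metricity condition $\sigma^*\omega_{\mathfrak p}=0$, where $(\omega_{\mathfrak p})^i_j=\frac12(\omega^i_j+\eta_{jp}\,\omega^p_q\,\eta^{qi})$. Let $g_{\mu\nu}=e^a_\mu\eta_{ab}e^b_\nu$ be the metric and $\Gamma^\mu_{\nu\sigma}=-e^k_\nu e^\mu_{k\sigma}$ the linear connection on $U$ determined by $\sigma$, and let $R^{\kappa\tau}_{\mu\nu}=g^{\rho\tau}R^\kappa_{\rho\mu\nu}$, where $R(\partial_\mu,\partial_\nu)\partial_\rho=R^\kappa_{\rho\mu\nu}\partial_\kappa$ is the curvature tensor of this connection. Then the following are equivalent: 1. $\sigma^*\Psi^{ab}=0$ on $U$ for all $a,b$; 2. the Lovelock tensor vanishes on $U$: in all local coordinates and for all $\mu,\nu$, $$\Big(\delta^{\mu\alpha_1\beta_1\dots\alpha_r\beta_r}_{\rho\lambda_1\theta_1\dots\lambda_r\theta_r}\,g^{\rho\nu}+\delta^{\nu\alpha_1\beta_1\dots\alpha_r\beta_r}_{\rho\lambda_1\theta_1\dots\lambda_r\theta_r}\,g^{\rho\mu}\Big)R^{\lambda_1\theta_1}_{\alpha_1\beta_1}\cdots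 R^{\lambda_r\theta_r}_{\alpha_r\beta_r}=0,$$ where $\delta^{\cdots}_{\cdots}$ is the generalized Kronecker delta; 3. $g$ satisfies the Euler–Lagrange equations of the Lovelock Lagrangian of order $r$, $$\mathcal L_r(g)=\sqrt{|\det g|}\;\delta^{\alpha_1\beta_1\dots\alpha_r\beta_r}_{\lambda_1\theta_1\dots\lambda_r\theta_r}R^{\lambda_1\theta_1}_{\alpha_1\beta_1}\cdots R^{\lambda_r\theta_r}_{\alpha_r\beta_r},$$ with $R$ now the curvature of the Levi-Civita connection of the metric; that is, in every coordinate chart, for every compact set $K$ in the part of the chart domain lying in $U$ and every smooth symmetric $h_{\mu\nu}$ supported in $K$, the derivative $\frac{d}{dt}\big|_{t=0}\int_K\mathcal L_r(g+th)\,d^mx$ exists and equals $0$. -/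

import Mathlib

open scoped Manifold ContDiff

noncomputable section

namespace Lovelock

/-! ### Exterior algebra of differential forms on coordinate spaces -/

/-- The exterior algebra `Λ(E*)` of the cotangent space of `E` at a point; multiplication is the
wedge product.  A differential form on `E` is a map `E → Forms E`. -/
abbrev Forms (E : Type*) [NormedAddCommGroup E] [NormedSpace ℝ E] : Type _ :=
  ExteriorAlgebra ℝ (E →L[ℝ] ℝ)

/-- A covector regarded as an element of degree one of the exterior algebra. -/
def oneForm {E : Type*} [NormedAddCommGroup E] [NormedSpace ℝ E] (α : E →L[ℝ] ℝ) : Forms E :=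
  ExteriorAlgebra.ι ℝ α

/-- Exterior derivative `dα = ∑_A dz^A ∧ ∂α/∂z^A` of a one-form `α` on a coordinate space. -/
def dOne {κ : Type*} [Fintype κ] [DecidableEq κ] (α : (κ → ℝ) → ((κ → ℝ) →L[ℝ] ℝ)) (z : κ → ℝ) :
    Forms (κ → ℝ) :=
  ∑ A, oneForm (ContinuousLinearMap.proj A) * oneForm (fderiv ℝ α z (Pi.single A 1))

/-- Pullback `f^* Φ` of a differential form `Φ` along `f`, evaluated at the point `y`. -/
def pullback {E F : Type*} [NormedAddCommGroup E] [NormedSpace ℝ E] [NormedAddCommGroup F]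
    [NormedSpace ℝ F] (f : E → F) (Φ : F → Forms F) (y : E) : Forms E :=
  ExteriorAlgebra.map (ContinuousLinearMap.precomp ℝ (fderiv ℝ f y)).toLinearMap (Φ (f y))

/-! ### Levi-Civita symbol, generalized Kronecker delta, the matrix `η` -/

/-- The Levi-Civita symbol `ε_{f 0 … f (m-1)}`: the sign of `f` if `f` is a permutation,
and `0` otherwise. -/
def leviCivita {m : ℕ} (f : Fin m → Fin m) : ℝ :=
  (Matrix.of fun a b : Fin m => if f a = b then (1 : ℝ) else 0).det

/-- The generalized Kronecker delta `δ^{i}_{j}`, a determinant of Kronecker deltas. The positions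
of the indices are labelled by a finite type `κ`; the value does not depend on an ordering of `κ`,
as long as the same one is used for the upper and the lower indices. -/
def kronecker {m : ℕ} {κ : Type*} [Fintype κ] [DecidableEq κ] (i j : κ → Fin m) : ℝ :=
  (Matrix.of fun a b : κ => if i a = j b then (1 : ℝ) else 0).det

/-- The matrix `η = diag(±1, …, ±1)` with the given signs; it is its own inverse, so that
`η_{ab} = η^{ab}`. -/
def eta {m : ℕ} (s : Fin m → ℤˣ) : Matrix (Fin m) (Fin m) ℝ :=
  Matrix.diagonal fun a => ((s a : ℤ) : ℝ)

/-! ### Canonical forms on the bundle `J¹τ` of 1-jets of frames, in fibered coordinates -/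

/-- Labels of the fibered coordinates `(x^μ, e^ν_k, e^ν_{kσ})` of `J¹τ`. -/
abbrev JetIdx (m : ℕ) : Type := Fin m ⊕ (Fin m × Fin m) ⊕ (Fin m × Fin m × Fin m)

/-- The space of fibered coordinates of `J¹τ`; the coordinates of actual jets of frames are those
points at which the matrix `(e^ν_k)` is invertible. -/
abbrev JetCoord (m : ℕ) : Type := JetIdx m → ℝ

section Forms

variable {m : ℕ}

/-- The matrix `e^ν_k`. -/
def frameMat (z : JetCoord m) : Matrix (Fin m) (Fin m) ℝ :=
  Matrix.of fun ν k => z (.inr (.inl (ν, k)))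

/-- The inverse matrix `e^k_μ`. -/
def coframeMat (z : JetCoord m) : Matrix (Fin m) (Fin m) ℝ := (frameMat z)⁻¹

/-- The coordinate `e^ν_{kσ}`. -/
def frameDer (z : JetCoord m) (ν k σ : Fin m) : ℝ := z (.inr (.inr (ν, k, σ)))

/-- The differential `dx^μ`. -/
def dx (μ : Fin m) : JetCoord m →L[ℝ] ℝ := ContinuousLinearMap.proj (.inl μ)

/-- The differential `de^ν_k`. -/
def de (ν k : Fin m) : JetCoord m →L[ℝ] ℝ := ContinuousLinearMap.proj (.inr (.inl (ν, k)))

/-- The canonical form `θ^k = e^k_μ dx^μ`. -/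
def theta (k : Fin m) (z : JetCoord m) : JetCoord m →L[ℝ] ℝ :=
  ∑ μ, coframeMat z k μ • dx μ

/-- The universal connection `ω^i_j = e^i_μ (de^μ_j - e^μ_{jσ} dx^σ)`. -/
def omega (i j : Fin m) (z : JetCoord m) : JetCoord m →L[ℝ] ℝ :=
  ∑ μ, coframeMat z i μ • (de μ j - ∑ σ, frameDer z μ j σ • dx σ)

/-- The component `(ω_𝔭)^i_j = ½ (ω^i_j + η_{jp} ω^p_q η^{qi})`. -/
def omegaP (s : Fin m → ℤˣ) (i j : Fin m) (z : JetCoord m) : JetCoord m →L[ℝ] ℝ :=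
  (1 / 2 : ℝ) • (omega i j z + ∑ p, ∑ q, (eta s j p * eta s q i) • omega p q z)

/-- The universal curvature `Ω^i_j = dω^i_j + ω^i_k ∧ ω^k_j`. -/
def curvForm (i j : Fin m) (z : JetCoord m) : Forms (JetCoord m) :=
  dOne (omega i j) z + ∑ k, oneForm (omega i k z) * oneForm (omega k j z)

/-- `Ω^{ab} = η^{bq} Ω^a_q`. -/
def curvFormUp (s : Fin m → ℤˣ) (a b : Fin m) (z : JetCoord m) : Forms (JetCoord m) :=
  ∑ q, eta s b q • curvForm a q z

/-- The Sparling form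
`θ_{i_1 … i_p} = (1/(m-p)!) ε_{i_1 … i_p i_{p+1} … i_m} θ^{i_{p+1}} ∧ … ∧ θ^{i_m}`, for `p ≤ m`. -/
def sparling {p : ℕ} (I : Fin p → Fin m) (z : JetCoord m) : Forms (JetCoord m) :=
  ((m - p).factorial : ℝ)⁻¹ • ∑ L : Fin (m - p) → Fin m,
    leviCivita (fun a : Fin m =>
      if h : (a : ℕ) < p then I ⟨a, h⟩ else L ⟨(a : ℕ) - p, by have := a.isLt; omega⟩) •
    (List.ofFn fun c => oneForm (theta (L c) z)).prod

/-- `Ω^{IJ} = Ω^{i_1 j_1} ∧ … ∧ Ω^{i_n j_n}`. -/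
def curvFormProd (s : Fin m → ℤˣ) {n : ℕ} (I J : Fin n → Fin m) (z : JetCoord m) :
    Forms (JetCoord m) :=
  (List.ofFn fun c => curvFormUp s (I c) (J c) z).prod

/-- `Ψ^{ab} = (Ω^{sa} η^{tb} + Ω^{sb} η^{ta} - (1/r) η^{ab} Ω^{st}) ∧ θ_{stI'J'} ∧ Ω^{I'J'}`, with
`I' = (i_2, …, i_r)` and `J' = (j_2, …, j_r)`. -/
def Psi (s : Fin m → ℤˣ) (r : ℕ) (a b : Fin m) (z : JetCoord m) : Forms (JetCoord m) :=
  ∑ c, ∑ t, ∑ I : Fin (r - 1) → Fin m, ∑ J : Fin (r - 1) → Fin m,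
    (eta s t b • curvFormUp s c a z + eta s t a • curvFormUp s c b z
        - ((1 / (r : ℝ)) * eta s a b) • curvFormUp s c t z)
      * sparling (Fin.append ![c, t] (Fin.append I J)) z * curvFormProd s I J z

end Forms

/-! ### Local sections of `J¹τ` -/

/-- The components, in the chart `φ`, of the vector field `X`, as a function on the chart's
image. -/
def chartComp {m : ℕ} {M : Type*} [TopologicalSpace M] [ChartedSpace (Fin m → ℝ) M]
    (φ : OpenPartialHomeomorph M (Fin m → ℝ))
    (X : (x : M) → TangentSpace 𝓘(ℝ, Fin m → ℝ) x) (y : Fin m → ℝ) : Fin m → ℝ :=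
  mfderiv 𝓘(ℝ, Fin m → ℝ) 𝓘(ℝ, Fin m → ℝ) φ (φ.symm y) (X (φ.symm y))

/-- The fibered coordinates `(x^μ, e^ν_k, e^ν_{kσ})`, in the chart `φ`, of the 1-jet at `φ⁻¹ y` of
the field of frames `S`. -/
def jetCoord {m : ℕ} {M : Type*} [TopologicalSpace M] [ChartedSpace (Fin m → ℝ) M]
    (φ : OpenPartialHomeomorph M (Fin m → ℝ))
    (S : Fin m → (x : M) → TangentSpace 𝓘(ℝ, Fin m → ℝ) x) (y : Fin m → ℝ) : JetCoord m
  | .inl μ => y μ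
  | .inr (.inl (ν, k)) => chartComp φ (S k) y ν
  | .inr (.inr (ν, k, σ)) => fderiv ℝ (chartComp φ (S k)) y (Pi.single σ 1) ν

/-- A smooth local section `x ↦ j¹_x (S x)` over `U` of the bundle `τ₁ : J¹τ → M` of 1-jets of
local sections of the frame bundle `τ : LM → M`. The jet at each point `x` is given by a local
field of frames `S x` representing it (only its 1-jet at `x` enters in what follows); the section
need not be holonomic, that is, `S x` may vary with `x`. -/
structure JetSection (m : ℕ) (M : Type*) [TopologicalSpace M] [ChartedSpace (Fin m → ℝ) M]
    [IsManifold 𝓘(ℝ, Fin m → ℝ) ∞ M] (U : Set M) where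
  /-- the local field of frames whose 1-jet at `x` is the value of the section at `x` -/
  S : M → Fin m → (y : M) → TangentSpace 𝓘(ℝ, Fin m → ℝ) y
  contMDiffAt_S : ∀ x ∈ U, ∀ k, ContMDiffAt 𝓘(ℝ, Fin m → ℝ) 𝓘(ℝ, Fin m → ℝ).tangent ∞
    (fun y => (⟨y, S x k y⟩ : TangentBundle 𝓘(ℝ, Fin m → ℝ) M)) x
  linearIndependent_S : ∀ x ∈ U, LinearIndependent ℝ fun k => S x k x
  /-- smoothness: the fibered coordinates are smooth functions of the coordinates on `M` -/
  smooth : ∀ φ ∈ IsManifold.maximalAtlas 𝓘(ℝ, Fin m → ℝ) ∞ M,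
    ContDiffOn ℝ ∞ (fun y => jetCoord φ (S (φ.symm y)) y) (φ.target ∩ φ.symm ⁻¹' U)

namespace JetSection

variable {m : ℕ} {M : Type*} [TopologicalSpace M] [ChartedSpace (Fin m → ℝ) M]
  [IsManifold 𝓘(ℝ, Fin m → ℝ) ∞ M] {U : Set M}

/-- The image in the chart `φ` of the part of `U` covered by `φ`. -/
def dom (_σ : JetSection m M U) (φ : OpenPartialHomeomorph M (Fin m → ℝ)) : Set (Fin m → ℝ) :=
  φ.target ∩ φ.symm ⁻¹' U

/-- The section in fibered coordinates. -/
def coord (σ : JetSection m M U) (φ : OpenPartialHomeomorph M (Fin m → ℝ)) (y : Fin m → ℝ) :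
    JetCoord m :=
  jetCoord φ (σ.S (φ.symm y)) y

/-- The section takes its values in the submanifold `T₀` of torsionless jets, given in fibered
coordinates by `e^μ_{iν} e^i_σ = e^μ_{iσ} e^i_ν`. -/
def Torsionless (σ : JetSection m M U) : Prop :=
  ∀ φ ∈ IsManifold.maximalAtlas 𝓘(ℝ, Fin m → ℝ) ∞ M, ∀ y ∈ σ.dom φ, ∀ μ ν ρ : Fin m,
    ∑ i, frameDer (σ.coord φ y) μ i ν * coframeMat (σ.coord φ y) i ρ =
      ∑ i, frameDer (σ.coord φ y) μ i ρ * coframeMat (σ.coord φ y) i ν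

/-- The metricity condition `σ^* ω_𝔭 = 0`. -/
def Metricity (s : Fin m → ℤˣ) (σ : JetSection m M U) : Prop :=
  ∀ φ ∈ IsManifold.maximalAtlas 𝓘(ℝ, Fin m → ℝ) ∞ M, ∀ y ∈ σ.dom φ, ∀ i j : Fin m,
    pullback (σ.coord φ) (fun z => oneForm (omegaP s i j z)) y = 0

/-- The metric `g_{μν} = e^a_μ η_{ab} e^b_ν` determined by the section. -/
def metric (s : Fin m → ℤˣ) (σ : JetSection m M U) (φ : OpenPartialHomeomorph M (Fin m → ℝ))
    (y : Fin m → ℝ) : Matrix (Fin m) (Fin m) ℝ :=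
  Matrix.of fun μ ν =>
    ∑ a, ∑ b, coframeMat (σ.coord φ y) a μ * eta s a b * coframeMat (σ.coord φ y) b ν

/-- The coefficients `Γ^μ_{νσ} = - e^k_ν e^μ_{kσ}` of the linear connection determined by the
section. -/
def connection (σ : JetSection m M U) (φ : OpenPartialHomeomorph M (Fin m → ℝ))
    (μ ν ρ : Fin m) (y : Fin m → ℝ) : ℝ :=
  -∑ k, coframeMat (σ.coord φ y) k ν * frameDer (σ.coord φ y) μ k ρ

end JetSection

/-! ### Curvature, the Lovelock tensor and the Lovelock Lagrangian in coordinates -/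

section Tensors

variable {m : ℕ}

/-- The partial derivative `∂_μ f`. -/
def pderiv (μ : Fin m) (f : (Fin m → ℝ) → ℝ) (y : Fin m → ℝ) : ℝ :=
  fderiv ℝ f y (Pi.single μ 1)

/-- The curvature `R^κ_{ρμν}` of the linear connection with coefficients `Γ^μ_{νσ}`, where
`∇_{∂_σ} ∂_ν = Γ^μ_{νσ} ∂_μ` and `R(∂_μ, ∂_ν) ∂_ρ = R^κ_{ρμν} ∂_κ`. -/
def curvature (Γ : Fin m → Fin m → Fin m → (Fin m → ℝ) → ℝ) (κ ρ μ ν : Fin m)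
    (y : Fin m → ℝ) : ℝ :=
  pderiv μ (Γ κ ρ ν) y - pderiv ν (Γ κ ρ μ) y
    + ∑ l, (Γ κ l μ y * Γ l ρ ν y - Γ κ l ν y * Γ l ρ μ y)

/-- `R^{κτ}_{μν} = g^{ρτ} R^κ_{ρμν}`. -/
def curvatureUp (g : (Fin m → ℝ) → Matrix (Fin m) (Fin m) ℝ)
    (Γ : Fin m → Fin m → Fin m → (Fin m → ℝ) → ℝ) (κ τ μ ν : Fin m) (y : Fin m → ℝ) : ℝ :=
  ∑ ρ, (g y)⁻¹ ρ τ * curvature Γ κ ρ μ ν y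

/-- The Lovelock tensor
`A^{μν} = (δ^{μ α₁β₁…α_rβ_r}_{ρ λ₁θ₁…λ_rθ_r} g^{ρν} + δ^{ν α₁β₁…α_rβ_r}_{ρ λ₁θ₁…λ_rθ_r} g^{ρμ})
  R^{λ₁θ₁}_{α₁β₁} ⋯ R^{λ_rθ_r}_{α_rβ_r}`.
The indices are `(α_k, β_k) = (A (k, 0), A (k, 1))` and `(λ_k, θ_k) = (B (k, 0), B (k, 1))`. -/
def lovelockTensor (r : ℕ) (g : (Fin m → ℝ) → Matrix (Fin m) (Fin m) ℝ)
    (Γ : Fin m → Fin m → Fin m → (Fin m → ℝ) → ℝ) (μ ν : Fin m) (y : Fin m → ℝ) : ℝ :=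
  ∑ ρ, ∑ A : Fin r × Fin 2 → Fin m, ∑ B : Fin r × Fin 2 → Fin m,
    (kronecker (fun o : Option (Fin r × Fin 2) => o.elim μ A) (fun o => o.elim ρ B) * (g y)⁻¹ ρ ν
      + kronecker (fun o : Option (Fin r × Fin 2) => o.elim ν A) (fun o => o.elim ρ B)
          * (g y)⁻¹ ρ μ)
      * ∏ k, curvatureUp g Γ (B (k, 0)) (B (k, 1)) (A (k, 0)) (A (k, 1)) y

/-- The coefficients `Γ^μ_{νσ} = ½ g^{μλ} (∂_ν g_{λσ} + ∂_σ g_{λν} - ∂_λ g_{νσ})` of the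
Levi-Civita connection of the metric `g`. -/
def christoffel (g : (Fin m → ℝ) → Matrix (Fin m) (Fin m) ℝ) (μ ν σ : Fin m)
    (y : Fin m → ℝ) : ℝ :=
  (1 / 2 : ℝ) * ∑ l, (g y)⁻¹ μ l *
    (pderiv ν (fun x => g x l σ) y + pderiv σ (fun x => g x l ν) y - pderiv l (fun x => g x ν σ) y)

/-- The Lovelock Lagrangian density of order `r`,
`√|det g| δ^{α₁β₁…α_rβ_r}_{λ₁θ₁…λ_rθ_r} R^{λ₁θ₁}_{α₁β₁} ⋯ R^{λ_rθ_r}_{α_rβ_r}`, with the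
curvature of the Levi-Civita connection of `g`. -/
def lovelockDensity (r : ℕ) (g : (Fin m → ℝ) → Matrix (Fin m) (Fin m) ℝ) (y : Fin m → ℝ) : ℝ :=
  Real.sqrt |(g y).det| * ∑ A : Fin r × Fin 2 → Fin m, ∑ B : Fin r × Fin 2 → Fin m,
    kronecker A B *
      ∏ k, curvatureUp g (christoffel g) (B (k, 0)) (B (k, 1)) (A (k, 0)) (A (k, 1)) y

/-- The metric `g` satisfies on the open set `V` the Euler-Lagrange equations of the Lovelock
Lagrangian of order `r`: the first variation of the action vanishes for all smooth symmetric
variations `h` of the metric with compact support in `V`. -/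
def IsLovelockExtremal (r : ℕ) (g : (Fin m → ℝ) → Matrix (Fin m) (Fin m) ℝ)
    (V : Set (Fin m → ℝ)) : Prop :=
  ∀ K : Set (Fin m → ℝ), IsCompact K → K ⊆ V →
    ∀ h : (Fin m → ℝ) → Matrix (Fin m) (Fin m) ℝ, (∀ μ ν, ContDiff ℝ ∞ fun y => h y μ ν) →
      (∀ y, (h y).IsSymm) → tsupport h ⊆ K →
      HasDerivAt (fun t : ℝ => ∫ y in K, lovelockDensity r (fun x => g x + t • h x) y) 0 0

end Tensors

end Lovelock

end

/-! Vanishing torsion and metricity together say that the connection Γ of σ is the Levi-Civita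
connection of g, so all three conditions concern g alone. The computation takes place in one chart,
over the commutative ring of smooth functions on an open set, with the partial derivatives as
commuting derivations. Tensor identities then become identities of matrices over a ring.

1 ⇔ 2. Let Q be the coframe matrix, X_{αβ} the matrix (R^{κτ}_{αβ})_{κτ} and A the Lovelock tensor.
The pullback sends θ^k to Q^k_μ dx^μ and Ω^{ab} to ½ (Q X_{αβ} Qᵀ)^{ab} dx^α ∧ dx^β. The product of
2r coordinate differentials and a Sparling form with 2r indices is a generalized Kronecker delta
times the volume form, up to a fixed sign. Expanding the delta that has the additional indices μ, ρ
gives δ^μ_ρ L - 2r E^μ_ρ, where L is the full contraction (`lovScalar`) and E leaves one upper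
curvature index free (`lovPartial`). The three terms of Ψ^{ab} produce E^{ab}, E^{ba} and -(1/r)
η^{ab} L, which is -1/(2r) times A^{ab}. Hence σ^*Ψ = c · (Q A Qᵀ) · vol with c ≠ 0 (`krSum_psi`,
`map_Psi`), and Q is invertible.

2 ⇔ 3. Regard g + th as a metric depending on (t, y), and let D = ∂/∂t, a derivation commuting with
the ∂_μ. The variation of R^{κτ}_{μν} consists of antisymmetrized covariant derivatives of DΓ and of
a term -R · Dg · g⁻¹. Contracted with the delta, the former add up to a divergence
(`sum_divergence`): the second Bianchi identity kills the derivatives of the other curvature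
factors, and the invariance of the delta under the linear group, with the symmetry of Γ, turns the
connection terms into tr Γ_μ = ∂_μ log √|det g|. The remaining terms are ¼ √|det g| A^{μν} h_{μν}
(`first_variation`, `evalAt_first_variation`). The divergence is supported in the support of h and
integrates to zero, and the fundamental lemma of the calculus of variations concludes
(`isLovelockExtremal_iff`). -/

noncomputable section

namespace Lovelock

/-! ### Determinants and the generalized Kronecker delta -/

section Determinants

variable {R : Type*} [CommRing R] {κ : Type*} [Fintype κ] [DecidableEq κ]

/-- Cofactor expansion along each replaced row. Both this sum and its column version are the
derivative of det at M in the direction N; their equality gives the invariance of the Kronecker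
delta, and the column version gives Jacobi's formula. -/
theorem sum_det_updateRow (M N : Matrix κ κ R) :
    ∑ i, (M.updateRow i (N i)).det = (M.adjugate * N).trace := by
  rw [Matrix.trace_mul_comm, Matrix.trace]
  refine Finset.sum_congr rfl fun i _ => ?_
  rw [← Matrix.cramer_transpose_apply, Matrix.cramer_eq_adjugate_mulVec, Matrix.diag_apply,
    Matrix.mul_apply, Matrix.mulVec, dotProduct]
  refine Finset.sum_congr rfl fun j _ => ?_
  rw [← Matrix.adjugate_transpose, Matrix.transpose_apply, mul_comm]

theorem sum_det_updateCol (M N : Matrix κ κ R) :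
    ∑ j, (M.updateCol j fun i => N i j).det = (M.adjugate * N).trace := by
  rw [Matrix.trace]
  refine Finset.sum_congr rfl fun i _ => ?_
  rw [← Matrix.cramer_apply, Matrix.cramer_eq_adjugate_mulVec, Matrix.diag_apply,
    Matrix.mul_apply, Matrix.mulVec, dotProduct]

/-- Laplace expansion along the column `none`, arranged so that no order on κ is needed: the minor
for the row `some b` is the main minor with row b replaced by the row `none`, at the cost of one
transposition. A permutation of `Option κ` is the image of `none` together with a permutation of κ.
-/
theorem det_option_column (M : Matrix (Option κ) (Option κ) R) :
    M.det = M none none * (M.submatrix some some).det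
      - ∑ b, M (some b) none *
          ((M.submatrix some some).updateRow b fun a => M none (some a)).det := by
  rw [Matrix.det_apply', ← Equiv.sum_comp Equiv.Perm.decomposeOption.symm,
    Fintype.sum_prod_type, Fintype.sum_option, sub_eq_add_neg]
  congr 1
  · rw [Matrix.det_apply', Finset.mul_sum]
    refine Finset.sum_congr rfl fun e _ => ?_
    rw [Fintype.prod_option]
    simp
    ring
  · rw [← Finset.sum_neg_distrib]
    refine Finset.sum_congr rfl fun b _ => ?_
    rw [Matrix.det_apply', Finset.mul_sum, ← Finset.sum_neg_distrib]
    refine Finset.sum_congr rfl fun e _ => ?_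
    rw [Fintype.prod_option]
    have h : ∀ i, M (Equiv.Perm.decomposeOption.symm (some b, e) (some i)) (some i)
        = ((M.submatrix some some).updateRow b fun a => M none (some a)) (e i) i := by
      intro i
      by_cases hb : e i = b
      · simp [Matrix.updateRow_apply, hb]
      · simp only [Equiv.Perm.decomposeOption_symm_apply, Equiv.Perm.coe_mul, Function.comp_apply,
          Equiv.optionCongr_apply, Option.map_some, Matrix.updateRow_apply, hb, if_false,
          Matrix.submatrix_apply]
        rw [Equiv.swap_apply_of_ne_of_ne] <;> simp [hb]
    simp_rw [h]
    simp
    ring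

theorem det_option_row (M : Matrix (Option κ) (Option κ) R) :
    M.det = M none none * (M.submatrix some some).det
      - ∑ b, M none (some b) *
          ((M.submatrix some some).updateCol b fun a => M (some a) none).det := by
  rw [← Matrix.det_transpose, det_option_column]
  congr 1
  · rw [Matrix.transpose_apply, ← Matrix.det_transpose, Matrix.transpose_submatrix,
      Matrix.transpose_transpose]
  · refine Finset.sum_congr rfl fun b _ => ?_
    rw [Matrix.transpose_apply, ← Matrix.det_transpose]
    congr 2
    ext i j
    simp [Matrix.updateRow_apply, Matrix.updateCol_apply]

end Determinants

/-! ### The generalized Kronecker delta: permutations, linear invariance, contractions. -/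

section Kronecker

variable {m : ℕ} {κ : Type*} [Fintype κ] [DecidableEq κ]

theorem kronecker_comp_perm (e : Equiv.Perm κ) (A B : κ → Fin m) :
    kronecker (A ∘ e) B = ((Equiv.Perm.sign e : ℤ) : ℝ) * kronecker A B := by
  rw [kronecker, kronecker, ← Matrix.det_permute]
  rfl

theorem kronecker_symm (A B : κ → Fin m) : kronecker A B = kronecker B A := by
  rw [kronecker, kronecker, ← Matrix.det_transpose]
  congr 1
  ext a b
  simp [eq_comm]

theorem kronecker_comp_perm_right (e : Equiv.Perm κ) (A B : κ → Fin m) :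
    kronecker A (B ∘ e) = ((Equiv.Perm.sign e : ℤ) : ℝ) * kronecker A B := by
  rw [kronecker_symm, kronecker_comp_perm, kronecker_symm]

theorem kronecker_comp_equiv {κ' : Type*} [Fintype κ'] [DecidableEq κ'] (e : κ' ≃ κ)
    (A B : κ → Fin m) : kronecker (A ∘ e) (B ∘ e) = kronecker A B := by
  rw [kronecker, kronecker, ← Matrix.det_submatrix_equiv_self e]
  rfl

theorem kronecker_comp_swap {a b : κ} (h : a ≠ b) (A B : κ → Fin m) :
    kronecker (A ∘ Equiv.swap a b) B = -kronecker A B := by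
  rw [kronecker_comp_perm, Equiv.Perm.sign_swap h]
  simp

theorem algebraMap_kronecker (R : Type*) [CommRing R] [Algebra ℝ R] (A B : κ → Fin m) :
    algebraMap ℝ R (kronecker A B)
      = (Matrix.of fun a b : κ => if A a = B b then (1 : R) else 0).det := by
  rw [kronecker, RingHom.map_det]
  congr 1
  ext a b
  simp [apply_ite (algebraMap ℝ R)]

/-- Infinitesimal invariance of the generalized Kronecker delta under the linear group. -/
theorem sum_kronecker_update {R : Type*} [CommRing R] [Algebra ℝ R] (G : Fin m → Fin m → R)
    (A B : κ → Fin m) :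
    ∑ b, ∑ x, algebraMap ℝ R (kronecker A (Function.update B b x)) * G x (B b)
      = ∑ a, ∑ x, algebraMap ℝ R (kronecker (Function.update A a x) B) * G (A a) x := by
  -- Both sides are the derivative of the delta, as a determinant, in the direction N: column by
  -- column on the left, row by row on the right.
  set M : Matrix κ κ R := Matrix.of fun a b => if A a = B b then (1 : R) else 0
  set N : Matrix κ κ R := Matrix.of fun a b => G (A a) (B b)
  trans (M.adjugate * N).trace
  · rw [← sum_det_updateCol]
    refine Finset.sum_congr rfl fun b _ => ?_
    have h1 : (fun i => N i b) = ∑ x, G x (B b) • fun i => if A i = x then (1 : R) else 0 := by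
      ext i
      simp [N, Finset.sum_apply]
    rw [h1, ← Matrix.cramer_apply, map_sum, Finset.sum_apply]
    refine Finset.sum_congr rfl fun x _ => ?_
    rw [map_smul, Pi.smul_apply, Matrix.cramer_apply, smul_eq_mul, mul_comm, algebraMap_kronecker]
    congr 2
    ext i j
    by_cases hj : j = b
    · subst hj; simp
    · simp [M, hj]
  · rw [← sum_det_updateRow]
    refine Finset.sum_congr rfl fun a _ => ?_
    have h1 : N a = ∑ x, G (A a) x • fun j => if x = B j then (1 : R) else 0 := by
      ext i
      simp [N, Finset.sum_apply]
    rw [h1, ← Matrix.cramer_transpose_apply, map_sum, Finset.sum_apply]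
    refine Finset.sum_congr rfl fun x _ => ?_
    rw [map_smul, Pi.smul_apply, Matrix.cramer_transpose_apply, smul_eq_mul, mul_comm,
      algebraMap_kronecker]
    congr 2
    ext i j
    by_cases hj : i = a
    · subst hj; simp
    · simp [M, Matrix.updateRow_apply, hj]

/-- Expansion along the row of the upper index μ. It separates the Lovelock tensor into its trace
part and its partial contractions. -/
theorem kronecker_option (μ ρ : Fin m) (A B : κ → Fin m) :
    kronecker (fun o : Option κ => o.elim μ A) (fun o => o.elim ρ B)
      = (if μ = ρ then 1 else 0) * kronecker A B
        - ∑ b, (if μ = B b then 1 else 0) * kronecker A (Function.update B b ρ) := by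
  rw [kronecker, det_option_row]
  congr 1
  refine Finset.sum_congr rfl fun b _ => ?_
  rw [kronecker]
  congr 2
  ext i j
  by_cases hj : j = b
  · subst hj; simp; rfl
  · simp [hj]; rfl

/-- In the expansion of the delta the leading term contributes m, and each position of κ removes
one. -/
theorem sum_kronecker_option (A B : κ → Fin m) :
    ∑ x, kronecker (fun o : Option κ => o.elim x A) (fun o => o.elim x B)
      = ((m : ℝ) - Fintype.card κ) * kronecker A B := by
  simp_rw [kronecker_option, Finset.sum_sub_distrib]
  rw [Finset.sum_comm]
  simp [Function.update_eq_self, sub_mul]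

/-- Induction on the number of contracted pairs: the first of them is moved into the index type, the
other q give q!, and contracting it last gives m - |κ| = q + 1. The factorial cancels the
normalization of the Sparling forms. -/
theorem sum_kronecker_sumElim (q : ℕ) (A B : κ → Fin m) (h : Fintype.card κ + q = m) :
    ∑ L : Fin q → Fin m, kronecker (Sum.elim A L) (Sum.elim B L)
      = (q.factorial : ℝ) * kronecker A B := by
  induction q generalizing κ with
  | zero =>
    rw [Fintype.sum_eq_single (fun i => i.elim0) fun L hL => (hL (Subsingleton.elim _ _)).elim,
      ← kronecker_comp_equiv (Equiv.sumEmpty κ (Fin 0)).symm]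
    simp only [Nat.factorial_zero, Nat.cast_one, one_mul]
    rfl
  | succ q ih =>
    have key : ∀ x : Fin m, ∀ L : Fin q → Fin m,
        kronecker (Sum.elim A (Fin.cons x L : Fin (q + 1) → Fin m))
          (Sum.elim B (Fin.cons x L : Fin (q + 1) → Fin m))
        = kronecker (Sum.elim (fun o : Option κ => o.elim x A) L)
            (Sum.elim (fun o : Option κ => o.elim x B) L) := by
      intro x L
      let e : Option κ ⊕ Fin q ≃ κ ⊕ Fin (q + 1) :=
        { toFun := Sum.elim (fun o => o.elim (Sum.inr 0) Sum.inl) fun i => Sum.inr i.succ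
          invFun := Sum.elim (fun k => Sum.inl (some k))
            (Fin.cases (Sum.inl none) fun i => Sum.inr i)
          left_inv := by rintro ((_ | _) | _) <;> simp
          right_inv := by
            rintro (_ | i)
            · simp
            · refine Fin.cases ?_ (fun i => ?_) i <;> simp }
      rw [← kronecker_comp_equiv e]
      congr 1 <;> · ext i; rcases i with (_ | _) | _ <;> simp [e]
    rw [← Equiv.sum_comp (Fin.consEquiv fun _ => Fin m), Fintype.sum_prod_type]
    change ∑ x, ∑ L : Fin q → Fin m, kronecker (Sum.elim A (Fin.cons x L : Fin (q + 1) → Fin m))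
          (Sum.elim B (Fin.cons x L : Fin (q + 1) → Fin m)) = _
    simp only [key]
    have hc : Fintype.card (Option κ) + q = m := by rw [Fintype.card_option]; omega
    simp_rw [ih _ _ hc, ← Finset.mul_sum, sum_kronecker_option]
    have : (m : ℝ) - Fintype.card κ = q + 1 := by
      rw [← h]; push_cast; ring
    rw [this, Nat.factorial_succ]
    push_cast
    ring

end Kronecker

/-! ### Levi-Civita connections over a commutative algebra with commuting derivations -/

section Derivations

variable {R : Type*} [CommRing R] [Algebra ℝ R]

theorem derivation_prod {κ : Type*} [DecidableEq κ] (D : Derivation ℝ R R) (s : Finset κ)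
    (f : κ → R) :
    D (∏ i ∈ s, f i) = ∑ j ∈ s, ∏ i ∈ s, if i = j then D (f j) else f i := by
  induction s using Finset.induction_on with
  | empty => simp
  | insert a s ha ih =>
    have h1 : ∀ j ∈ s, (∏ i ∈ insert a s, if i = j then D (f j) else f i)
        = f a * ∏ i ∈ s, if i = j then D (f j) else f i := by
      intro j hj
      rw [Finset.prod_insert ha, if_neg (fun h : a = j => ha (h ▸ hj))]
    have h2 : (∏ i ∈ s, if i = a then D (f a) else f i) = ∏ i ∈ s, f i :=
      Finset.prod_congr rfl fun i hi => if_neg fun h : i = a => ha (h ▸ hi)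
    rw [Finset.prod_insert ha, Derivation.leibniz, ih, Finset.sum_insert ha,
      Finset.sum_congr rfl h1, ← Finset.mul_sum, Finset.prod_insert ha, if_pos rfl, h2]
    simp only [smul_eq_mul]
    ring

variable {κ : Type*}

/-- A derivation applied to the entries of a matrix. -/
def matDer (D : Derivation ℝ R R) (M : Matrix κ κ R) : Matrix κ κ R := M.map D

@[simp]
theorem matDer_apply (D : Derivation ℝ R R) (M : Matrix κ κ R) (i j : κ) :
    matDer D M i j = D (M i j) := rfl

theorem matDer_add (D : Derivation ℝ R R) (M N : Matrix κ κ R) :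
    matDer D (M + N) = matDer D M + matDer D N := by ext; simp

theorem matDer_sub (D : Derivation ℝ R R) (M N : Matrix κ κ R) :
    matDer D (M - N) = matDer D M - matDer D N := by ext; simp

theorem matDer_neg (D : Derivation ℝ R R) (M : Matrix κ κ R) :
    matDer D (-M) = -matDer D M := by ext; simp

theorem matDer_one [DecidableEq κ] (D : Derivation ℝ R R) : matDer D (1 : Matrix κ κ R) = 0 := by
  ext i j
  by_cases h : i = j <;> simp [h]

theorem matDer_transpose (D : Derivation ℝ R R) (M : Matrix κ κ R) :
    matDer D M.transpose = (matDer D M).transpose := rfl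

variable [Fintype κ]

theorem matDer_mul (D : Derivation ℝ R R) (M N : Matrix κ κ R) :
    matDer D (M * N) = matDer D M * N + M * matDer D N := by
  ext i j
  simp only [matDer_apply, Matrix.mul_apply, map_sum, Derivation.leibniz, smul_eq_mul,
    Matrix.add_apply]
  rw [← Finset.sum_add_distrib]
  exact Finset.sum_congr rfl fun k _ => by ring

variable [DecidableEq κ]

theorem matDer_inverse (D : Derivation ℝ R R) {M N : Matrix κ κ R} (h : M * N = 1) :
    matDer D N = -(N * matDer D M * N) := by
  have h' : N * M = 1 := mul_eq_one_comm.mp h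
  have h1 : matDer D M * N + M * matDer D N = 0 := by rw [← matDer_mul, h, matDer_one]
  have h2 : N * (matDer D M * N + M * matDer D N) = 0 := by rw [h1, mul_zero]
  rw [mul_add, ← mul_assoc, ← mul_assoc, h', one_mul] at h2
  exact eq_neg_of_add_eq_zero_right h2

/-- Jacobi's formula, from the Leibniz rule applied to each column. -/
theorem derivation_det (D : Derivation ℝ R R) (M : Matrix κ κ R) :
    D M.det = (M.adjugate * matDer D M).trace := by
  rw [← sum_det_updateCol, Matrix.det_apply']
  simp only [map_sum, Derivation.leibniz, Derivation.map_intCast, mul_zero, add_zero,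
    derivation_prod, smul_eq_mul, Matrix.det_apply', Finset.mul_sum]
  refine Finset.sum_comm.trans ?_
  refine Finset.sum_congr rfl fun j _ => Finset.sum_congr rfl fun σ _ => ?_
  congr 1
  refine Finset.prod_congr rfl fun i _ => ?_
  by_cases h : i = j
  · subst h; simp
  · simp [h]

/-- The derivative of a square root `w` of `|det g|`. -/
theorem derivation_sqrt_det (D : Derivation ℝ R R) {g gi : Matrix κ κ R} (h : g * gi = 1)
    {w w' : R} (hw : w ^ 4 = g.det ^ 2) (hw' : w * w' = 1) :
    2 * D w = w * (gi * matDer D g).trace := by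
  have hi : gi = gi.det • g.adjugate := by
    have h1 : g.adjugate * (g * gi) = g.det • gi := by
      rw [← mul_assoc, Matrix.adjugate_mul, Matrix.smul_mul, one_mul]
    have h2 : gi.det * g.det = 1 := by rw [mul_comm, ← Matrix.det_mul, h, Matrix.det_one]
    rw [h, mul_one] at h1
    rw [h1, smul_smul, h2, one_smul]
  have hd : g.det * gi.det = 1 := by rw [← Matrix.det_mul, h, Matrix.det_one]
  -- Differentiating w⁴ = (det g)² involves neither the square root nor the sign of det g. The
  -- result is then divided by 4 and by w³, which are invertible.
  have hD := congrArg D hw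
  rw [Derivation.leibniz_pow, Derivation.leibniz_pow, derivation_det] at hD
  rw [hi, Matrix.smul_mul, Matrix.trace_smul]
  simp only [smul_eq_mul, nsmul_eq_mul] at hD ⊢
  push_cast at hD
  norm_num at hD
  set T := (g.adjugate * matDer D g).trace
  have h4 : (2 : R) * (2 * D w) * w ^ 3 = 2 * (g.det * T) := by rw [← hD]; ring
  have hu : algebraMap ℝ R (1 / 2) * 2 = 1 := by
    rw [← map_ofNat (algebraMap ℝ R) 2, ← map_mul]; norm_num
  have h5 : 2 * D w * w ^ 3 = g.det * T := by
    linear_combination algebraMap ℝ R (1 / 2) * h4 + (g.det * T - 2 * D w * w ^ 3) * hu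
  have h6 : w' ^ 3 * w ^ 3 = 1 := by rw [← mul_pow, mul_comm, hw', one_pow]
  have h7 : w' ^ 3 * g.det ^ 2 = w := by rw [← hw]; linear_combination w * h6
  linear_combination w' ^ 3 * h5 - (2 * D w) * h6 + T * gi.det * h7
    - w' ^ 3 * g.det * T * hd

end Derivations

/-! ### Levi-Civita connections as matrices over a ring: existence, uniqueness, curvature
identities. -/

section LeviCivita

variable {R : Type*} [CommRing R] [Algebra ℝ R] {m : ℕ}

/-- `Γ μ` is the matrix `(Γ^κ_{ρμ})_{κρ}` of the Levi-Civita connection of `g`, whose inverse is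
`gi`, in the direction of the derivation `∂ μ`. -/
structure IsLeviCivita (d : Fin m → Derivation ℝ R R) (g gi : Matrix (Fin m) (Fin m) R)
    (Γ : Fin m → Matrix (Fin m) (Fin m) R) : Prop where
  comm : ∀ i j f, d i (d j f) = d j (d i f)
  symm : g.transpose = g
  mul_inv : g * gi = 1
  torsion : ∀ μ κ ρ, Γ μ κ ρ = Γ ρ κ μ
  compat : ∀ μ, matDer (d μ) g = (Γ μ).transpose * g + g * Γ μ

/-- The Christoffel symbols `½ g^{κλ} (∂_ρ g_{λσ} + ∂_σ g_{λρ} - ∂_λ g_{ρσ})`. -/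
def christoffelMat (d : Fin m → Derivation ℝ R R) (g gi : Matrix (Fin m) (Fin m) R)
    (σ : Fin m) : Matrix (Fin m) (Fin m) R :=
  Matrix.of fun κ ρ => algebraMap ℝ R (1 / 2) *
    ∑ l, gi κ l * (d ρ (g l σ) + d σ (g l ρ) - d l (g ρ σ))

/-- The curvature `R_{μν} = ∂_μ Γ_ν - ∂_ν Γ_μ + [Γ_μ, Γ_ν]`. -/
def riem (d : Fin m → Derivation ℝ R R) (Γ : Fin m → Matrix (Fin m) (Fin m) R) (μ ν : Fin m) :
    Matrix (Fin m) (Fin m) R :=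
  matDer (d μ) (Γ ν) - matDer (d ν) (Γ μ) + (Γ μ * Γ ν - Γ ν * Γ μ)

/-- The covariant derivative of a matrix with two upper indices. -/
def covDer (d : Fin m → Derivation ℝ R R) (Γ : Fin m → Matrix (Fin m) (Fin m) R) (μ : Fin m)
    (X : Matrix (Fin m) (Fin m) R) : Matrix (Fin m) (Fin m) R :=
  matDer (d μ) X + (Γ μ * X + X * (Γ μ).transpose)

theorem algebraMap_half_add : algebraMap ℝ R (1 / 2) + algebraMap ℝ R (1 / 2) = 1 := by
  rw [← map_add]; norm_num

/-- With its first index lowered the connection is S; in S + Sᵀ the two antisymmetric derivative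
terms cancel and ∂_μ g remains. -/
theorem isLeviCivita_christoffelMat {d : Fin m → Derivation ℝ R R}
    (hd : ∀ i j f, d i (d j f) = d j (d i f)) {g gi : Matrix (Fin m) (Fin m) R}
    (hg : g.transpose = g) (h : g * gi = 1) :
    IsLeviCivita d g gi (christoffelMat d g gi) := by
  have hg' : ∀ i j, g i j = g j i := fun i j => congrFun (congrFun hg j) i
  refine ⟨hd, hg, h, ?_, ?_⟩
  · intro μ κ ρ
    simp only [christoffelMat, Matrix.of_apply]
    congr 1
    refine Finset.sum_congr rfl fun l _ => ?_
    rw [hg' ρ μ]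
    ring
  · intro μ
    let S : Matrix (Fin m) (Fin m) R := Matrix.of fun l ρ =>
      algebraMap ℝ R (1 / 2) * (d ρ (g l μ) + d μ (g l ρ) - d l (g ρ μ))
    have hS : christoffelMat d g gi μ = gi * S := by
      ext κ ρ
      simp only [christoffelMat, Matrix.of_apply, Matrix.mul_apply, S, Finset.mul_sum]
      exact Finset.sum_congr rfl fun l _ => by ring
    have hgS : g * christoffelMat d g gi μ = S := by rw [hS, ← mul_assoc, h, one_mul]
    have hgS' : (christoffelMat d g gi μ).transpose * g = S.transpose := by
      rw [← hgS, Matrix.transpose_mul, hg]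
    rw [hgS, hgS']
    ext i j
    simp only [matDer_apply, Matrix.add_apply, Matrix.transpose_apply, S, Matrix.of_apply]
    rw [hg' j i]
    linear_combination (-d μ (g i j)) * algebraMap_half_add (R := R)

namespace IsLeviCivita

variable {d : Fin m → Derivation ℝ R R} {g gi : Matrix (Fin m) (Fin m) R}
  {Γ : Fin m → Matrix (Fin m) (Fin m) R}

theorem inv_mul (H : IsLeviCivita d g gi Γ) : gi * g = 1 := mul_eq_one_comm.mp H.mul_inv

theorem inv_symm (H : IsLeviCivita d g gi Γ) : gi.transpose = gi := by
  have h : gi.transpose * g = 1 := by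
    rw [← H.symm, ← Matrix.transpose_mul, H.mul_inv, Matrix.transpose_one]
  calc gi.transpose = gi.transpose * (g * gi) := by rw [H.mul_inv, mul_one]
    _ = gi := by rw [← mul_assoc, h, one_mul]

/-- Koszul's argument: in the combination ∂_ρ g_{lσ} + ∂_σ g_{lρ} - ∂_l g_{ρσ}, compatibility gives
six terms, four of which cancel by vanishing torsion. -/
theorem eq_christoffelMat (H : IsLeviCivita d g gi Γ) : Γ = christoffelMat d g gi := by
  have hs : ∀ σ l ν, (g * Γ σ) l ν = (g * Γ ν) l σ := by
    intro σ l ν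
    simp only [Matrix.mul_apply]
    exact Finset.sum_congr rfl fun k _ => by rw [H.torsion]
  have hc : ∀ σ l ν, d σ (g l ν) = (g * Γ σ) ν l + (g * Γ σ) l ν := by
    intro σ l ν
    have h1 := congrFun (congrFun (H.compat σ) l) ν
    have h2 : (Γ σ).transpose * g = (g * Γ σ).transpose := by
      rw [Matrix.transpose_mul, H.symm]
    rwa [h2] at h1
  funext σ
  have h3 : Γ σ = gi * (g * Γ σ) := by rw [← mul_assoc, H.inv_mul, one_mul]
  rw [h3]
  ext κ ρ
  rw [Matrix.mul_apply, christoffelMat, Matrix.of_apply, Finset.mul_sum]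
  refine Finset.sum_congr rfl fun l _ => ?_
  rw [hc, hc, hc, hs ρ σ l, hs ρ l σ, hs l ρ σ]
  linear_combination (-(gi κ l * (g * Γ σ) l ρ)) * algebraMap_half_add (R := R)

theorem matDer_inv (H : IsLeviCivita d g gi Γ) (μ : Fin m) :
    matDer (d μ) gi = -(Γ μ * gi + gi * (Γ μ).transpose) := by
  rw [matDer_inverse _ H.mul_inv, H.compat, mul_add, add_mul, mul_assoc, mul_assoc, H.mul_inv,
    mul_one, ← mul_assoc, H.inv_mul, one_mul, add_comm]

/-- The inverse metric is parallel, so raising an index turns the covariant derivative of an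
endomorphism, with its commutator [Γ, M], into that of a matrix with two upper indices. -/
theorem covDer_mul_inv (H : IsLeviCivita d g gi Γ) (μ : Fin m)
    (M : Matrix (Fin m) (Fin m) R) :
    covDer d Γ μ (M * gi) = (matDer (d μ) M + Γ μ * M - M * Γ μ) * gi := by
  rw [covDer, matDer_mul, H.matDer_inv]
  noncomm_ring

theorem matDer_comm (H : IsLeviCivita d g gi Γ) (μ ν : Fin m) (M : Matrix (Fin m) (Fin m) R) :
    matDer (d μ) (matDer (d ν) M) = matDer (d ν) (matDer (d μ) M) := by
  ext i j
  exact H.comm _ _ _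

/-- The commutator of covariant derivatives applied to the parallel matrix g⁻¹ is R g⁻¹ + g⁻¹ Rᵀ;
equality of the mixed derivatives of g⁻¹ says that it vanishes. -/
theorem riem_mul_inv_antisymm (H : IsLeviCivita d g gi Γ) (μ ν : Fin m) :
    (riem d Γ μ ν * gi).transpose = -(riem d Γ μ ν * gi) := by
  have h := H.matDer_comm μ ν gi
  rw [H.matDer_inv ν, H.matDer_inv μ] at h
  simp only [matDer_neg, matDer_add, matDer_mul, matDer_transpose, H.matDer_inv] at h
  rw [Matrix.transpose_mul, H.inv_symm, eq_neg_iff_add_eq_zero]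
  simp only [riem, Matrix.transpose_add, Matrix.transpose_sub, Matrix.transpose_mul]
  rw [← sub_eq_zero] at h
  rw [← neg_eq_zero, ← h]
  noncomm_ring

/-- The second Bianchi identity, with no connection terms for the form indices α, β, γ, as for an
exterior covariant derivative. It follows from the commutation of partial derivatives and the Jacobi
identity for matrices. -/
theorem bianchi (H : IsLeviCivita d g gi Γ) (α β γ : Fin m) :
    covDer d Γ α (riem d Γ β γ * gi) + covDer d Γ β (riem d Γ γ α * gi)
      + covDer d Γ γ (riem d Γ α β * gi) = 0 := by
  rw [H.covDer_mul_inv, H.covDer_mul_inv, H.covDer_mul_inv, ← add_mul, ← add_mul]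
  convert zero_mul gi
  simp only [riem, matDer_add, matDer_sub, matDer_mul]
  rw [H.matDer_comm β α, H.matDer_comm γ β, H.matDer_comm γ α]
  noncomm_ring

/-- The variation of `R^{κτ}_{μν}` under a further derivation `D`. -/
theorem derivation_riem_mul_inv (H : IsLeviCivita d g gi Γ) (D : Derivation ℝ R R)
    (hD : ∀ i f, D (d i f) = d i (D f)) (μ ν : Fin m) :
    matDer D (riem d Γ μ ν * gi) = covDer d Γ μ (matDer D (Γ ν) * gi)
      - covDer d Γ ν (matDer D (Γ μ) * gi) - riem d Γ μ ν * gi * (matDer D g * gi) := by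
  have hc : ∀ i (M : Matrix (Fin m) (Fin m) R),
      matDer D (matDer (d i) M) = matDer (d i) (matDer D M) := by
    intro i M
    ext
    exact hD _ _
  rw [H.covDer_mul_inv, H.covDer_mul_inv, matDer_mul, matDer_inverse D H.mul_inv]
  simp only [riem, matDer_add, matDer_sub, matDer_mul, hc]
  noncomm_ring

/-- The identity Γ^κ_{κμ} = ∂_μ log √|det g|, through which the density w supplies the trace term of
a covariant divergence. -/
theorem derivation_sqrt_det (H : IsLeviCivita d g gi Γ) {w w' : R} (hw : w ^ 4 = g.det ^ 2)
    (hw' : w * w' = 1) (μ : Fin m) : d μ w = w * (Γ μ).trace := by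
  have h := Lovelock.derivation_sqrt_det (d μ) H.mul_inv hw hw'
  have h2 : (gi * matDer (d μ) g).trace = 2 * (Γ μ).trace := by
    rw [H.compat, mul_add, Matrix.trace_add, Matrix.trace_mul_comm, mul_assoc, H.mul_inv, mul_one,
      Matrix.trace_transpose, ← mul_assoc, H.inv_mul, one_mul, two_mul]
  rw [h2] at h
  linear_combination algebraMap ℝ R (1 / 2) * h
    + (w * (Γ μ).trace - d μ w) * algebraMap_half_add (R := R)

end IsLeviCivita

end LeviCivita

/-! ### Contraction with the generalized Kronecker delta -/

section Contraction

variable {R : Type*} [CommRing R] [Algebra ℝ R] {m : ℕ} {κ : Type*} [Fintype κ] [DecidableEq κ]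

theorem eq_zero_of_eq_neg {a : R} (h : a = -a) : a = 0 := by
  linear_combination algebraMap ℝ R (1 / 2) * h - a * algebraMap_half_add (R := R)

/-- Exchanging x with the value of B at b is an involution of the pairs (B, x). This is the renaming
of a dummy index in one position. -/
theorem sum_update_swap {ι S : Type*} [Fintype ι] [DecidableEq ι] [AddCommMonoid S] (b : κ)
    (f : (κ → ι) → ι → S) :
    ∑ B, ∑ x, f B x = ∑ B, ∑ x, f (Function.update B b x) (B b) := by
  let e : (κ → ι) × ι ≃ (κ → ι) × ι :=
    { toFun := fun p => (Function.update p.1 b p.2, p.1 b)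
      invFun := fun p => (Function.update p.1 b p.2, p.1 b)
      left_inv := fun p => by simp
      right_inv := fun p => by simp }
  rw [← Fintype.sum_prod_type', ← Fintype.sum_prod_type', ← Equiv.sum_comp e]
  rfl

/-- The full contraction of `Z` with the generalized Kronecker delta. -/
def krSum (Z : (κ → Fin m) → (κ → Fin m) → R) : R :=
  ∑ A, ∑ B, algebraMap ℝ R (kronecker A B) * Z A B

theorem krSum_add (Z Z' : (κ → Fin m) → (κ → Fin m) → R) :
    krSum (fun A B => Z A B + Z' A B) = krSum Z + krSum Z' := by
  simp only [krSum, mul_add, Finset.sum_add_distrib]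

theorem krSum_sub (Z Z' : (κ → Fin m) → (κ → Fin m) → R) :
    krSum (fun A B => Z A B - Z' A B) = krSum Z - krSum Z' := by
  simp only [krSum, mul_sub, Finset.sum_sub_distrib]

theorem krSum_neg (Z : (κ → Fin m) → (κ → Fin m) → R) :
    krSum (fun A B => -Z A B) = -krSum Z := by
  simp only [krSum, mul_neg, Finset.sum_neg_distrib]

theorem krSum_mul_left (c : R) (Z : (κ → Fin m) → (κ → Fin m) → R) :
    krSum (fun A B => c * Z A B) = c * krSum Z := by
  simp only [krSum, Finset.mul_sum]
  exact Finset.sum_congr rfl fun A _ => Finset.sum_congr rfl fun B _ => by ring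

theorem krSum_sum {ι : Type*} (s : Finset ι) (Z : ι → (κ → Fin m) → (κ → Fin m) → R) :
    krSum (fun A B => ∑ i ∈ s, Z i A B) = ∑ i ∈ s, krSum (Z i) := by
  simp only [krSum, Finset.mul_sum]
  rw [Finset.sum_comm]
  rw [Finset.sum_congr rfl fun A _ => Finset.sum_comm]
  rw [Finset.sum_comm]
  exact Finset.sum_congr rfl fun i _ => Finset.sum_comm

theorem krSum_comp_perm (e : Equiv.Perm κ) (Z : (κ → Fin m) → (κ → Fin m) → R) :
    krSum (fun A B => Z (A ∘ e) B) = ((Equiv.Perm.sign e : ℤ) : R) * krSum Z := by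
  have h : ((Equiv.Perm.sign e : ℤ) : R) * ((Equiv.Perm.sign e : ℤ) : R) = 1 := by
    rw [← Int.cast_mul, ← Units.val_mul, Int.units_mul_self]; simp
  have h1 : ∀ A B : κ → Fin m, algebraMap ℝ R (kronecker A B)
      = ((Equiv.Perm.sign e : ℤ) : R) * algebraMap ℝ R (kronecker (A ∘ e) B) := by
    intro A B
    rw [kronecker_comp_perm, map_mul, map_intCast, ← mul_assoc, h, one_mul]
  rw [krSum, krSum, Finset.mul_sum]
  conv_rhs => rw [← Equiv.sum_comp (e.symm.arrowCongr (Equiv.refl (Fin m)))]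
  refine Finset.sum_congr rfl fun A _ => ?_
  rw [Finset.mul_sum]
  refine Finset.sum_congr rfl fun B _ => ?_
  rw [h1, mul_assoc]
  rfl

theorem krSum_flip (Z : (κ → Fin m) → (κ → Fin m) → R) :
    krSum (fun A B => Z B A) = krSum Z := by
  rw [krSum, krSum, Finset.sum_comm]
  simp_rw [kronecker_symm]

theorem krSum_comp_perm_right (e : Equiv.Perm κ) (Z : (κ → Fin m) → (κ → Fin m) → R) :
    krSum (fun A B => Z A (B ∘ e)) = ((Equiv.Perm.sign e : ℤ) : R) * krSum Z := by
  rw [← krSum_flip, krSum_comp_perm e fun A B => Z B A, krSum_flip]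

theorem krSum_comp_swap {a b : κ} (h : a ≠ b) (Z : (κ → Fin m) → (κ → Fin m) → R) :
    krSum (fun A B => Z (A ∘ Equiv.swap a b) B) = -krSum Z := by
  rw [krSum_comp_perm, Equiv.Perm.sign_swap h]; simp

theorem krSum_comp_swap_right {a b : κ} (h : a ≠ b) (Z : (κ → Fin m) → (κ → Fin m) → R) :
    krSum (fun A B => Z A (B ∘ Equiv.swap a b)) = -krSum Z := by
  rw [krSum_comp_perm_right, Equiv.Perm.sign_swap h]; simp

theorem krSum_comp_equiv {κ' : Type*} [Fintype κ'] [DecidableEq κ'] (e : κ' ≃ κ)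
    (Z : (κ' → Fin m) → (κ' → Fin m) → R) :
    krSum (fun A B : κ → Fin m => Z (A ∘ e) (B ∘ e)) = krSum Z := by
  rw [krSum, krSum, ← Equiv.sum_comp (e.symm.arrowCongr (Equiv.refl (Fin m)))]
  refine Finset.sum_congr rfl fun A _ => ?_
  rw [← Equiv.sum_comp (e.symm.arrowCongr (Equiv.refl (Fin m)))]
  refine Finset.sum_congr rfl fun B _ => ?_
  rw [← kronecker_comp_equiv e]
  rfl

/-- A 3-cycle is even, so the three rotated contractions are equal. Their sum vanishes and 3 is
invertible. This is how the Bianchi identity enters. -/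
theorem krSum_eq_zero_of_cyclic {o a b : κ} (hoa : o ≠ a) (hab : a ≠ b)
    (Z : (κ → Fin m) → (κ → Fin m) → R)
    (hZ : ∀ A B, Z A B + Z (A ∘ (Equiv.swap o a * Equiv.swap a b : Equiv.Perm κ)) B
      + Z (A ∘ (Equiv.swap o a * Equiv.swap a b : Equiv.Perm κ)
          ∘ (Equiv.swap o a * Equiv.swap a b : Equiv.Perm κ)) B = 0) :
    krSum Z = 0 := by
  set c : Equiv.Perm κ := Equiv.swap o a * Equiv.swap a b with hc
  have hs : ((Equiv.Perm.sign c : ℤ) : R) = 1 := by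
    rw [hc, map_mul, Equiv.Perm.sign_swap hoa, Equiv.Perm.sign_swap hab]; simp
  have h1 := krSum_comp_perm c Z
  have h2 := krSum_comp_perm c fun A B => Z (A ∘ c) B
  rw [hs, one_mul] at h1 h2
  rw [h1] at h2
  have h3 : krSum (fun A B => Z A B + Z (A ∘ c) B + Z (A ∘ c ∘ c) B) = 0 := by
    simp only [krSum]
    refine Finset.sum_eq_zero fun A _ => Finset.sum_eq_zero fun B _ => ?_
    rw [hZ, mul_zero]
  rw [krSum_add, krSum_add, h1] at h3
  change _ + krSum (fun A B => Z ((A ∘ c) ∘ c) B) = 0 at h3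
  rw [h2] at h3
  have hu : algebraMap ℝ R (1 / 3) * 3 = 1 := by
    rw [← map_ofNat (algebraMap ℝ R) 3, ← map_mul]; norm_num
  linear_combination algebraMap ℝ R (1 / 3) * h3 - krSum Z * hu

/-- Contraction with a symmetric connection of all the upper indices of `Z`, when the lower index
in the position `o` is a differentiation index. -/
theorem krSum_connection {Γ : Fin m → Matrix (Fin m) (Fin m) R}
    (hΓ : ∀ μ κ ρ, Γ μ κ ρ = Γ ρ κ μ) (o : κ) (Z : (κ → Fin m) → (κ → Fin m) → R)
    (hZ : ∀ A x B, Z (Function.update A o x) B = Z A B) :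
    krSum (fun A B => ∑ b, ∑ l, Γ (A o) (B b) l * Z A (Function.update B b l))
      = krSum fun A B => (Γ (A o)).trace * Z A B := by
  -- Renaming a dummy index moves Γ from Z to the lower indices of the delta, and the linear
  -- invariance of the delta moves it on to the upper ones.
  have h1 : ∀ A : κ → Fin m,
      ∑ B, algebraMap ℝ R (kronecker A B) *
          ∑ b, ∑ l, Γ (A o) (B b) l * Z A (Function.update B b l)
        = ∑ B, ∑ a, ∑ x, Z A B * (algebraMap ℝ R (kronecker (Function.update A a x) B)
            * Γ (A o) (A a) x) := by
    intro A
    simp only [Finset.mul_sum]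
    rw [Finset.sum_comm, Finset.sum_congr rfl fun b _ => sum_update_swap b _, Finset.sum_comm]
    refine Finset.sum_congr rfl fun B _ => ?_
    simp only [← Finset.mul_sum]
    rw [← sum_kronecker_update (Γ (A o)) A B, Finset.mul_sum]
    refine Finset.sum_congr rfl fun b _ => ?_
    rw [Finset.mul_sum]
    refine Finset.sum_congr rfl fun x _ => ?_
    simp only [Function.update_self, Function.update_idem, Function.update_eq_self]
    ring
  -- In the position o the symmetry of Γ produces its trace. In any other position Γ is symmetric in
  -- two dummy indices in which the delta is antisymmetric, so the term equals its own negative.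
  have h2 : ∀ (B : κ → Fin m) (a : κ),
      ∑ A : κ → Fin m, ∑ x, Z A B * (algebraMap ℝ R (kronecker (Function.update A a x) B)
            * Γ (A o) (A a) x)
        = if a = o then ∑ A, algebraMap ℝ R (kronecker A B) * ((Γ (A o)).trace * Z A B)
          else 0 := by
    intro B a
    rw [sum_update_swap o]
    split_ifs with h
    · subst h
      refine Finset.sum_congr rfl fun A _ => ?_
      rw [Matrix.trace, Finset.sum_mul, Finset.mul_sum]
      refine Finset.sum_congr rfl fun x _ => ?_
      simp only [hZ, Function.update_idem, Function.update_eq_self, Function.update_self,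
        Matrix.diag_apply]
      rw [hΓ x]
      ring
    · refine eq_zero_of_eq_neg ?_
      conv_rhs => rw [sum_update_swap o]
      rw [← Finset.sum_neg_distrib]
      refine Finset.sum_congr rfl fun A _ => ?_
      rw [← Finset.sum_neg_distrib]
      refine Finset.sum_congr rfl fun x _ => ?_
      simp only [hZ, Function.update_idem, Function.update_eq_self, Function.update_self,
        Function.update_of_ne h]
      rw [hΓ x]
      have h3 : Function.update (Function.update A o x) a (A o)
          = Function.update A a x ∘ Equiv.swap a o := by
        ext i
        congr 1
        by_cases hi : i = a
        · subst hi; simp [Function.update_of_ne (Ne.symm h)]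
        · by_cases hi' : i = o
          · subst hi'; simp [Function.update_of_ne hi]
          · simp [Function.update_of_ne hi, Function.update_of_ne hi',
              Equiv.swap_apply_of_ne_of_ne hi hi']
      rw [h3, kronecker_comp_swap h, map_neg]
      ring
  rw [krSum, Finset.sum_congr rfl fun A _ => h1 A, krSum]
  refine Finset.sum_comm.trans (Eq.trans ?_ Finset.sum_comm)
  refine Finset.sum_congr rfl fun B _ => Finset.sum_comm.trans ?_
  rw [Finset.sum_congr rfl fun a _ => h2 B a]
  simp

end Contraction

/-! ### Contractions of products of curvatures and the first variation -/

section Blocks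

variable {R : Type*} {m r : ℕ}

/-- The family of matrices `X_{αβ}` with the pairs of indices given by `A`. -/
def blocks (X : Fin m → Fin m → Matrix (Fin m) (Fin m) R) (A : Fin r × Fin 2 → Fin m) :
    Fin r → Matrix (Fin m) (Fin m) R :=
  fun j => X (A (j, 0)) (A (j, 1))

theorem blocks_swap (X : Fin m → Fin m → Matrix (Fin m) (Fin m) R) (k : Fin r)
    (A : Fin r × Fin 2 → Fin m) (M : Matrix (Fin m) (Fin m) R) :
    Function.update (blocks X (A ∘ Equiv.swap (k, 0) (k, 1))) k M
      = Function.update (blocks X A) k M := by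
  ext i : 1
  by_cases h : i = k
  · subst h; simp
  · rw [Function.update_of_ne h, Function.update_of_ne h]
    simp [blocks, Equiv.swap_apply_of_ne_of_ne, h]

variable [CommRing R]

/-- The product of the entries of the matrices `Q j` at the pairs of indices given by `B`. -/
def blockProd (Q : Fin r → Matrix (Fin m) (Fin m) R) (B : Fin r × Fin 2 → Fin m) : R :=
  ∏ j, Q j (B (j, 0)) (B (j, 1))

theorem blockProd_update (Q : Fin r → Matrix (Fin m) (Fin m) R) (j : Fin r)
    (M : Matrix (Fin m) (Fin m) R) (B : Fin r × Fin 2 → Fin m) :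
    blockProd (Function.update Q j M) B
      = M (B (j, 0)) (B (j, 1)) * ∏ i ∈ Finset.univ.erase j, Q i (B (i, 0)) (B (i, 1)) := by
  rw [blockProd, ← Finset.mul_prod_erase _ _ (Finset.mem_univ j)]
  congr 1
  · rw [Function.update_self]
  · exact Finset.prod_congr rfl fun i hi => by rw [Function.update_of_ne (Finset.ne_of_mem_erase hi)]

theorem blockProd_eq (Q : Fin r → Matrix (Fin m) (Fin m) R) (j : Fin r)
    (B : Fin r × Fin 2 → Fin m) :
    blockProd Q B
      = Q j (B (j, 0)) (B (j, 1)) * ∏ i ∈ Finset.univ.erase j, Q i (B (i, 0)) (B (i, 1)) := by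
  rw [← blockProd_update, Function.update_eq_self]

theorem blockProd_update_sub (Q : Fin r → Matrix (Fin m) (Fin m) R) (j : Fin r)
    (M N : Matrix (Fin m) (Fin m) R) (B : Fin r × Fin 2 → Fin m) :
    blockProd (Function.update Q j (M - N)) B
      = blockProd (Function.update Q j M) B - blockProd (Function.update Q j N) B := by
  simp only [blockProd_update, Matrix.sub_apply]
  ring

theorem prod_erase_update (Q : Fin r → Matrix (Fin m) (Fin m) R) (j : Fin r) (c : Fin 2)
    (B : Fin r × Fin 2 → Fin m) (x : Fin m) :
    ∏ i ∈ Finset.univ.erase j, Q i (Function.update B (j, c) x (i, 0))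
        (Function.update B (j, c) x (i, 1))
      = ∏ i ∈ Finset.univ.erase j, Q i (B (i, 0)) (B (i, 1)) := by
  refine Finset.prod_congr rfl fun i hi => ?_
  have h : ∀ c', (i, c') ≠ (j, c) := fun c' h => Finset.ne_of_mem_erase hi (congrArg Prod.fst h)
  rw [Function.update_of_ne (h 0), Function.update_of_ne (h 1)]

theorem blockProd_update_fst (Q : Fin r → Matrix (Fin m) (Fin m) R) (j : Fin r)
    (B : Fin r × Fin 2 → Fin m) (x : Fin m) :
    blockProd Q (Function.update B (j, 0) x)
      = Q j x (B (j, 1)) * ∏ i ∈ Finset.univ.erase j, Q i (B (i, 0)) (B (i, 1)) := by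
  rw [blockProd_eq Q j, prod_erase_update, Function.update_self,
    Function.update_of_ne (by simp : (j, (1 : Fin 2)) ≠ (j, 0))]

theorem blockProd_update_snd (Q : Fin r → Matrix (Fin m) (Fin m) R) (j : Fin r)
    (B : Fin r × Fin 2 → Fin m) (x : Fin m) :
    blockProd Q (Function.update B (j, 1) x)
      = Q j (B (j, 0)) x * ∏ i ∈ Finset.univ.erase j, Q i (B (i, 0)) (B (i, 1)) := by
  rw [blockProd_eq Q j, prod_erase_update, Function.update_self,
    Function.update_of_ne (by simp : (j, (0 : Fin 2)) ≠ (j, 1))]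

variable [Algebra ℝ R]

theorem derivation_blockProd (D : Derivation ℝ R R) (Q : Fin r → Matrix (Fin m) (Fin m) R)
    (B : Fin r × Fin 2 → Fin m) :
    D (blockProd Q B) = ∑ j, blockProd (Function.update Q j (matDer D (Q j))) B := by
  rw [blockProd, derivation_prod]
  refine Finset.sum_congr rfl fun j _ => Finset.prod_congr rfl fun i _ => ?_
  by_cases h : i = j
  · subst h; simp
  · simp [h]

/-- Leibniz rule: for each factor, the connection terms at its two positions are Γ Q and Q Γᵀ, which
complete the derivative to `covDer`. -/
theorem covDer_blockProd (d : Fin m → Derivation ℝ R R)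
    (Γ : Fin m → Matrix (Fin m) (Fin m) R) (μ : Fin m) (Q : Fin r → Matrix (Fin m) (Fin m) R)
    (B : Fin r × Fin 2 → Fin m) :
    d μ (blockProd Q B) + ∑ b, ∑ l, Γ μ (B b) l * blockProd Q (Function.update B b l)
      = ∑ j, blockProd (Function.update Q j (covDer d Γ μ (Q j))) B := by
  rw [derivation_blockProd, Fintype.sum_prod_type, ← Finset.sum_add_distrib]
  refine Finset.sum_congr rfl fun j _ => ?_
  simp only [Fin.sum_univ_two, blockProd_update_fst, blockProd_update_snd, blockProd_update,
    covDer, Matrix.add_apply, Matrix.mul_apply, Matrix.transpose_apply, add_mul, Finset.sum_mul]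
  congr 1
  congr 1
  · exact Finset.sum_congr rfl fun l _ => by ring
  · exact Finset.sum_congr rfl fun l _ => by ring

/-- The contraction `δ^{α₁β₁…}_{λ₁θ₁…} X^{λ₁θ₁}_{α₁β₁} ⋯`. -/
def lovScalar (r : ℕ) (X : Fin m → Fin m → Matrix (Fin m) (Fin m) R) : R :=
  krSum fun A B : Fin r × Fin 2 → Fin m => blockProd (blocks X A) B

/-- The contraction `δ^{μ α₁β₁…}_{ρ λ₁θ₁…} X^{λ₁θ₁}_{α₁β₁} ⋯`. -/
def lovMixed (r : ℕ) (X : Fin m → Fin m → Matrix (Fin m) (Fin m) R) (μ ρ : Fin m) : R :=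
  ∑ A : Fin r × Fin 2 → Fin m, ∑ B : Fin r × Fin 2 → Fin m,
    algebraMap ℝ R (kronecker (fun o : Option (Fin r × Fin 2) => o.elim μ A) fun o => o.elim ρ B)
      * blockProd (blocks X A) B

/-- The contraction in which, at the position `b`, the index of the curvature is `μ` and that of the
generalized Kronecker delta is `ρ`. -/
def lovPartial (X : Fin m → Fin m → Matrix (Fin m) (Fin m) R) (b : Fin r × Fin 2)
    (μ ρ : Fin m) : R :=
  krSum fun A B : Fin r × Fin 2 → Fin m =>
    if B b = ρ then blockProd (blocks X A) (Function.update B b μ) else 0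

/-- The delta is expanded along μ. In each term with a replaced lower index, a renaming of the dummy
index at b moves the replacement from the delta to the curvature. -/
theorem lovMixed_eq_sub (X : Fin m → Fin m → Matrix (Fin m) (Fin m) R) (μ ρ : Fin m) :
    lovMixed r X μ ρ = (if μ = ρ then lovScalar r X else 0)
      - ∑ b : Fin r × Fin 2, lovPartial X b μ ρ := by
  have h1 : ∀ b : Fin r × Fin 2, lovPartial X b μ ρ = ∑ A, ∑ B,
      algebraMap ℝ R ((if μ = B b then 1 else 0) * kronecker A (Function.update B b ρ))
        * blockProd (blocks X A) B := by
    intro b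
    rw [lovPartial, krSum]
    refine Finset.sum_congr rfl fun A _ => ?_
    trans ∑ B : Fin r × Fin 2 → Fin m, ∑ x, if B b = ρ ∧ x = μ then
      algebraMap ℝ R (kronecker A B) * blockProd (blocks X A) (Function.update B b x) else 0
    · refine Finset.sum_congr rfl fun B _ => ?_
      by_cases h : B b = ρ <;> simp [h]
    rw [sum_update_swap b]
    refine Finset.sum_congr rfl fun B _ => ?_
    by_cases h : μ = B b
    · simp [h]
    · simp [h, Ne.symm h]
  simp only [h1]
  have h2 : (if μ = ρ then lovScalar r X else 0)
      = ∑ A : Fin r × Fin 2 → Fin m, ∑ B, algebraMap ℝ R ((if μ = ρ then 1 else 0) * kronecker A B)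
        * blockProd (blocks X A) B := by
    split_ifs <;> simp [lovScalar, krSum]
  rw [h2, lovMixed, Finset.sum_comm (s := (Finset.univ : Finset (Fin r × Fin 2))),
    ← Finset.sum_sub_distrib]
  refine Finset.sum_congr rfl fun A _ => ?_
  rw [Finset.sum_comm (s := (Finset.univ : Finset (Fin r × Fin 2))), ← Finset.sum_sub_distrib]
  refine Finset.sum_congr rfl fun B _ => ?_
  rw [kronecker_option, map_sub, map_sum, sub_mul, Finset.sum_mul]

/-- Exchanging the two positions of block k changes the sign of both the delta and the curvature.
Thus the 2r partial contractions reduce to r of them, counted twice. -/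
theorem lovPartial_fst (X : Fin m → Fin m → Matrix (Fin m) (Fin m) R)
    (hX : ∀ α β, (X α β).transpose = -X α β) (k : Fin r) (μ ρ : Fin m) :
    lovPartial X (k, 0) μ ρ = lovPartial X (k, 1) μ ρ := by
  have hne : ((k, 0) : Fin r × Fin 2) ≠ (k, 1) := by simp
  rw [← neg_inj, lovPartial, ← krSum_comp_swap_right hne, lovPartial, ← krSum_neg]
  congr 1
  ext A B
  simp only [Function.comp_apply, Equiv.swap_apply_left]
  split_ifs with h
  · have hX' : ∀ i j, blocks X A k i j = -blocks X A k j i := fun i j => by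
      have := congrFun (congrFun (hX (A (k, 0)) (A (k, 1))) j) i
      simpa [blocks] using this
    rw [blockProd_update_fst, blockProd_update_snd, hX' (B (k, 0)), neg_mul, neg_neg,
      Function.comp_apply, Equiv.swap_apply_right]
    congr 1
    refine Finset.prod_congr rfl fun i hi => ?_
    have hi' := Finset.ne_of_mem_erase hi
    simp [Equiv.swap_apply_of_ne_of_ne, hi']
  · simp

theorem lovMixed_eq (X : Fin m → Fin m → Matrix (Fin m) (Fin m) R)
    (hX : ∀ α β, (X α β).transpose = -X α β) (μ ρ : Fin m) :
    lovMixed r X μ ρ = (if μ = ρ then lovScalar r X else 0)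
      - 2 * ∑ k : Fin r, lovPartial X (k, 1) μ ρ := by
  rw [lovMixed_eq_sub, Fintype.sum_prod_type, Finset.mul_sum]
  congr 1
  refine Finset.sum_congr rfl fun k _ => ?_
  rw [Fin.sum_univ_two, lovPartial_fst X hX, two_mul]

/-- The common mechanism of both equivalences: N is Dg · g⁻¹ in the first variation, the coefficient
matrix of the bracket in Ψ, or 1 when a trace is taken. -/
theorem krSum_update_mul (X : Fin m → Fin m → Matrix (Fin m) (Fin m) R)
    (N : Matrix (Fin m) (Fin m) R) (k : Fin r) :
    krSum (fun A B : Fin r × Fin 2 → Fin m =>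
        blockProd (Function.update (blocks X A) k (X (A (k, 0)) (A (k, 1)) * N)) B)
      = ∑ σ, ∑ τ, N σ τ * lovPartial X (k, 1) σ τ := by
  simp only [lovPartial, ← krSum_mul_left]
  simp only [← krSum_sum]
  congr 1
  ext A B
  rw [blockProd_update, Matrix.mul_apply, Finset.sum_mul]
  refine Finset.sum_congr rfl fun σ _ => ?_
  simp only [blockProd_update_snd, mul_ite, mul_zero, Finset.sum_ite_eq, Finset.mem_univ, if_true]
  simp only [blocks]
  ring

end Blocks

/-! ### The first variation of the Lovelock Lagrangian, modulo a divergence. -/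

section Variation

variable {R : Type*} [CommRing R] [Algebra ℝ R] {m : ℕ} {d : Fin m → Derivation ℝ R R}
  {g gi : Matrix (Fin m) (Fin m) R} {Γ : Fin m → Matrix (Fin m) (Fin m) R}

/-- `R^{κτ}_{μν}` as a matrix in `κ` and `τ`. -/
def riemUp (d : Fin m → Derivation ℝ R R) (gi : Matrix (Fin m) (Fin m) R)
    (Γ : Fin m → Matrix (Fin m) (Fin m) R) (μ ν : Fin m) : Matrix (Fin m) (Fin m) R :=
  riem d Γ μ ν * gi

theorem IsLeviCivita.krSum_bianchi (H : IsLeviCivita d g gi Γ) {r : ℕ}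
    (Y : Fin m → Matrix (Fin m) (Fin m) R) {j k : Fin r} (hjk : j ≠ k) :
    krSum (fun A B : Fin r × Fin 2 → Fin m => blockProd (Function.update
      (Function.update (blocks (riemUp d gi Γ) A) k (Y (A (k, 1)))) j
        (covDer d Γ (A (k, 0)) (riemUp d gi Γ (A (j, 0)) (A (j, 1))))) B) = 0 := by
  have h1 : ((k, 0) : Fin r × Fin 2) ≠ (j, 0) := by simp [hjk.symm]
  have h2 : ((j, 0) : Fin r × Fin 2) ≠ (j, 1) := by simp
  have h3 : ((k, 0) : Fin r × Fin 2) ≠ (j, 1) := by simp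
  -- The differentiation index, in the position (k, 0), is rotated with the two form indices of
  -- block j. The remaining factors, including Y in block k, do not contain these three indices.
  refine krSum_eq_zero_of_cyclic h1 h2 _ fun A B => ?_
  set c : Equiv.Perm (Fin r × Fin 2) := Equiv.swap (k, 0) (j, 0) * Equiv.swap (j, 0) (j, 1)
    with hc
  have c1 : c (k, 0) = (j, 0) := by
    rw [hc, Equiv.Perm.mul_apply, Equiv.swap_apply_of_ne_of_ne h1 h3, Equiv.swap_apply_left]
  have c2 : c (j, 0) = (j, 1) := by
    rw [hc, Equiv.Perm.mul_apply, Equiv.swap_apply_left, Equiv.swap_apply_of_ne_of_ne h3.symm h2.symm]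
  have c3 : c (j, 1) = (k, 0) := by
    rw [hc, Equiv.Perm.mul_apply, Equiv.swap_apply_right, Equiv.swap_apply_right]
  have c4 : ∀ p, p ≠ (k, 0) → p ≠ (j, 0) → p ≠ (j, 1) → c p = p := by
    intro p hp hp' hp''
    rw [hc, Equiv.Perm.mul_apply, Equiv.swap_apply_of_ne_of_ne hp' hp'',
      Equiv.swap_apply_of_ne_of_ne hp hp']
  have hinv : ∀ A' : Fin r × Fin 2 → Fin m,
      ∏ i ∈ Finset.univ.erase j, Function.update (blocks (riemUp d gi Γ) (A' ∘ c)) k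
          (Y ((A' ∘ c) (k, 1))) i (B (i, 0)) (B (i, 1))
        = ∏ i ∈ Finset.univ.erase j, Function.update (blocks (riemUp d gi Γ) A') k
          (Y (A' (k, 1))) i (B (i, 0)) (B (i, 1)) := by
    intro A'
    refine Finset.prod_congr rfl fun i hi => ?_
    have hij := Finset.ne_of_mem_erase hi
    by_cases hik : i = k
    · subst hik
      rw [Function.update_self, Function.update_self, Function.comp_apply,
        c4 (i, 1) (by simp) (by simp) (by simp [hij])]
    · rw [Function.update_of_ne hik, Function.update_of_ne hik, blocks, blocks,
        Function.comp_apply, Function.comp_apply, c4 (i, 0) (by simp [hik]) (by simp [hij]) (by simp),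
        c4 (i, 1) (by simp) (by simp) (by simp [hij])]
  rw [← Function.comp_assoc]
  simp only [blockProd_update]
  rw [hinv (A ∘ c), hinv A]
  simp only [Function.comp_apply, c1, c2, c3]
  rw [← add_mul, ← add_mul]
  have hb := congrFun (congrFun (H.bianchi (A (k, 0)) (A (j, 0)) (A (j, 1))) (B (j, 0))) (B (j, 1))
  simp only [Matrix.add_apply, Matrix.zero_apply] at hb
  simp only [riemUp]
  rw [hb, zero_mul]

/-- The derivative of w gives tr Γ, which `krSum_connection` converts into connection terms for all
upper curvature indices, so the divergence becomes covariant. Of the Leibniz terms only that of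
block k survives, the others vanishing by Bianchi. -/
theorem IsLeviCivita.sum_divergence (H : IsLeviCivita d g gi Γ) {w : R}
    (hw : ∀ μ, d μ w = w * (Γ μ).trace) {r : ℕ} (Y : Fin m → Matrix (Fin m) (Fin m) R)
    (k : Fin r) :
    krSum (fun A B : Fin r × Fin 2 → Fin m => d (A (k, 0)) (w * blockProd
        (Function.update (blocks (riemUp d gi Γ) A) k (Y (A (k, 1)))) B))
      = w * krSum fun A B : Fin r × Fin 2 → Fin m => blockProd
        (Function.update (blocks (riemUp d gi Γ) A) k
          (covDer d Γ (A (k, 0)) (Y (A (k, 1))))) B := by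
  set Q : (Fin r × Fin 2 → Fin m) → Fin r → Matrix (Fin m) (Fin m) R := fun A =>
    Function.update (blocks (riemUp d gi Γ) A) k (Y (A (k, 1))) with hQ
  have hQo : ∀ A x, Q (Function.update A (k, 0) x) = Q A := by
    intro A x
    ext i : 1
    by_cases h : i = k
    · subst h; simp [hQ]
    · simp [hQ, h, blocks]
  have h1 := krSum_connection H.torsion (k, 0) (fun A B => blockProd (Q A) B)
    fun A x B => by rw [hQo]
  have h2 : krSum (fun A B : Fin r × Fin 2 → Fin m => d (A (k, 0)) (w * blockProd (Q A) B))
      = w * (krSum (fun A B => d (A (k, 0)) (blockProd (Q A) B))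
        + krSum fun A B => (Γ (A (k, 0))).trace * blockProd (Q A) B) := by
    rw [← krSum_add, ← krSum_mul_left]
    congr 1
    ext A B
    rw [Derivation.leibniz, hw, smul_eq_mul, smul_eq_mul]
    ring
  rw [h2, ← h1, ← krSum_add]
  simp only [covDer_blockProd]
  rw [krSum_sum, Finset.sum_eq_single k]
  · simp [hQ]
  · intro j _ hjk
    rw [← H.krSum_bianchi Y hjk]
    simp only [hQ, Function.update_of_ne hjk]
    rfl
  · simp

/-- The vector field whose divergence appears in the first variation. -/
def boundaryField (r : ℕ) (d : Fin m → Derivation ℝ R R) (gi : Matrix (Fin m) (Fin m) R)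
    (Γ : Fin m → Matrix (Fin m) (Fin m) R) (w : R) (C : Fin m → Matrix (Fin m) (Fin m) R)
    (μ : Fin m) : R :=
  ∑ k : Fin r, krSum fun A B : Fin r × Fin 2 → Fin m => if μ = A (k, 0) then
    w * blockProd (Function.update (blocks (riemUp d gi Γ) A) k (C (A (k, 1)) * gi)) B else 0

theorem derivation_krSum (D : Derivation ℝ R R) {κ : Type*} [Fintype κ] [DecidableEq κ]
    (Z : (κ → Fin m) → (κ → Fin m) → R) : D (krSum Z) = krSum fun A B => D (Z A B) := by
  simp only [krSum, map_sum, Derivation.leibniz, Derivation.map_algebraMap, mul_zero, add_zero,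
    smul_eq_mul]

/-- The first variation of the Lovelock Lagrangian. -/
theorem IsLeviCivita.first_variation (H : IsLeviCivita d g gi Γ) {w w' : R}
    (hw : w ^ 4 = g.det ^ 2) (hw' : w * w' = 1) (D : Derivation ℝ R R)
    (hD : ∀ i f, D (d i f) = d i (D f)) (r : ℕ) :
    2 * D (w * lovScalar r (riemUp d gi Γ))
      = w * ∑ σ, ∑ τ, (matDer D g * gi) σ τ * lovMixed r (riemUp d gi Γ) σ τ
        + 4 * ∑ μ, d μ (boundaryField r d gi Γ w (fun ν => matDer D (Γ ν)) μ) := by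
  have hX : ∀ α β, (riemUp d gi Γ α β).transpose = -riemUp d gi Γ α β := H.riem_mul_inv_antisymm
  have hdiv : ∑ μ, d μ (boundaryField r d gi Γ w (fun ν => matDer D (Γ ν)) μ)
      = w * ∑ k : Fin r, krSum fun A B : Fin r × Fin 2 → Fin m => blockProd
        (Function.update (blocks (riemUp d gi Γ) A) k
          (covDer d Γ (A (k, 0)) (matDer D (Γ (A (k, 1))) * gi))) B := by
    rw [Finset.mul_sum]
    simp only [← H.sum_divergence (H.derivation_sqrt_det hw hw')
      (fun ν => matDer D (Γ ν) * gi)]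
    simp only [boundaryField, map_sum, derivation_krSum]
    rw [Finset.sum_comm]
    refine Finset.sum_congr rfl fun k _ => ?_
    rw [← krSum_sum]
    congr 1
    ext A B
    rw [Finset.sum_eq_single (A (k, 0))]
    · rw [if_pos rfl]
    · intro b _ hb
      rw [if_neg hb, map_zero]
    · simp
  -- The two covariant derivatives of DΓ differ by exchanging α_k and β_k, and the delta is
  -- antisymmetric in these; whence the factor 2.
  have hvar : D (lovScalar r (riemUp d gi Γ)) = ∑ k : Fin r,
      (2 * (krSum fun A B : Fin r × Fin 2 → Fin m => blockProd
        (Function.update (blocks (riemUp d gi Γ) A) k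
          (covDer d Γ (A (k, 0)) (matDer D (Γ (A (k, 1))) * gi))) B)
        - ∑ σ, ∑ τ, (matDer D g * gi) σ τ * lovPartial (riemUp d gi Γ) (k, 1) σ τ) := by
    rw [lovScalar, derivation_krSum]
    simp only [derivation_blockProd]
    rw [krSum_sum]
    refine Finset.sum_congr rfl fun k _ => ?_
    rw [← krSum_update_mul]
    have hne : ((k, 0) : Fin r × Fin 2) ≠ (k, 1) := by simp
    have hsw := krSum_comp_swap hne fun A B : Fin r × Fin 2 → Fin m => blockProd
        (Function.update (blocks (riemUp d gi Γ) A) k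
          (covDer d Γ (A (k, 0)) (matDer D (Γ (A (k, 1))) * gi))) B
    simp only [blocks_swap, Function.comp_apply, Equiv.swap_apply_left,
      Equiv.swap_apply_right] at hsw
    have hb : ∀ A : Fin r × Fin 2 → Fin m, matDer D (blocks (riemUp d gi Γ) A k) = _ := fun A =>
      H.derivation_riem_mul_inv D hD (A (k, 0)) (A (k, 1))
    trans krSum fun A B : Fin r × Fin 2 → Fin m =>
      blockProd (Function.update (blocks (riemUp d gi Γ) A) k
          (covDer d Γ (A (k, 0)) (matDer D (Γ (A (k, 1))) * gi))) B
        - blockProd (Function.update (blocks (riemUp d gi Γ) A) k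
          (covDer d Γ (A (k, 1)) (matDer D (Γ (A (k, 0))) * gi))) B
        - blockProd (Function.update (blocks (riemUp d gi Γ) A) k
          (riemUp d gi Γ (A (k, 0)) (A (k, 1)) * (matDer D g * gi))) B
    · congr 1
      ext A B
      rw [hb, blockProd_update_sub, blockProd_update_sub]
      rfl
    rw [krSum_sub, krSum_sub, hsw, two_mul, sub_neg_eq_add]
  -- The trace part of the mixed contraction is matched by the variation of the density, 2 Dw = w
  -- tr(g⁻¹ Dg), and the remainder by the terms R · Dg · g⁻¹.
  have hmix : ∑ σ, ∑ τ, (matDer D g * gi) σ τ * lovMixed r (riemUp d gi Γ) σ τ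
      = (gi * matDer D g).trace * lovScalar r (riemUp d gi Γ) - 2 * ∑ k : Fin r,
        ∑ σ, ∑ τ, (matDer D g * gi) σ τ * lovPartial (riemUp d gi Γ) (k, 1) σ τ := by
    simp only [lovMixed_eq _ hX, mul_sub, Finset.sum_sub_distrib]
    congr 1
    · rw [Matrix.trace_mul_comm, Matrix.trace, Finset.sum_mul]
      simp
    · simp only [Finset.mul_sum]
      refine (Finset.sum_congr rfl fun σ _ => Finset.sum_comm).trans ?_
      refine Finset.sum_comm.trans (Finset.sum_congr rfl fun k _ => ?_)
      exact Finset.sum_congr rfl fun σ _ => Finset.sum_congr rfl fun τ _ => by ring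
  have hw2 := Lovelock.derivation_sqrt_det D H.mul_inv hw hw'
  rw [Derivation.leibniz, smul_eq_mul, smul_eq_mul, hvar, hmix, hdiv, Finset.sum_sub_distrib,
    ← Finset.mul_sum]
  linear_combination lovScalar r (riemUp d gi Γ) * hw2

end Variation

/-! ### The algebra of smooth functions on an open set -/

section SmoothFun

variable {P : Type*} {O : Set P}

/-- Extension by zero of a function on `O`. -/
def extZero (f : O → ℝ) : P → ℝ := Function.extend Subtype.val f 0

@[simp]
theorem extZero_apply (f : O → ℝ) (p : O) : extZero f p = f p :=
  Subtype.val_injective.extend_apply f 0 p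

variable [NormedAddCommGroup P] [NormedSpace ℝ P]

variable (O) in
/-- The algebra of smooth functions on `O`. -/
def smoothFun : Subalgebra ℝ (O → ℝ) where
  carrier := {f | ContDiffOn ℝ ∞ (extZero f) O}
  mul_mem' {f g} hf hg := (ContDiffOn.mul hf hg).congr fun p hp => by
    rw [extZero_apply _ ⟨p, hp⟩, Pi.mul_apply, ← extZero_apply f, ← extZero_apply g]
  add_mem' {f g} hf hg := (ContDiffOn.add hf hg).congr fun p hp => by
    rw [extZero_apply _ ⟨p, hp⟩, Pi.add_apply, ← extZero_apply f, ← extZero_apply g]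
  algebraMap_mem' c := (contDiffOn_const (c := c)).congr fun p hp => by
    rw [extZero_apply _ ⟨p, hp⟩]
    rfl

theorem smoothFun.contDiffOn (f : smoothFun O) : ContDiffOn ℝ ∞ (extZero (f : O → ℝ)) O := f.2

/-- The restriction to `O` of a function which is smooth there. -/
def smoothFun.ofFun (F : P → ℝ) (hF : ContDiffOn ℝ ∞ F O) : smoothFun O :=
  ⟨fun p => F p, hF.congr fun p hp => extZero_apply _ ⟨p, hp⟩⟩

/-- Evaluation at a point. -/
def evalAt (p : O) : smoothFun O →ₐ[ℝ] ℝ := (Pi.evalAlgHom ℝ (fun _ : O => ℝ) p).comp (smoothFun O).val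

theorem smoothFun.ext_eval {f g : smoothFun O} (h : ∀ p, evalAt p f = evalAt p g) : f = g :=
  Subtype.ext (funext h)

@[simp]
theorem evalAt_ofFun (F : P → ℝ) (hF : ContDiffOn ℝ ∞ F O) (p : O) :
    evalAt p (smoothFun.ofFun F hF) = F p := rfl

theorem smoothFun.contDiffOn_of_eq (f : smoothFun O) {F : P → ℝ} (h : ∀ p : O, F p = evalAt p f) :
    ContDiffOn ℝ ∞ F O :=
  (smoothFun.contDiffOn f).congr fun p hp => (h ⟨p, hp⟩).trans (extZero_apply (f : O → ℝ) ⟨p, hp⟩).symm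

theorem contDiffOn_fderiv_apply {F : P → ℝ} (hO : IsOpen O) (hF : ContDiffOn ℝ ∞ F O) (v : P) :
    ContDiffOn ℝ ∞ (fun p => fderiv ℝ F p v) O :=
  (hF.fderiv_of_isOpen hO (m := ∞) (by simp)).clm_apply contDiffOn_const

theorem smoothFun.differentiableAt (hO : IsOpen O) (f : smoothFun O) (p : O) :
    DifferentiableAt ℝ (extZero (f : O → ℝ)) p :=
  ((smoothFun.contDiffOn f).contDiffAt (hO.mem_nhds p.2)).differentiableAt (by simp)

/-- O is a neighbourhood of each of its points, so the value 0 assigned outside O does not affect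
derivatives on O. -/
theorem fderiv_extZero {f : O → ℝ} {F : P → ℝ} (hO : IsOpen O) (p : O)
    (h : ∀ q : O, f q = F q) : fderiv ℝ (extZero f) p = fderiv ℝ F p := by
  refine Filter.EventuallyEq.fderiv_eq ?_
  filter_upwards [hO.mem_nhds p.2] with q hq
  rw [extZero_apply f ⟨q, hq⟩, h]

/-- The derivative in the direction `v`. -/
def dirDer (hO : IsOpen O) (v : P) : Derivation ℝ (smoothFun O) (smoothFun O) :=
  Derivation.mk'
    { toFun := fun f => smoothFun.ofFun (fun p => fderiv ℝ (extZero (f : O → ℝ)) p v)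
        (contDiffOn_fderiv_apply hO (smoothFun.contDiffOn f) v)
      map_add' := fun f g => smoothFun.ext_eval fun p => by
        rw [map_add, evalAt_ofFun, evalAt_ofFun, evalAt_ofFun, ← add_apply,
          ← fderiv_add (smoothFun.differentiableAt hO f p) (smoothFun.differentiableAt hO g p),
          fderiv_extZero hO p fun q => ?_]
        rw [Pi.add_apply, extZero_apply, extZero_apply]
        rfl
      map_smul' := fun c f => smoothFun.ext_eval fun p => by
        rw [RingHom.id_apply, map_smul, evalAt_ofFun, evalAt_ofFun, smul_eq_mul,
          ← smul_eq_mul, ← smul_apply, ← fderiv_const_smul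
          (smoothFun.differentiableAt hO f p),
          fderiv_extZero hO p fun q => ?_]
        rw [Pi.smul_apply, extZero_apply]
        rfl }
    fun f g => smoothFun.ext_eval fun p => by
      simp only [LinearMap.coe_mk, AddHom.coe_mk, evalAt_ofFun, map_add, smul_eq_mul, map_mul]
      rw [fderiv_extZero (F := fun q => extZero (f : O → ℝ) q * extZero (g : O → ℝ) q) hO p
          fun q => ?_, fderiv_fun_mul (smoothFun.differentiableAt hO f p) (smoothFun.differentiableAt hO g p)]
      · simp only [add_apply, smul_apply, smul_eq_mul,
          extZero_apply]
        rfl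
      · simp only [extZero_apply]
        rfl

theorem evalAt_dirDer (hO : IsOpen O) (v : P) (f : smoothFun O) (p : O) :
    evalAt p (dirDer hO v f) = fderiv ℝ (extZero (f : O → ℝ)) p v := rfl

theorem evalAt_dirDer_of_eq (hO : IsOpen O) (v : P) (f : smoothFun O) {F : P → ℝ}
    (h : ∀ q : O, evalAt q f = F q) (p : O) : evalAt p (dirDer hO v f) = fderiv ℝ F p v := by
  rw [evalAt_dirDer, fderiv_extZero (f := (f : O → ℝ)) hO p h]

/-- Symmetry of the second derivative of a smooth function. -/
theorem dirDer_comm (hO : IsOpen O) (v w : P) (f : smoothFun O) :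
    dirDer hO v (dirDer hO w f) = dirDer hO w (dirDer hO v f) := by
  refine smoothFun.ext_eval fun p => ?_
  set F := extZero (f : O → ℝ)
  have hF : ContDiffAt ℝ ∞ F p := (smoothFun.contDiffOn f).contDiffAt (hO.mem_nhds p.2)
  have hd : DifferentiableAt ℝ (fderiv ℝ F) p :=
    (hF.fderiv_right (m := ∞) (by simp)).differentiableAt (by simp)
  have key : ∀ a b : P, evalAt p (dirDer hO a (dirDer hO b f)) = fderiv ℝ (fderiv ℝ F) p a b := by
    intro a b
    rw [evalAt_dirDer_of_eq hO a (dirDer hO b f) (F := fun q => fderiv ℝ F q b)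
      (fun q => evalAt_dirDer hO b f q)]
    rw [fderiv_clm_apply hd (differentiableAt_const b)]
    simp
  rw [key, key]
  exact (hF.isSymmSndFDerivAt (by simpa using ENat.LEInfty.out)) v w

end SmoothFun

/-! ### Comparison with curvature, Lovelock tensor and Lagrangian in coordinates -/

section Comparison

variable {P : Type*} [NormedAddCommGroup P] [NormedSpace ℝ P] {O : Set P} {m : ℕ}

/-- The partial derivatives along the directions `j (∂_μ)`. -/
def coordDer (hO : IsOpen O) (j : (Fin m → ℝ) →L[ℝ] P) (μ : Fin m) :
    Derivation ℝ (smoothFun O) (smoothFun O) :=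
  dirDer hO (j (Pi.single μ 1))

variable (hO : IsOpen O) {j : (Fin m → ℝ) →L[ℝ] P} {T : (Fin m → ℝ) → P}

/-- The chain rule along T, which is either the identity of the chart or a slice x ↦ (t, x). One
algebraic computation on O thereby serves a fixed metric and a family of metrics. -/
theorem pderiv_eq_evalAt (hT : ∀ x, HasFDerivAt T j x)
    (μ : Fin m) {F : (Fin m → ℝ) → ℝ} {f : smoothFun O}
    (hF : ∀ x (hx : T x ∈ O), F x = evalAt ⟨T x, hx⟩ f) {y : Fin m → ℝ} (hy : T y ∈ O) :
    pderiv μ F y = evalAt ⟨T y, hy⟩ (coordDer hO j μ f) := by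
  have h1 : F =ᶠ[nhds y] extZero (f : O → ℝ) ∘ T := by
    filter_upwards [(hT y).continuousAt.preimage_mem_nhds (hO.mem_nhds hy)] with x hx
    rw [hF x hx, Function.comp_apply, extZero_apply (f : O → ℝ) ⟨T x, hx⟩]
    rfl
  have h2 := (smoothFun.differentiableAt hO f ⟨T y, hy⟩).hasFDerivAt.comp y (hT y)
  rw [pderiv, h1.fderiv_eq, h2.fderiv, coordDer, evalAt_dirDer]
  rfl

variable {g : (Fin m → ℝ) → Matrix (Fin m) (Fin m) ℝ}
  {G Gi : Matrix (Fin m) (Fin m) (smoothFun O)}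

theorem christoffel_eq_evalAt (hT : ∀ x, HasFDerivAt T j x)
    (hg : ∀ x (hx : T x ∈ O), g x = G.map (evalAt ⟨T x, hx⟩))
    (hgi : ∀ x (hx : T x ∈ O), (g x)⁻¹ = Gi.map (evalAt ⟨T x, hx⟩)) (μ ν σ : Fin m)
    {y : Fin m → ℝ} (hy : T y ∈ O) :
    christoffel g μ ν σ y
      = evalAt ⟨T y, hy⟩ (christoffelMat (coordDer hO j) G Gi σ μ ν) := by
  have h : ∀ μ a b, pderiv μ (fun x => g x a b) y = evalAt ⟨T y, hy⟩ (coordDer hO j μ (G a b)) :=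
    fun μ a b => pderiv_eq_evalAt hO hT μ (fun x hx => by rw [hg x hx]; rfl) hy
  simp only [christoffel, christoffelMat, Matrix.of_apply, map_mul, map_sum, map_sub, map_add,
    AlgHom.commutes, h, hgi y hy, Matrix.map_apply]
  rfl

variable {Γ : Fin m → Fin m → Fin m → (Fin m → ℝ) → ℝ}
  {ΓM : Fin m → Matrix (Fin m) (Fin m) (smoothFun O)}

theorem curvatureUp_eq_evalAt (hT : ∀ x, HasFDerivAt T j x)
    (hgi : ∀ x (hx : T x ∈ O), (g x)⁻¹ = Gi.map (evalAt ⟨T x, hx⟩))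
    (hΓ : ∀ μ ν σ x (hx : T x ∈ O), Γ μ ν σ x = evalAt ⟨T x, hx⟩ (ΓM σ μ ν)) (κ τ μ ν : Fin m)
    {y : Fin m → ℝ} (hy : T y ∈ O) :
    curvatureUp g Γ κ τ μ ν y
      = evalAt ⟨T y, hy⟩ (riemUp (coordDer hO j) Gi ΓM μ ν κ τ) := by
  have h : ∀ α a b c, pderiv α (Γ a b c) y = evalAt ⟨T y, hy⟩ (coordDer hO j α (ΓM c a b)) :=
    fun α a b c => pderiv_eq_evalAt hO hT α (fun x hx => hΓ a b c x hx) hy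
  simp only [curvatureUp, curvature, riemUp, riem, Matrix.mul_apply, Matrix.add_apply,
    Matrix.sub_apply, matDer_apply, map_sum, map_mul, map_add, map_sub, h, hgi y hy,
    Matrix.map_apply, hΓ _ _ _ y hy, Finset.sum_sub_distrib]
  exact Finset.sum_congr rfl fun ρ _ => by ring

theorem lovelockTensor_eq_evalAt (hT : ∀ x, HasFDerivAt T j x)
    (hgi : ∀ x (hx : T x ∈ O), (g x)⁻¹ = Gi.map (evalAt ⟨T x, hx⟩))
    (hΓ : ∀ μ ν σ x (hx : T x ∈ O), Γ μ ν σ x = evalAt ⟨T x, hx⟩ (ΓM σ μ ν)) (r : ℕ)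
    (μ ν : Fin m) {y : Fin m → ℝ} (hy : T y ∈ O) :
    lovelockTensor r g Γ μ ν y = evalAt ⟨T y, hy⟩
      (∑ ρ, (lovMixed r (riemUp (coordDer hO j) Gi ΓM) μ ρ * Gi ρ ν
        + lovMixed r (riemUp (coordDer hO j) Gi ΓM) ν ρ * Gi ρ μ)) := by
  simp only [lovelockTensor, lovMixed, map_sum, map_add, map_mul, AlgHom.commutes, blockProd,
    map_prod, blocks, curvatureUp_eq_evalAt hO hT hgi hΓ _ _ _ _ hy, hgi y hy, Matrix.map_apply,
    Finset.sum_mul, ← Finset.sum_add_distrib]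
  refine Finset.sum_congr rfl fun ρ _ => Finset.sum_congr rfl fun A _ =>
    Finset.sum_congr rfl fun B _ => ?_
  simp only [Algebra.algebraMap_self, RingHom.id_apply]
  ring

theorem lovelockDensity_eq_evalAt (hT : ∀ x, HasFDerivAt T j x)
    (hg : ∀ x (hx : T x ∈ O), g x = G.map (evalAt ⟨T x, hx⟩))
    (hgi : ∀ x (hx : T x ∈ O), (g x)⁻¹ = Gi.map (evalAt ⟨T x, hx⟩)) (r : ℕ)
    {w : smoothFun O} (hw : ∀ x (hx : T x ∈ O), Real.sqrt |(g x).det| = evalAt ⟨T x, hx⟩ w)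
    {y : Fin m → ℝ} (hy : T y ∈ O) :
    lovelockDensity r g y = evalAt ⟨T y, hy⟩
      (w * lovScalar r (riemUp (coordDer hO j) Gi (christoffelMat (coordDer hO j) G Gi))) := by
  simp only [lovelockDensity, lovScalar, krSum, map_sum, map_mul, AlgHom.commutes, blockProd,
    map_prod, blocks, hw y hy, curvatureUp_eq_evalAt hO hT hgi
      (fun μ ν σ x hx => christoffel_eq_evalAt hO hT hg hgi μ ν σ hx) _ _ _ _ hy]
  rfl

end Comparison

/-! ### The Euler-Lagrange equations of the Lovelock Lagrangian -/

section SmoothMetric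

variable {P : Type*} [NormedAddCommGroup P] [NormedSpace ℝ P] {O : Set P} {m : ℕ}

/-- A smooth field of nondegenerate symmetric matrices on `O`, with its inverse and its volume
density. -/
structure SmoothMetric (O : Set P) (Gf : P → Matrix (Fin m) (Fin m) ℝ) where
  G : Matrix (Fin m) (Fin m) (smoothFun O)
  Gi : Matrix (Fin m) (Fin m) (smoothFun O)
  w : smoothFun O
  winv : smoothFun O
  G_eval : ∀ p : O, Gf p = G.map (evalAt p)
  Gi_eval : ∀ p : O, (Gf p)⁻¹ = Gi.map (evalAt p)
  w_eval : ∀ p : O, Real.sqrt |(Gf p).det| = evalAt p w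
  mul_inv : G * Gi = 1
  pow_w : w ^ 4 = G.det ^ 2
  mul_w : w * winv = 1
  symm : G.transpose = G

theorem evalAt_matrix_ext {M N : Matrix (Fin m) (Fin m) (smoothFun O)}
    (h : ∀ p : O, M.map (evalAt p) = N.map (evalAt p)) : M = N := by
  ext1 i j
  exact smoothFun.ext_eval fun p => congrFun (congrFun (h p) i) j

theorem map_evalAt_mul (M N : Matrix (Fin m) (Fin m) (smoothFun O)) (p : O) :
    (M * N).map (evalAt p) = M.map (evalAt p) * N.map (evalAt p) :=
  Matrix.map_mul (f := (evalAt p).toRingHom)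

/-- A matrix whose entries are smooth, as a matrix over the algebra of smooth functions. -/
def smoothMat (Gf : P → Matrix (Fin m) (Fin m) ℝ)
    (h : ∀ i j, ContDiffOn ℝ ∞ (fun p => Gf p i j) O) : Matrix (Fin m) (Fin m) (smoothFun O) :=
  Matrix.of fun i j => smoothFun.ofFun (fun p => Gf p i j) (h i j)

theorem smoothMat_eval (Gf : P → Matrix (Fin m) (Fin m) ℝ)
    (h : ∀ i j, ContDiffOn ℝ ∞ (fun p => Gf p i j) O) (p : O) :
    (smoothMat Gf h).map (evalAt p) = Gf p := rfl

theorem contDiffOn_det {Gf : P → Matrix (Fin m) (Fin m) ℝ}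
    (h : ∀ i j, ContDiffOn ℝ ∞ (fun p => Gf p i j) O) : ContDiffOn ℝ ∞ (fun p => (Gf p).det) O :=
  smoothFun.contDiffOn_of_eq (smoothMat Gf h).det fun p => by
    rw [AlgHom.map_det, AlgHom.mapMatrix_apply, smoothMat_eval]

theorem contDiffOn_matrix_inv {Gf : P → Matrix (Fin m) (Fin m) ℝ}
    (h : ∀ i j, ContDiffOn ℝ ∞ (fun p => Gf p i j) O) (hd : ∀ p ∈ O, (Gf p).det ≠ 0)
    (i j : Fin m) : ContDiffOn ℝ ∞ (fun p => (Gf p)⁻¹ i j) O := by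
  have h1 : ContDiffOn ℝ ∞ (fun p => (Gf p).adjugate i j) O :=
    smoothFun.contDiffOn_of_eq ((smoothMat Gf h).adjugate i j) fun p => by
      have := AlgHom.map_adjugate (evalAt p) (smoothMat Gf h)
      rw [AlgHom.mapMatrix_apply, AlgHom.mapMatrix_apply, smoothMat_eval] at this
      rw [← this, Matrix.map_apply]
  refine (((contDiffOn_det h).inv hd).mul h1).congr fun p _ => ?_
  rw [Matrix.inv_def, Matrix.smul_apply, Ring.inverse_eq_inv', smul_eq_mul]
  rfl

/-- The data attached to a smooth field of nondegenerate symmetric matrices. -/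
def SmoothMetric.of (Gf : P → Matrix (Fin m) (Fin m) ℝ)
    (h : ∀ i j, ContDiffOn ℝ ∞ (fun p => Gf p i j) O) (hd : ∀ p ∈ O, (Gf p).det ≠ 0)
    (hs : ∀ p ∈ O, (Gf p).transpose = Gf p) : SmoothMetric O Gf :=
  have hw : ContDiffOn ℝ ∞ (fun p => Real.sqrt |(Gf p).det|) O :=
    ((contDiffOn_det h).norm ℝ hd).sqrt fun p hp => norm_ne_zero_iff.mpr (hd p hp)
  have hw0 : ∀ p ∈ O, Real.sqrt |(Gf p).det| ≠ 0 := fun p hp =>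
    (Real.sqrt_pos.mpr (abs_pos.mpr (hd p hp))).ne'
  { G := smoothMat Gf h
    Gi := smoothMat (fun p => (Gf p)⁻¹) (contDiffOn_matrix_inv h hd)
    w := smoothFun.ofFun _ hw
    winv := smoothFun.ofFun _ (hw.inv hw0)
    G_eval := fun p => rfl
    Gi_eval := fun p => rfl
    w_eval := fun p => rfl
    mul_inv := evalAt_matrix_ext fun p => by
      rw [map_evalAt_mul, smoothMat_eval, smoothMat_eval,
        Matrix.mul_nonsing_inv _ (isUnit_iff_ne_zero.mpr (hd p p.2)),
        Matrix.map_one _ (map_zero _) (map_one _)]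
    pow_w := smoothFun.ext_eval fun p => by
      rw [map_pow, map_pow, AlgHom.map_det, AlgHom.mapMatrix_apply, smoothMat_eval, evalAt_ofFun,
        show 4 = 2 * 2 from rfl, pow_mul, Real.sq_sqrt (abs_nonneg _), sq_abs]
    mul_w := smoothFun.ext_eval fun p => by
      rw [map_mul, evalAt_ofFun, evalAt_ofFun, map_one]
      exact mul_inv_cancel₀ (hw0 p p.2)
    symm := evalAt_matrix_ext fun p => by
      rw [Matrix.transpose_map, smoothMat_eval, hs p p.2] }

theorem SmoothMetric.isLeviCivita {Gf : P → Matrix (Fin m) (Fin m) ℝ} (S : SmoothMetric O Gf)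
    (hO : IsOpen O) (j : (Fin m → ℝ) →L[ℝ] P) :
    IsLeviCivita (coordDer hO j) S.G S.Gi (christoffelMat (coordDer hO j) S.G S.Gi) :=
  isLeviCivita_christoffelMat (fun _ _ _ => dirDer_comm hO _ _ _) S.symm S.mul_inv

end SmoothMetric

/-! ### The family g + th as a metric in the variables (t, y). -/

section Variation

variable {m : ℕ}

/-- Integration by parts against the constant function 1. -/
theorem integral_fderiv_eq_zero {F : (Fin m → ℝ) → ℝ} (hF : ContDiff ℝ 1 F)
    (hc : HasCompactSupport F) (v : Fin m → ℝ) : ∫ y, fderiv ℝ F y v = 0 := by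
  have h1 : Continuous fun y => fderiv ℝ F y v :=
    (hF.continuous_fderiv one_ne_zero).clm_apply continuous_const
  have h2 : MeasureTheory.Integrable fun y => fderiv ℝ F y v :=
    h1.integrable_of_hasCompactSupport (hc.fderiv_apply (𝕜 := ℝ) v)
  have h := integral_mul_fderiv_eq_neg_fderiv_mul_of_integrable (μ := MeasureTheory.volume)
    (f := fun _ : Fin m → ℝ => (1 : ℝ)) (g := F) (v := v) (by simp)
    (by simpa using h2) (by simpa using hF.continuous.integrable_of_hasCompactSupport hc)
    (fun x _ => differentiableAt_const _) (fun x _ => hF.differentiable one_ne_zero x)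
  simpa using h

theorem lovelockTensor_symm (r : ℕ) (g : (Fin m → ℝ) → Matrix (Fin m) (Fin m) ℝ)
    (Γ : Fin m → Fin m → Fin m → (Fin m → ℝ) → ℝ) (μ ν : Fin m) (y : Fin m → ℝ) :
    lovelockTensor r g Γ μ ν y = lovelockTensor r g Γ ν μ y := by
  simp only [lovelockTensor]
  refine Finset.sum_congr rfl fun ρ _ => Finset.sum_congr rfl fun A _ =>
    Finset.sum_congr rfl fun B _ => ?_
  ring

variable {g h : (Fin m → ℝ) → Matrix (Fin m) (Fin m) ℝ} {V K : Set (Fin m → ℝ)}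

/-- The variation `g + t h` of the metric as a function of `(t, y)`. -/
def varied (g h : (Fin m → ℝ) → Matrix (Fin m) (Fin m) ℝ) (p : ℝ × (Fin m → ℝ)) :
    Matrix (Fin m) (Fin m) ℝ :=
  g p.2 + p.1 • h p.2

/-- The set of the pairs `(t, y)` for which `g + t h` is nondegenerate at `y ∈ V`. -/
def variedDom (g h : (Fin m → ℝ) → Matrix (Fin m) (Fin m) ℝ) (V : Set (Fin m → ℝ)) :
    Set (ℝ × (Fin m → ℝ)) :=
  {p | p.2 ∈ V ∧ (varied g h p).det ≠ 0}

theorem contDiffOn_varied (hg : ∀ i j, ContDiffOn ℝ ∞ (fun y => g y i j) V)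
    (hh : ∀ i j, ContDiff ℝ ∞ fun y => h y i j) (i j : Fin m) :
    ContDiffOn ℝ ∞ (fun p => varied g h p i j) (Prod.snd ⁻¹' V) := by
  simp only [varied, Matrix.add_apply, Matrix.smul_apply, smul_eq_mul]
  exact ((hg i j).comp contDiffOn_snd fun p hp => hp).add
    (contDiffOn_fst.mul ((hh i j).contDiffOn.comp contDiffOn_snd fun p _ => Set.mem_univ _))

theorem isOpen_variedDom (hV : IsOpen V) (hg : ∀ i j, ContDiffOn ℝ ∞ (fun y => g y i j) V)
    (hh : ∀ i j, ContDiff ℝ ∞ fun y => h y i j) : IsOpen (variedDom g h V) :=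
  (contDiffOn_det (contDiffOn_varied hg hh)).continuousOn.isOpen_inter_preimage
    (hV.preimage continuous_snd) isOpen_ne

end Variation

section Variation

variable {m : ℕ} {g h : (Fin m → ℝ) → Matrix (Fin m) (Fin m) ℝ} {V K : Set (Fin m → ℝ)}

theorem varied_zero (y : Fin m → ℝ) : varied g h (0, y) = g y := by simp [varied]

theorem mem_variedDom_zero (hd : ∀ y ∈ V, (g y).det ≠ 0) {y : Fin m → ℝ} (hy : y ∈ V) :
    ((0 : ℝ), y) ∈ variedDom g h V := ⟨hy, by rw [varied_zero]; exact hd y hy⟩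

theorem evalAt_derivation_varied (S : SmoothMetric (variedDom g h V) (varied g h))
    (hO : IsOpen (variedDom g h V)) (p : variedDom g h V) (i j : Fin m) :
    evalAt p (dirDer hO (1, 0) (S.G i j)) = h p.1.2 i j := by
  have h1 := smoothFun.differentiableAt hO (S.G i j) p
  rw [evalAt_dirDer, ← h1.lineDeriv_eq_fderiv]
  have h2 : HasDerivAt (fun t : ℝ => g p.1.2 i j + (p.1.1 + t) * h p.1.2 i j) (h p.1.2 i j) 0 := by
    simpa using (((hasDerivAt_id (0 : ℝ)).const_add p.1.1).mul_const (h p.1.2 i j)).const_add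
      (g p.1.2 i j)
  rw [lineDeriv, ← h2.deriv]
  refine Filter.EventuallyEq.deriv_eq ?_
  have hc : ContinuousAt (fun t : ℝ => (p : ℝ × (Fin m → ℝ)) + t • ((1 : ℝ), (0 : Fin m → ℝ))) 0 := by
    fun_prop
  have hmem : variedDom g h V
      ∈ nhds ((p : ℝ × (Fin m → ℝ)) + (0 : ℝ) • ((1 : ℝ), (0 : Fin m → ℝ))) := by
    rw [zero_smul, add_zero]; exact hO.mem_nhds p.2
  filter_upwards [hc.preimage_mem_nhds hmem] with t ht
  rw [extZero_apply (S.G i j : variedDom g h V → ℝ) ⟨_, ht⟩]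
  have := congrFun (congrFun (S.G_eval ⟨_, ht⟩) i) j
  rw [Matrix.map_apply] at this
  refine this.symm.trans ?_
  simp [varied]

/-- `∂Γ/∂t` vanishes where the variation of the metric vanishes in a neighbourhood. -/
theorem evalAt_derivation_christoffel (S : SmoothMetric (variedDom g h V) (varied g h))
    (hO : IsOpen (variedDom g h V)) (p : variedDom g h V) (hp : p.1.2 ∉ tsupport h)
    (ν κ ρ : Fin m) :
    evalAt p (dirDer hO (1, 0) (christoffelMat
      (coordDer hO (ContinuousLinearMap.inr ℝ ℝ (Fin m → ℝ))) S.G S.Gi ν κ ρ)) = 0 := by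
  set d := coordDer hO (ContinuousLinearMap.inr ℝ ℝ (Fin m → ℝ))
  set D := dirDer hO ((1 : ℝ), (0 : Fin m → ℝ))
  have h0 : ∀ i j, evalAt p (D (S.G i j)) = 0 := by
    intro i j
    rw [evalAt_derivation_varied, image_eq_zero_of_notMem_tsupport hp, Matrix.zero_apply]
  have h1 : ∀ i j, evalAt p (D (S.Gi i j)) = 0 := by
    intro i j
    have e := congrFun (congrFun (matDer_inverse D S.mul_inv) i) j
    rw [matDer_apply] at e
    rw [e, Matrix.neg_apply, map_neg, neg_eq_zero, Matrix.mul_apply, map_sum]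
    refine Finset.sum_eq_zero fun b _ => ?_
    rw [map_mul, Matrix.mul_apply, map_sum, Finset.sum_eq_zero, zero_mul]
    intro a _
    rw [map_mul, matDer_apply, h0, mul_zero]
  -- Here vanishing near the point is needed, not only at it: ∂_t ∂_μ g = ∂_μ h.
  have h2 : ∀ μ i j, evalAt p (D (d μ (S.G i j))) = 0 := by
    intro μ i j
    have hT : ∀ x, HasFDerivAt (fun x : Fin m → ℝ => (p.1.1, x))
      (ContinuousLinearMap.inr ℝ ℝ (Fin m → ℝ)) x := fun x => hasFDerivAt_prodMk_right _ _
    have e := pderiv_eq_evalAt hO hT μ (F := fun x => h x i j) (f := D (S.G i j))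
      (fun x hx => (evalAt_derivation_varied S hO ⟨_, hx⟩ i j).symm) (y := p.1.2) p.2
    rw [show D (d μ (S.G i j)) = d μ (D (S.G i j)) from dirDer_comm hO _ _ _]
    refine e.symm.trans ?_
    have hz : (fun x => h x i j) =ᶠ[nhds p.1.2] fun _ => 0 := by
      filter_upwards [(isClosed_tsupport h).isOpen_compl.mem_nhds hp] with x hx
      rw [image_eq_zero_of_notMem_tsupport hx, Matrix.zero_apply]
    rw [pderiv, hz.fderiv_eq]
    simp
  simp only [christoffelMat, Matrix.of_apply, Derivation.leibniz, Derivation.map_algebraMap,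
    map_sum, smul_eq_mul, map_add, map_mul, map_sub, h1, h2]
  simp

/-- Every term of the boundary field contains an entry of ∂Γ/∂t as a factor. -/
theorem evalAt_boundaryField (S : SmoothMetric (variedDom g h V) (varied g h))
    (hO : IsOpen (variedDom g h V)) (r : ℕ) (p : variedDom g h V) (hp : p.1.2 ∉ tsupport h)
    (μ : Fin m) :
    evalAt p (boundaryField r (coordDer hO (ContinuousLinearMap.inr ℝ ℝ (Fin m → ℝ))) S.Gi
      (christoffelMat (coordDer hO (ContinuousLinearMap.inr ℝ ℝ (Fin m → ℝ))) S.G S.Gi) S.w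
      (fun ν => matDer (dirDer hO (1, 0)) (christoffelMat
        (coordDer hO (ContinuousLinearMap.inr ℝ ℝ (Fin m → ℝ))) S.G S.Gi ν)) μ) = 0 := by
  simp only [boundaryField, krSum, map_sum, map_mul]
  refine Finset.sum_eq_zero fun k _ => Finset.sum_eq_zero fun A _ =>
    Finset.sum_eq_zero fun B _ => ?_
  split_ifs
  · rw [blockProd_update, map_mul, map_mul, Matrix.mul_apply, map_sum, Finset.sum_eq_zero]
    · simp
    · intro a _
      rw [map_mul, matDer_apply, evalAt_derivation_christoffel S hO p hp, zero_mul]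
  · simp

/-- The first variation at a point. -/
theorem evalAt_first_variation (S : SmoothMetric (variedDom g h V) (varied g h))
    (hO : IsOpen (variedDom g h V)) (hh : ∀ y, (h y).IsSymm) (r : ℕ) {y : Fin m → ℝ}
    (hy : ((0 : ℝ), y) ∈ variedDom g h V) :
    evalAt ⟨(0, y), hy⟩ (dirDer hO (1, 0) (S.w * lovScalar r (riemUp
        (coordDer hO (ContinuousLinearMap.inr ℝ ℝ (Fin m → ℝ))) S.Gi
        (christoffelMat (coordDer hO (ContinuousLinearMap.inr ℝ ℝ (Fin m → ℝ))) S.G S.Gi))))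
      = 1 / 4 * (Real.sqrt |(g y).det| *
          ∑ μ, ∑ ν, lovelockTensor r g (christoffel g) μ ν y * h y μ ν)
        + 2 * ∑ μ, evalAt ⟨(0, y), hy⟩ (coordDer hO (ContinuousLinearMap.inr ℝ ℝ (Fin m → ℝ)) μ
          (boundaryField r (coordDer hO (ContinuousLinearMap.inr ℝ ℝ (Fin m → ℝ))) S.Gi
      (christoffelMat (coordDer hO (ContinuousLinearMap.inr ℝ ℝ (Fin m → ℝ))) S.G S.Gi) S.w
      (fun ν => matDer (dirDer hO (1, 0)) (christoffelMat
        (coordDer hO (ContinuousLinearMap.inr ℝ ℝ (Fin m → ℝ))) S.G S.Gi ν)) μ)) := by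
  have hT : ∀ x, HasFDerivAt (fun x : Fin m → ℝ => ((0 : ℝ), x))
      (ContinuousLinearMap.inr ℝ ℝ (Fin m → ℝ)) x := fun x => hasFDerivAt_prodMk_right _ _
  have hg : ∀ x (hx : ((0 : ℝ), x) ∈ variedDom g h V), g x = S.G.map (evalAt ⟨(0, x), hx⟩) :=
    fun x hx => by rw [← S.G_eval, varied_zero]
  have hgi : ∀ x (hx : ((0 : ℝ), x) ∈ variedDom g h V),
      (g x)⁻¹ = S.Gi.map (evalAt ⟨(0, x), hx⟩) := fun x hx => by rw [← S.Gi_eval, varied_zero]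
  have H := S.isLeviCivita hO (ContinuousLinearMap.inr ℝ ℝ (Fin m → ℝ))
  have e := congrArg (evalAt ⟨(0, y), hy⟩) (H.first_variation S.pow_w S.mul_w
    (dirDer hO ((1 : ℝ), (0 : Fin m → ℝ))) (fun i f => dirDer_comm hO _ _ _) r)
  have hten := fun μ ν => lovelockTensor_eq_evalAt hO hT hgi
    (fun μ ν σ x hx => christoffel_eq_evalAt hO hT hg hgi μ ν σ hx) r μ ν hy
  have hw : Real.sqrt |(g y).det| = evalAt ⟨(0, y), hy⟩ S.w := by rw [← S.w_eval, varied_zero]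
  have hGi : ∀ a b, evalAt ⟨(0, y), hy⟩ (S.Gi a b) = evalAt ⟨(0, y), hy⟩ (S.Gi b a) :=
    fun a b => congrArg _ (congrFun (congrFun H.inv_symm b) a)
  have hhs : ∀ a b, h y a b = h y b a := fun a b => congrFun (congrFun (hh y) b) a
  set d := coordDer hO (ContinuousLinearMap.inr ℝ ℝ (Fin m → ℝ))
  set Γ := christoffelMat d S.G S.Gi
  set ev := evalAt (⟨(0, y), hy⟩ : variedDom g h V)
  set L := S.w * lovScalar r (riemUp d S.Gi Γ)
  set W := boundaryField r d S.Gi Γ S.w fun ν => matDer (dirDer hO (1, 0)) (Γ ν)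
  have hcontr : ∑ σ, ∑ τ, ev ((matDer (dirDer hO (1, 0)) S.G * S.Gi) σ τ)
        * ev (lovMixed r (riemUp d S.Gi Γ) σ τ)
      = ∑ μ, ∑ ν, h y μ ν * ∑ ρ, ev (lovMixed r (riemUp d S.Gi Γ) μ ρ) * ev (S.Gi ρ ν) := by
    simp only [Matrix.mul_apply, map_sum, map_mul, matDer_apply, Finset.sum_mul, Finset.mul_sum]
    refine Finset.sum_congr rfl fun σ _ => Finset.sum_comm.trans ?_
    refine Finset.sum_congr rfl fun ν _ => Finset.sum_congr rfl fun τ _ => ?_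
    rw [evalAt_derivation_varied S hO, hGi ν τ]
    ring
  -- The Lovelock tensor is symmetrized without a factor ½, so pairing it with the symmetric h
  -- counts each contraction twice. With the 2 in `first_variation` this gives the coefficient ¼.
  have htensor : ∑ μ, ∑ ν, lovelockTensor r g (christoffel g) μ ν y * h y μ ν
      = 2 * ∑ μ, ∑ ν, h y μ ν * ∑ ρ, ev (lovMixed r (riemUp d S.Gi Γ) μ ρ) * ev (S.Gi ρ ν) := by
    simp only [hten, map_sum, map_add, map_mul, Finset.sum_add_distrib, add_mul]
    rw [two_mul]
    congr 1
    · exact Finset.sum_congr rfl fun μ _ => Finset.sum_congr rfl fun ν _ => mul_comm _ _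
    · rw [Finset.sum_comm]
      exact Finset.sum_congr rfl fun μ _ => Finset.sum_congr rfl fun ν _ => by
        rw [hhs ν μ, mul_comm]
  simp only [map_mul, map_add, map_sum, map_ofNat] at e
  rw [hcontr] at e
  rw [htensor, hw]
  linear_combination (1 / 2 : ℝ) * e

end Variation

/-! ### The first variation of the action and the Euler-Lagrange equations. -/

section Variation

variable {m : ℕ} {g h : (Fin m → ℝ) → Matrix (Fin m) (Fin m) ℝ} {V K : Set (Fin m → ℝ)}

/-- A divergence supported in a compact subset of `V` integrates to zero. -/
theorem setIntegral_pderiv_eq_zero {F : (Fin m → ℝ) → ℝ} (hV : IsOpen V)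
    (hF : ContDiffOn ℝ ∞ F V) (hK : IsCompact K) (hKV : K ⊆ V) {C : Set (Fin m → ℝ)}
    (hC : IsClosed C) (hCK : C ⊆ K) (h0 : ∀ y ∉ C, F y = 0) (μ : Fin m) :
    MeasureTheory.IntegrableOn (pderiv μ F) K ∧ ∫ y in K, pderiv μ F y = 0 := by
  have hev : ∀ y ∉ C, F =ᶠ[nhds y] fun _ => 0 := fun y hy => by
    filter_upwards [hC.isOpen_compl.mem_nhds hy] with x hx using h0 x hx
  -- F is smooth everywhere although only its smoothness on V is given: the closed set C lies in V,
  -- and F vanishes on the open complement of C.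
  have hsm : ContDiff ℝ 1 F := by
    rw [contDiff_iff_contDiffAt]
    intro y
    by_cases hy : y ∈ C
    · exact (hF.contDiffAt (hV.mem_nhds (hKV (hCK hy)))).of_le (by exact_mod_cast le_top)
    · exact contDiffAt_const.congr_of_eventuallyEq (hev y hy)
  have hcs : HasCompactSupport F :=
    HasCompactSupport.intro hK fun y hy => h0 y fun hy' => hy (hCK hy')
  have hcont : Continuous (pderiv μ F) :=
    (hsm.continuous_fderiv one_ne_zero).clm_apply continuous_const
  refine ⟨hcont.continuousOn.integrableOn_compact hK, ?_⟩
  rw [MeasureTheory.setIntegral_eq_integral_of_forall_compl_eq_zero]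
  · exact integral_fderiv_eq_zero hsm hcs _
  · intro y hy
    rw [pderiv, (hev y fun hy' => hy (hCK hy')).fderiv_eq]
    simp

/-- Tube lemma: by compactness g + th stays nondegenerate on all of K for small t. -/
theorem exists_closedBall_prod_subset (hV : IsOpen V)
    (hg : ∀ i j, ContDiffOn ℝ ∞ (fun y => g y i j) V) (hd : ∀ y ∈ V, (g y).det ≠ 0)
    (hK : IsCompact K) (hKV : K ⊆ V) (hh : ∀ i j, ContDiff ℝ ∞ fun y => h y i j) :
    ∃ ε > 0, Metric.closedBall (0 : ℝ) ε ×ˢ K ⊆ variedDom g h V := by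
  obtain ⟨u, v, hu, _, h0u, hKv, huv⟩ := generalized_tube_lemma (isCompact_singleton (x := (0 : ℝ)))
    hK (isOpen_variedDom hV hg hh) (by
      rintro ⟨t, y⟩ ⟨ht, hy⟩
      rw [Set.mem_singleton_iff] at ht
      subst ht
      exact mem_variedDom_zero hd (hKV hy))
  obtain ⟨ε, hε, hεu⟩ := Metric.nhds_basis_closedBall.mem_iff.mp
    (hu.mem_nhds (h0u (Set.mem_singleton 0)))
  exact ⟨ε, hε, (Set.prod_mono hεu hKv).trans huv⟩

/-- The first variation of the Lovelock action. -/
theorem hasDerivAt_action (hV : IsOpen V) (hg : ∀ i j, ContDiffOn ℝ ∞ (fun y => g y i j) V)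
    (hd : ∀ y ∈ V, (g y).det ≠ 0) (hs : ∀ y ∈ V, (g y).transpose = g y) (hK : IsCompact K)
    (hKV : K ⊆ V) (hh : ∀ i j, ContDiff ℝ ∞ fun y => h y i j) (hhs : ∀ y, (h y).IsSymm)
    (hhK : tsupport h ⊆ K) (r : ℕ) :
    HasDerivAt (fun t : ℝ => ∫ y in K, lovelockDensity r (fun x => g x + t • h x) y)
      (∫ y in K, 1 / 4 * (Real.sqrt |(g y).det| *
        ∑ μ, ∑ ν, lovelockTensor r g (christoffel g) μ ν y * h y μ ν)) 0 := by
  have hO := isOpen_variedDom hV hg hh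
  have hsym : ∀ p ∈ variedDom g h V, (varied g h p).transpose = varied g h p := by
    intro p hp
    rw [varied, Matrix.transpose_add, Matrix.transpose_smul, hs _ hp.1, (hhs _).eq]
  let S : SmoothMetric (variedDom g h V) (varied g h) := SmoothMetric.of _
    (fun i j => (contDiffOn_varied hg hh i j).mono fun p hp => hp.1) (fun p hp => hp.2) hsym
  set d := coordDer hO (ContinuousLinearMap.inr ℝ ℝ (Fin m → ℝ)) with hdd
  set Γ := christoffelMat d S.G S.Gi with hΓ
  set D := dirDer hO ((1 : ℝ), (0 : Fin m → ℝ)) with hD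
  set L : smoothFun (variedDom g h V) := S.w * lovScalar r (riemUp d S.Gi Γ) with hL
  set W := boundaryField r d S.Gi Γ S.w fun ν => matDer D (Γ ν) with hW
  set F := extZero (L : variedDom g h V → ℝ) with hF
  set F' := extZero (D L : variedDom g h V → ℝ) with hF'
  have hT : ∀ t x, HasFDerivAt (fun x : Fin m → ℝ => ((t : ℝ), x))
      (ContinuousLinearMap.inr ℝ ℝ (Fin m → ℝ)) x := fun t x => hasFDerivAt_prodMk_right _ _
  have hdens : ∀ t y, (t, y) ∈ variedDom g h V →
      lovelockDensity r (fun x => g x + t • h x) y = F (t, y) := by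
    intro t y hy
    rw [hF, extZero_apply (L : variedDom g h V → ℝ) ⟨(t, y), hy⟩]
    exact lovelockDensity_eq_evalAt hO (hT t) (fun x hx => S.G_eval ⟨(t, x), hx⟩)
      (fun x hx => S.Gi_eval ⟨(t, x), hx⟩) r (fun x hx => S.w_eval ⟨(t, x), hx⟩) hy
  have hFF' : ∀ t y, (t, y) ∈ variedDom g h V → HasDerivAt (fun t => F (t, y)) (F' (t, y)) t := by
    intro t y hy
    have h1 := (smoothFun.differentiableAt hO L ⟨(t, y), hy⟩).hasFDerivAt
    have h2 := h1.comp_hasDerivAt t ((hasDerivAt_id t).prodMk (hasDerivAt_const t y))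
    rw [hF', extZero_apply (D L : variedDom g h V → ℝ) ⟨(t, y), hy⟩]
    exact h2
  have hFc : ContinuousOn F (variedDom g h V) := (smoothFun.contDiffOn L).continuousOn
  have hF'c : ContinuousOn F' (variedDom g h V) := (smoothFun.contDiffOn (D L)).continuousOn
  obtain ⟨ε, hε, hεK⟩ := exists_closedBall_prod_subset hV hg hd hK hKV hh
  have hslice : ∀ {f : ℝ × (Fin m → ℝ) → ℝ}, ContinuousOn f (variedDom g h V) →
      ∀ t ∈ Metric.closedBall (0 : ℝ) ε, ContinuousOn (fun y => f (t, y)) K := by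
    intro f hf t ht
    exact hf.comp (by fun_prop) fun y hy => hεK ⟨ht, hy⟩
  obtain ⟨b, hb⟩ := ((isCompact_closedBall (0 : ℝ) ε).prod hK).exists_bound_of_continuousOn
    (hF'c.mono hεK)
  have hball : Metric.closedBall (0 : ℝ) ε ∈ nhds (0 : ℝ) := Metric.closedBall_mem_nhds 0 hε
  have h0ball : (0 : ℝ) ∈ Metric.closedBall (0 : ℝ) ε := Metric.mem_closedBall_self hε.le
  -- Differentiation under the integral sign. The dominating constant is the bound of ∂F/∂t on the
  -- compact set [-ε, ε] × K.
  have key := (hasDerivAt_integral_of_dominated_loc_of_deriv_le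
    (μ := MeasureTheory.volume.restrict K) (F := fun t y => F (t, y)) (F' := fun t y => F' (t, y))
    (bound := fun _ => b) (x₀ := (0 : ℝ)) hball
    (by
      filter_upwards [hball] with t ht
      exact (hslice hFc t ht).aestronglyMeasurable hK.measurableSet)
    ((hslice hFc 0 h0ball).integrableOn_compact hK)
    ((hslice hF'c 0 h0ball).aestronglyMeasurable hK.measurableSet)
    (by
      rw [MeasureTheory.ae_restrict_iff' hK.measurableSet]
      exact Filter.Eventually.of_forall fun y hy t ht => hb (t, y) ⟨ht, hy⟩)
    (MeasureTheory.integrableOn_const hK.measure_lt_top.ne)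
    (by
      rw [MeasureTheory.ae_restrict_iff' hK.measurableSet]
      exact Filter.Eventually.of_forall fun y hy t ht => hFF' t y (hεK ⟨ht, hy⟩))).2
  have hWd : ∀ μ, MeasureTheory.IntegrableOn
      (pderiv μ fun y => extZero (W μ : variedDom g h V → ℝ) (0, y)) K ∧
        ∫ y in K, pderiv μ (fun y => extZero (W μ : variedDom g h V → ℝ) (0, y)) y = 0 := by
    intro μ
    refine setIntegral_pderiv_eq_zero hV ?_ hK hKV (isClosed_tsupport h) hhK ?_ μ
    · exact (smoothFun.contDiffOn (W μ)).comp (by fun_prop) fun y hy => mem_variedDom_zero hd hy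
    · intro y hy
      by_cases hyO : ((0 : ℝ), y) ∈ variedDom g h V
      · rw [extZero_apply (W μ : variedDom g h V → ℝ) ⟨(0, y), hyO⟩]
        exact evalAt_boundaryField S hO r ⟨(0, y), hyO⟩ hy μ
      -- Outside the domain the extension takes its default value 0.
      · exact Function.extend_apply' _ _ _ fun ⟨p, hp⟩ => hyO (hp ▸ p.2)
  have hpt : ∀ y ∈ K, 1 / 4 * (Real.sqrt |(g y).det| *
        ∑ μ, ∑ ν, lovelockTensor r g (christoffel g) μ ν y * h y μ ν)
      = F' (0, y) - 2 * ∑ μ, pderiv μ (fun y => extZero (W μ : variedDom g h V → ℝ) (0, y)) y := by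
    intro y hy
    have hyO : ((0 : ℝ), y) ∈ variedDom g h V := mem_variedDom_zero hd (hKV hy)
    have e := evalAt_first_variation S hO hhs r hyO
    have e' : ∀ μ, pderiv μ (fun y => extZero (W μ : variedDom g h V → ℝ) (0, y)) y
        = evalAt ⟨(0, y), hyO⟩ (d μ (W μ)) := fun μ =>
      pderiv_eq_evalAt hO (hT 0) μ
        (fun x hx => extZero_apply (W μ : variedDom g h V → ℝ) ⟨(0, x), hx⟩) hyO
    simp only [e']
    rw [hF', extZero_apply (D L : variedDom g h V → ℝ) ⟨(0, y), hyO⟩]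
    exact eq_sub_of_add_eq e.symm
  have hval : ∫ y in K, 1 / 4 * (Real.sqrt |(g y).det| *
        ∑ μ, ∑ ν, lovelockTensor r g (christoffel g) μ ν y * h y μ ν)
      = ∫ y in K, F' (0, y) := by
    rw [MeasureTheory.setIntegral_congr_fun hK.measurableSet hpt, MeasureTheory.integral_sub,
      MeasureTheory.integral_const_mul, MeasureTheory.integral_finsetSum]
    · simp [hWd]
    · exact fun μ _ => (hWd μ).1
    · exact (hslice hF'c 0 h0ball).integrableOn_compact hK
    · exact (MeasureTheory.integrable_finsetSum _ fun μ _ => (hWd μ).1).const_mul 2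
  rw [hval]
  -- The density agrees with F only for small t, where g + th is nondegenerate on K; this suffices
  -- for a derivative at 0.
  refine key.congr_of_eventuallyEq ?_
  filter_upwards [hball] with t ht
  exact MeasureTheory.setIntegral_congr_fun hK.measurableSet fun y hy =>
    hdens t y (hεK ⟨ht, hy⟩)

/-- A metric is an extremal of the Lovelock action if and only if its Lovelock tensor vanishes. -/
theorem isLovelockExtremal_iff (hV : IsOpen V) (hg : ∀ i j, ContDiffOn ℝ ∞ (fun y => g y i j) V)
    (hd : ∀ y ∈ V, (g y).det ≠ 0) (hs : ∀ y ∈ V, (g y).transpose = g y) (r : ℕ) :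
    IsLovelockExtremal r g V ↔
      ∀ y ∈ V, ∀ μ ν, lovelockTensor r g (christoffel g) μ ν y = 0 := by
  constructor
  · intro H
    let S : SmoothMetric V g := SmoothMetric.of _ hg hd hs
    have hT : ∀ x, HasFDerivAt (fun x : Fin m → ℝ => x)
      (ContinuousLinearMap.id ℝ (Fin m → ℝ)) x := fun x => hasFDerivAt_id x
    have hcont : ∀ μ ν, ContinuousOn (fun y => Real.sqrt |(g y).det| *
        lovelockTensor r g (christoffel g) μ ν y) V := by
      intro μ ν
      refine ((smoothFun.contDiffOn_of_eq S.w S.w_eval).mul (smoothFun.contDiffOn_of_eq _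
        fun p => lovelockTensor_eq_evalAt hV hT (fun x hx => S.Gi_eval ⟨x, hx⟩)
        (fun μ ν σ x hx => christoffel_eq_evalAt hV hT (fun x hx => S.G_eval ⟨x, hx⟩)
          (fun x hx => S.Gi_eval ⟨x, hx⟩) μ ν σ hx) r μ ν p.2)).continuousOn
    have hzero : ∀ μ ν, ∀ y ∈ V, Real.sqrt |(g y).det| *
        lovelockTensor r g (christoffel g) μ ν y = 0 := by
      intro μ ν
      have hae := hV.ae_eq_zero_of_integral_contDiff_smul_eq_zero
        ((hcont μ ν).locallyIntegrableOn hV.measurableSet (μ := MeasureTheory.volume))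
        (fun b hb hbc hbV => by
          -- The test variation b (E_{μν} + E_{νμ}) isolates one component: by the symmetry of the
          -- tensor the pairing is 2 b A^{μν}, also when μ = ν. The compact set is the support of b.
          let h : (Fin m → ℝ) → Matrix (Fin m) (Fin m) ℝ := fun y =>
            b y • (Matrix.single μ ν (1 : ℝ) + Matrix.single ν μ 1)
          have hh : ∀ i j, ContDiff ℝ ∞ fun y => h y i j := fun i j => by
            simp only [h, Matrix.smul_apply, smul_eq_mul]
            exact hb.mul contDiff_const
          have hhs : ∀ y, (h y).IsSymm := fun y => by
            simp only [h, Matrix.IsSymm, Matrix.transpose_smul, Matrix.transpose_add,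
              Matrix.transpose_single, add_comm]
          have hhb : tsupport h ⊆ tsupport b := by
            refine closure_mono fun y hy hby => hy ?_
            simp only [h, hby, zero_smul]
          have e := (hasDerivAt_action hV hg hd hs hbc hbV hh hhs hhb r).unique
            (H _ hbc hbV h hh hhs hhb)
          have hcontr : ∀ y, ∑ μ', ∑ ν', lovelockTensor r g (christoffel g) μ' ν' y * h y μ' ν'
              = 2 * (b y * lovelockTensor r g (christoffel g) μ ν y) := by
            intro y
            simp only [h, Matrix.smul_apply, Matrix.add_apply, smul_eq_mul, Matrix.single_apply,
              mul_add, Finset.sum_add_distrib]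
            have hsw := lovelockTensor_symm r g (christoffel g) ν μ y
            simp [ite_and, hsw]
            ring
          simp only [hcontr] at e
          rw [MeasureTheory.setIntegral_eq_integral_of_forall_compl_eq_zero] at e
          · rw [← mul_right_inj' (show (1 / 2 : ℝ) ≠ 0 by norm_num), mul_zero, ← e,
              ← MeasureTheory.integral_const_mul]
            congr 1
            ext y
            simp only [smul_eq_mul]
            ring
          · intro y hy
            rw [image_eq_zero_of_notMem_tsupport hy]
            ring)
      -- Continuity upgrades vanishing almost everywhere to vanishing at every point of V.
      refine MeasureTheory.Measure.eqOn_open_of_ae_eq (μ := MeasureTheory.volume) (g := fun _ => 0)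
        ?_ hV (hcont μ ν) continuousOn_const
      rwa [Filter.EventuallyEq, MeasureTheory.ae_restrict_iff' hV.measurableSet]
    intro y hy μ ν
    exact (mul_eq_zero.mp (hzero μ ν y hy)).resolve_left
      (Real.sqrt_pos.mpr (abs_pos.mpr (hd y hy))).ne'
  · intro H K hK hKV h hh hhs hhK
    have e := hasDerivAt_action hV hg hd hs hK hKV hh hhs hhK r
    rwa [MeasureTheory.setIntegral_congr_fun hK.measurableSet (g := fun _ => (0 : ℝ))
      (fun y hy => by simp [H y (hKV hy)]), MeasureTheory.integral_zero] at e

end Variation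

/-! ### Exterior products of coordinate differentials -/

section Exterior

variable {m : ℕ}

theorem leviCivita_eq_kronecker (f : Fin m → Fin m) : leviCivita f = kronecker f id := rfl

theorem kronecker_self_equiv {κ : Type*} [Fintype κ] [DecidableEq κ] (k : κ ≃ Fin m) :
    kronecker (m := m) k k = 1 := by
  rw [kronecker, ← Matrix.det_one (n := κ)]
  congr 1
  ext a b
  simp [Matrix.one_apply]

/-- The rule that a product of two Levi-Civita symbols is a generalized delta: the determinants
multiply, and the product of the two incidence matrices is again one. -/
theorem kronecker_mul_equiv {κ : Type*} [Fintype κ] [DecidableEq κ] (k : κ ≃ Fin m)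
    (f h : κ → Fin m) : kronecker f k * kronecker h k = kronecker f h := by
  rw [kronecker_symm h, kronecker, kronecker, kronecker, ← Matrix.det_mul]
  congr 1
  ext a b
  simp only [Matrix.mul_apply, Matrix.of_apply]
  rw [Fintype.sum_eq_single (k.symm (f a))]
  · by_cases hab : f a = h b <;> simp [hab]
  · intro c hc
    rw [if_neg, zero_mul]
    rintro h'
    exact hc (by rw [h', Equiv.symm_apply_apply])

/-- The coordinate differential `dx^μ` as a form. -/
def dxForm (μ : Fin m) : Forms (Fin m → ℝ) := oneForm (ContinuousLinearMap.proj μ)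

variable (m) in
/-- The form `dx^1 ∧ … ∧ dx^m`. -/
def volForm : Forms (Fin m → ℝ) := (List.ofFn (dxForm (m := m))).prod

theorem prod_dxForm (f : Fin m → Fin m) :
    (List.ofFn fun i => dxForm (f i)).prod = leviCivita f • volForm m := by
  have h1 : ∀ f : Fin m → Fin m, (List.ofFn fun i => dxForm (f i)).prod
      = ExteriorAlgebra.ιMulti ℝ m
        ((fun μ : Fin m => (ContinuousLinearMap.proj μ : (Fin m → ℝ) →L[ℝ] ℝ)) ∘ f) := by
    intro f
    rw [ExteriorAlgebra.ιMulti_apply]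
    rfl
  by_cases hf : Function.Injective f
  · let e : Equiv.Perm (Fin m) := Equiv.ofBijective f (Finite.injective_iff_bijective.mp hf)
    have h2 : leviCivita f = ((Equiv.Perm.sign e : ℤ) : ℝ) := by
      have := kronecker_comp_perm (m := m) e id id
      rw [show kronecker (m := m) id id = 1 from kronecker_self_equiv (Equiv.refl _), mul_one] at this
      exact this
    have h3 : volForm m = ExteriorAlgebra.ιMulti ℝ m
        (fun μ : Fin m => (ContinuousLinearMap.proj μ : (Fin m → ℝ) →L[ℝ] ℝ)) := h1 id
    rw [h1, h2, h3]
    refine (AlternatingMap.map_perm _ _ e).trans ?_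
    rw [Units.smul_def, Int.cast_smul_eq_zsmul]
  · have h2 : leviCivita f = 0 := by
      simp only [Function.Injective, not_forall] at hf
      obtain ⟨a, b, hab, hne⟩ := hf
      exact Matrix.det_zero_of_row_eq hne (by ext c; simp [hab])
    rw [h1, h2, zero_smul]
    refine AlternatingMap.map_eq_zero_of_not_injective _ _ fun h => hf (h.of_comp)

/-- The determinant is an alternating form taking the value 1 on the coordinate differentials, and
it factors through the exterior algebra. -/
theorem volForm_ne_zero : volForm m ≠ 0 := by
  let ev : ((Fin m → ℝ) →L[ℝ] ℝ) →ₗ[ℝ] (Fin m → ℝ) :=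
    { toFun := fun α i => α (Pi.single i 1)
      map_add' := fun _ _ => rfl
      map_smul' := fun _ _ => rfl }
  -- `liftAlternating` requires a form in every degree; all but that of degree m are taken to be
  -- zero.
  let F : ∀ i, ((Fin m → ℝ) →L[ℝ] ℝ) [⋀^Fin i]→ₗ[ℝ] ℝ := fun i =>
    if h : m = i then (h ▸ Matrix.detRowAlternating.compLinearMap ev) else 0
  have h1 : volForm m = ExteriorAlgebra.ιMulti ℝ m
      (fun μ : Fin m => (ContinuousLinearMap.proj μ : (Fin m → ℝ) →L[ℝ] ℝ)) := by
    rw [ExteriorAlgebra.ιMulti_apply]; rfl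
  have h2 : ExteriorAlgebra.liftAlternating F (volForm m) = 1 := by
    rw [h1, ExteriorAlgebra.liftAlternating_apply_ιMulti]
    simp only [F, dif_pos]
    have h3 : (fun μ i : Fin m =>
        (ContinuousLinearMap.proj μ : (Fin m → ℝ) →L[ℝ] ℝ) (Pi.single i 1)) = (1 : Matrix _ _ ℝ) := by
      ext a b
      simp [Matrix.one_apply, Pi.single_apply]
    exact (congrArg Matrix.det h3).trans Matrix.det_one
  intro h0
  rw [h0, map_zero] at h2
  exact zero_ne_one h2

theorem prod_dxForm_cast {N : ℕ} (h : N = m) (f : Fin N → Fin m) :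
    (List.ofFn fun i => dxForm (f i)).prod = kronecker f (finCongr h) • volForm m := by
  subst h
  exact prod_dxForm f

/-- The concatenation of `I` and `L`. -/
def joinIdx {p : ℕ} (I : Fin p → Fin m) (L : Fin (m - p) → Fin m) (a : Fin m) : Fin m :=
  if h : (a : ℕ) < p then I ⟨a, h⟩ else L ⟨(a : ℕ) - p, by have := a.isLt; omega⟩

/-- The positions of the concatenation of sequences of lengths `p` and `m - p`. -/
def joinEquiv {p : ℕ} (hp : p ≤ m) : Fin p ⊕ Fin (m - p) ≃ Fin m :=
  finSumFinEquiv.trans (finCongr (by omega))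

theorem joinIdx_comp {p : ℕ} (hp : p ≤ m) (I : Fin p → Fin m) (L : Fin (m - p) → Fin m) :
    joinIdx I L ∘ joinEquiv hp = Sum.elim I L := by
  ext x
  rcases x with x | x
  · simp [joinIdx, joinEquiv]
  · simp [joinIdx, joinEquiv]

theorem leviCivita_joinIdx {p : ℕ} (hp : p ≤ m) (I : Fin p → Fin m) (L : Fin (m - p) → Fin m) :
    leviCivita (joinIdx I L) = kronecker (Sum.elim I L) (joinEquiv hp) := by
  rw [← joinIdx_comp hp, leviCivita_eq_kronecker, ← kronecker_comp_equiv (joinEquiv hp)]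
  rfl

/-- The Sparling forms of a family `θ` of forms of degree one. -/
def sparlingOf {Λ : Type*} [Ring Λ] [Algebra ℝ Λ] (θ : Fin m → Λ) {p : ℕ} (I : Fin p → Fin m) : Λ :=
  ((m - p).factorial : ℝ)⁻¹ • ∑ L : Fin (m - p) → Fin m,
    leviCivita (joinIdx I L) • (List.ofFn fun c => θ (L c)).prod

theorem list_prod_sum {Λ : Type*} [Ring Λ] [Algebra ℝ Λ] {ι : Type*} [Fintype ι] {n : ℕ}
    (c : Fin n → ι → ℝ) (δ : Fin n → ι → Λ) :
    (List.ofFn fun i => ∑ x, c i x • δ i x).prod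
      = ∑ f : Fin n → ι, (∏ i, c i (f i)) • (List.ofFn fun i => δ i (f i)).prod := by
  classical
  have h := (MultilinearMap.mkPiAlgebraFin ℝ n Λ).map_sum (g := fun i x => c i x • δ i x)
  rw [MultilinearMap.mkPiAlgebraFin_apply] at h
  rw [h]
  refine Finset.sum_congr rfl fun f _ => ?_
  rw [MultilinearMap.map_smul_univ, MultilinearMap.mkPiAlgebraFin_apply]

/-- The left side is the multilinear expansion of the determinant whose rows are the columns h a of
Q. That matrix is a product of a selection matrix and Qᵀ. -/
theorem sum_leviCivita_mul_prod (Q : Matrix (Fin m) (Fin m) ℝ) (h : Fin m → Fin m) :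
    ∑ f : Fin m → Fin m, leviCivita f * ∏ a, Q (f a) (h a) = Q.det * leviCivita h := by
  have h1 := (Matrix.detRowAlternating (R := ℝ) (n := Fin m)).toMultilinearMap.map_sum
    (g := fun a b => Q b (h a) • fun c => if b = c then (1 : ℝ) else 0)
  have h2 : ∑ f : Fin m → Fin m, leviCivita f * ∏ a, Q (f a) (h a)
      = Matrix.det (Matrix.of fun a b => Q b (h a)) := by
    refine Eq.trans ?_ (Eq.trans h1.symm ?_)
    · refine Finset.sum_congr rfl fun f _ => ?_
      rw [MultilinearMap.map_smul_univ, mul_comm]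
      rfl
    · refine congrArg Matrix.det ?_
      ext a b
      simp [Finset.sum_apply]
  rw [h2, leviCivita, mul_comm, ← Matrix.det_transpose Q, ← Matrix.det_mul]
  congr 1
  ext a b
  simp [Matrix.mul_apply]

/-- Expanding each θ in the δ gives one factor Q for each of the m indices of the Levi-Civita
symbol, which therefore transforms by det Q. -/
theorem sum_smul_sparlingOf {Λ : Type*} [Ring Λ] [Algebra ℝ Λ] (Q : Matrix (Fin m) (Fin m) ℝ)
    {θ δ : Fin m → Λ} (hθ : ∀ k, θ k = ∑ μ, Q k μ • δ μ) {p : ℕ} (hp : p ≤ m)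
    (B : Fin p → Fin m) :
    ∑ I : Fin p → Fin m, (∏ i, Q (I i) (B i)) • sparlingOf θ I = Q.det • sparlingOf δ B := by
  have h1 : ∀ M : Fin (m - p) → Fin m, ∑ I : Fin p → Fin m, ∑ L : Fin (m - p) → Fin m,
      (∏ i, Q (I i) (B i)) * (leviCivita (joinIdx I L) * ∏ c, Q (L c) (M c))
        = Q.det * leviCivita (joinIdx B M) := by
    intro M
    rw [← sum_leviCivita_mul_prod,
      ← Equiv.sum_comp (((joinEquiv hp).arrowCongr (Equiv.refl (Fin m)))),
      ← Equiv.sum_comp (Equiv.sumArrowEquivProdArrow _ _ _).symm, Fintype.sum_prod_type]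
    refine Finset.sum_congr rfl fun I _ => Finset.sum_congr rfl fun L _ => ?_
    have h2 : ((joinEquiv hp).arrowCongr (Equiv.refl (Fin m)))
        ((Equiv.sumArrowEquivProdArrow _ _ _).symm (I, L)) = joinIdx I L := by
      ext a
      obtain ⟨x, rfl⟩ := (joinEquiv hp).surjective a
      rw [← Function.comp_apply (f := joinIdx I L), joinIdx_comp]
      rcases x with x | x <;> simp
    rw [h2, ← Equiv.prod_comp (joinEquiv hp), Fintype.prod_sum_type]
    have h3 : ∀ x, joinIdx I L (joinEquiv hp x) = Sum.elim I L x :=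
      fun x => congrFun (joinIdx_comp hp I L) x
    have h4 : ∀ x, joinIdx B M (joinEquiv hp x) = Sum.elim B M x :=
      fun x => congrFun (joinIdx_comp hp B M) x
    simp only [h3, h4, Sum.elim_inl, Sum.elim_inr]
    ring
  simp only [sparlingOf, hθ, list_prod_sum, smul_comm _ (((m - p).factorial : ℝ)⁻¹),
    ← Finset.smul_sum]
  congr 1
  simp only [Finset.smul_sum, smul_smul]
  simp only [← h1, Finset.sum_smul]
  rw [Finset.sum_comm (γ := Fin (m - p) → Fin m) (s := (Finset.univ : Finset (Fin (m - p) → Fin m)))]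
  refine Finset.sum_congr rfl fun I _ => ?_
  rw [Finset.sum_comm]

end Exterior

/-! ### Wedge products of 2-forms with Sparling forms. -/

section ExteriorBlocks

variable {m n : ℕ}

/-- A pair of indices for each `j`, as a function on `Fin n × Fin 2`. -/
def pairEquiv (n : ℕ) (α : Type*) : (Fin n → α × α) ≃ (Fin n × Fin 2 → α) where
  toFun f p := if p.2 = 0 then (f p.1).1 else (f p.1).2
  invFun C j := (C (j, 0), C (j, 1))
  left_inv f := by simp
  right_inv C := by
    ext ⟨j, c⟩
    fin_cases c <;> simp

theorem list_prod_sum_pairs {Λ : Type*} [Ring Λ] [Algebra ℝ Λ] (c : Fin n → Fin m → Fin m → ℝ)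
    (δ : Fin n → Fin m → Fin m → Λ) :
    (List.ofFn fun j => ∑ x, ∑ y, c j x y • δ j x y).prod
      = ∑ C : Fin n × Fin 2 → Fin m, (∏ j, c j (C (j, 0)) (C (j, 1))) •
          (List.ofFn fun j => δ j (C (j, 0)) (C (j, 1))).prod := by
  simp only [← Fintype.sum_prod_type']
  rw [list_prod_sum, ← Equiv.sum_comp (pairEquiv n (Fin m)).symm]
  rfl

/-- The order of the indices `(i₁, j₁, i₂, …, i_r, j₂, …, j_r)`. -/
def indexOrder (n : ℕ) : Fin (2 + (n + n)) ≃ Fin (n + 1) × Fin 2 :=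
  finSumFinEquiv.symm.trans <| ((Equiv.refl _).sumCongr finSumFinEquiv.symm).trans
    { toFun := Sum.elim (fun c => (0, c)) (Sum.elim (fun k => (k.succ, 0)) fun k => (k.succ, 1))
      invFun := fun p => Fin.cases (Sum.inl p.2)
        (fun k => Sum.inr (if p.2 = 0 then Sum.inl k else Sum.inr k)) p.1
      left_inv := by rintro (_ | _ | _) <;> simp
      right_inv := by
        rintro ⟨k, c⟩
        refine Fin.cases (by simp) (fun k => ?_) k
        fin_cases c <;> simp }

theorem append_finSumFinEquiv {α : Type*} {p q : ℕ} (a : Fin p → α) (b : Fin q → α)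
    (x : Fin p ⊕ Fin q) : Fin.append a b (finSumFinEquiv x) = Sum.elim a b x := by
  rcases x with x | x
  · rw [finSumFinEquiv_apply_left, Fin.append_left, Sum.elim_inl]
  · rw [finSumFinEquiv_apply_right, Fin.append_right, Sum.elim_inr]

theorem comp_indexOrder (B : Fin (n + 1) × Fin 2 → Fin m) :
    Fin.append ![B (0, 0), B (0, 1)]
        (Fin.append (fun k : Fin n => B (k.succ, 0)) fun k => B (k.succ, 1))
      = B ∘ indexOrder n := by
  ext i
  obtain ⟨i, rfl⟩ := finSumFinEquiv.surjective i
  rcases i with c | i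
  · fin_cases c <;> simp [indexOrder]
  · obtain ⟨i, rfl⟩ := finSumFinEquiv.surjective i
    rw [append_finSumFinEquiv, Sum.elim_inr, append_finSumFinEquiv]
    simp only [indexOrder, Function.comp_apply, Equiv.trans_apply, Equiv.symm_apply_apply,
      Equiv.sumCongr_apply, Sum.map_inr, Equiv.coe_fn_mk, Sum.elim_inr]
    rcases i with k | k <;> rfl

/-- Splitting off the first pair of indices, and separating the others. -/
def splitIndices (m n : ℕ) : (Fin (n + 1) × Fin 2 → Fin m) ≃
    Fin m × Fin m × (Fin n → Fin m) × (Fin n → Fin m) where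
  toFun B := (B (0, 0), B (0, 1), fun k => B (k.succ, 0), fun k => B (k.succ, 1))
  invFun q p := Fin.cases (if p.2 = 0 then q.1 else q.2.1)
    (fun k => if p.2 = 0 then q.2.2.1 k else q.2.2.2 k) p.1
  left_inv B := by
    ext ⟨k, c⟩
    refine Fin.cases ?_ (fun k => ?_) k <;> fin_cases c <;> simp
  right_inv q := by simp

theorem sum_splitIndices {S : Type*} [AddCommMonoid S]
    (F : Fin m → Fin m → (Fin n → Fin m) → (Fin n → Fin m) → S) :
    ∑ c, ∑ t, ∑ I, ∑ J, F c t I J = ∑ B : Fin (n + 1) × Fin 2 → Fin m,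
      F (B (0, 0)) (B (0, 1)) (fun k => B (k.succ, 0)) fun k => B (k.succ, 1) := by
  have h := Equiv.sum_comp (splitIndices m n) fun q => F q.1 q.2.1 q.2.2.1 q.2.2.2
  simp only [Fintype.sum_prod_type] at h
  exact h.symm

/-- The ordered product of the entries of the matrices `M j` at the pairs of indices given by
`B`. -/
def listBlockProd {Λ : Type*} [Ring Λ] (M : Fin n → Matrix (Fin m) (Fin m) Λ)
    (B : Fin n × Fin 2 → Fin m) : Λ :=
  (List.ofFn fun j => M j (B (j, 0)) (B (j, 1))).prod

/-- Passage from frame to coordinate indices: the matrices Q on the upper indices of the 2-forms are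
absorbed by the lower indices of the Sparling form, and only det Q remains. -/
theorem sum_listBlockProd_mul_sparlingOf {Λ : Type*} [Ring Λ] [Algebra ℝ Λ]
    (Q : Matrix (Fin m) (Fin m) ℝ) {θ δ : Fin m → Λ} (hθ : ∀ k, θ k = ∑ μ, Q k μ • δ μ)
    (hp : 2 + (n + n) ≤ m) {M N : Fin (n + 1) → Matrix (Fin m) (Fin m) Λ}
    (hM : ∀ j a b, M j a b = ∑ x, ∑ y, (Q a x * Q b y) • N j x y) :
    ∑ B, listBlockProd M B * sparlingOf θ (B ∘ indexOrder n)
      = Q.det • ∑ C, listBlockProd N C * sparlingOf δ (C ∘ indexOrder n) := by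
  have h1 : ∀ B C : Fin (n + 1) × Fin 2 → Fin m,
      ∏ j, Q (B (j, 0)) (C (j, 0)) * Q (B (j, 1)) (C (j, 1))
        = ∏ i, Q ((B ∘ indexOrder n) i) ((C ∘ indexOrder n) i) := by
    intro B C
    have := Equiv.prod_comp (indexOrder n) fun b => Q (B b) (C b)
    rw [Fintype.prod_prod_type] at this
    simp only [Fin.prod_univ_two] at this
    exact this.symm
  have h2 : ∀ B, listBlockProd M B = ∑ C : Fin (n + 1) × Fin 2 → Fin m,
      (∏ i, Q ((B ∘ indexOrder n) i) ((C ∘ indexOrder n) i)) • listBlockProd N C := by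
    intro B
    simp only [listBlockProd, hM, ← h1]
    exact list_prod_sum_pairs (fun j x y => Q (B (j, 0)) x * Q (B (j, 1)) y) fun j x y => N j x y
  simp only [h2, Finset.sum_mul, Finset.smul_sum]
  rw [Finset.sum_comm]
  refine Finset.sum_congr rfl fun C _ => ?_
  rw [← mul_smul_comm, ← sum_smul_sparlingOf Q hθ hp, Finset.mul_sum,
    ← Equiv.sum_comp ((indexOrder n).symm.arrowCongr (Equiv.refl (Fin m)))]
  refine Finset.sum_congr rfl fun B _ => ?_
  rw [smul_mul_assoc, ← mul_smul_comm]
  rfl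

theorem prod_pairs_dxForm (A : Fin n × Fin 2 → Fin m) :
    (List.ofFn fun j => dxForm (A (j, 0)) * dxForm (A (j, 1))).prod
      = (List.ofFn fun i : Fin (n * 2) => dxForm (A (finProdFinEquiv.symm i))).prod := by
  rw [List.ofFn_mul, List.prod_flatten, List.map_ofFn]
  congr 2
  ext j
  have h : ∀ c : Fin 2, ∀ h, finProdFinEquiv.symm (⟨(j : ℕ) * 2 + c, h⟩ : Fin (n * 2)) = (j, c) := by
    intro c h
    rw [Equiv.symm_apply_eq]
    ext
    simp [finProdFinEquiv, mul_comm, add_comm]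
  simp only [Function.comp_apply, h]
  simp [List.ofFn_succ]

/-- The sign of the reordering of `(i₁, j₁, i₂, j₂, …)` into `(i₁, j₁, i₂, …, i_r, j₂, …, j_r)`,
the remaining indices being kept. -/
theorem exists_sign_prod_mul_sparlingOf (hp : 2 + (n + n) ≤ m) :
    ∃ s : ℝ, s ≠ 0 ∧ ∀ A B : Fin (n + 1) × Fin 2 → Fin m,
      (List.ofFn fun j => dxForm (A (j, 0)) * dxForm (A (j, 1))).prod
        * sparlingOf dxForm (B ∘ indexOrder n) = (s * kronecker A B) • volForm m := by
  have hN : (n + 1) * 2 + (m - (2 + (n + n))) = m := by omega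
  -- `k1` lists the positions in the order of the Levi-Civita symbol in the Sparling form, `k2` in
  -- the order in which the differentials are multiplied. The sign sought is that of the permutation
  -- comparing them, independent of A and B.
  let k1 : (Fin (n + 1) × Fin 2) ⊕ Fin (m - (2 + (n + n))) ≃ Fin m :=
    ((indexOrder n).symm.sumCongr (Equiv.refl _)).trans (joinEquiv hp)
  let k2 : (Fin (n + 1) × Fin 2) ⊕ Fin (m - (2 + (n + n))) ≃ Fin m :=
    (finProdFinEquiv.sumCongr (Equiv.refl _)).trans (finSumFinEquiv.trans (finCongr hN))
  let π : Equiv.Perm ((Fin (n + 1) × Fin 2) ⊕ Fin (m - (2 + (n + n)))) := k2.trans k1.symm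
  refine ⟨((Equiv.Perm.sign π : ℤ) : ℝ), by exact_mod_cast (Equiv.Perm.sign π).ne_zero,
    fun A B => ?_⟩
  have h1 : ∀ L : Fin (m - (2 + (n + n))) → Fin m,
      leviCivita (joinIdx (B ∘ indexOrder n) L) = kronecker (Sum.elim B L) k1 := by
    intro L
    rw [leviCivita_joinIdx hp,
      ← kronecker_comp_equiv ((indexOrder n).symm.sumCongr (Equiv.refl (Fin (m - (2 + (n + n))))))]
    congr 1
    ext x
    rcases x with x | x <;> simp
  have h2 : ∀ L : Fin (m - (2 + (n + n))) → Fin m,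
      (List.ofFn fun j => dxForm (A (j, 0)) * dxForm (A (j, 1))).prod
        * (List.ofFn fun c => dxForm (L c)).prod
      = (((Equiv.Perm.sign π : ℤ) : ℝ) * kronecker (Sum.elim A L) k1) • volForm m := by
    intro L
    have h3 := prod_dxForm_cast hN (Fin.append (fun i => A (finProdFinEquiv.symm i)) L)
    have h4 : (fun i => dxForm (Fin.append (fun i => A (finProdFinEquiv.symm i)) L i))
        = Fin.append (fun i => dxForm (A (finProdFinEquiv.symm i))) fun c => dxForm (L c) := by
      ext1 i
      refine Fin.addCases (fun i => ?_) (fun i => ?_) i <;> simp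
    rw [h4, List.ofFn_fin_append, List.prod_append] at h3
    rw [prod_pairs_dxForm, h3, ← kronecker_comp_perm_right,
      ← kronecker_comp_equiv ((finProdFinEquiv.sumCongr (Equiv.refl _)).trans finSumFinEquiv)]
    congr 2
    · ext x
      simp only [Function.comp_apply, Equiv.trans_apply, append_finSumFinEquiv,
        Equiv.sumCongr_apply]
      rcases x with x | x
      · simp only [Sum.map_inl, Sum.elim_inl, Equiv.symm_apply_apply]
      · rfl
    · ext x
      simp [π, k2]
  rw [sparlingOf, mul_smul_comm, Finset.mul_sum]
  have hfac : ((m - (2 + (n + n))).factorial : ℝ) ≠ 0 := by positivity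
  have hsum := sum_kronecker_sumElim (m - (2 + (n + n))) A B (by simp; omega)
  have h5 : ∀ L : Fin (m - (2 + (n + n))) → Fin m,
      (List.ofFn fun j => dxForm (A (j, 0)) * dxForm (A (j, 1))).prod
        * leviCivita (joinIdx (B ∘ indexOrder n) L) • (List.ofFn fun c => dxForm (L c)).prod
      = (((Equiv.Perm.sign π : ℤ) : ℝ) * kronecker (Sum.elim A L) (Sum.elim B L)) • volForm m := by
    intro L
    rw [mul_smul_comm, h2, smul_smul, h1, ← kronecker_mul_equiv k1 (Sum.elim A L) (Sum.elim B L)]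
    congr 1
    ring
  rw [Finset.sum_congr rfl fun L _ => h5 L, ← Finset.sum_smul, ← Finset.mul_sum, hsum, smul_smul]
  congr 1
  field_simp

/-- The preceding sign rule extended multilinearly to 2-forms with arbitrary coefficients, one
coefficient family for each factor. -/
theorem exists_sign_sum_listBlockProd (hp : 2 + (n + n) ≤ m) :
    ∃ s : ℝ, s ≠ 0 ∧ ∀ (Y : Fin (n + 1) → Fin m → Fin m → Matrix (Fin m) (Fin m) ℝ)
      (N : Fin (n + 1) → Matrix (Fin m) (Fin m) (Forms (Fin m → ℝ))),
      (∀ j a b, N j a b = ∑ α, ∑ β, Y j α β a b • (dxForm α * dxForm β)) →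
      ∑ C, listBlockProd N C * sparlingOf dxForm (C ∘ indexOrder n)
        = (s * krSum fun A C : Fin (n + 1) × Fin 2 → Fin m =>
            blockProd (fun j => Y j (A (j, 0)) (A (j, 1))) C) • volForm m := by
  obtain ⟨s, hs, h⟩ := exists_sign_prod_mul_sparlingOf hp
  refine ⟨s, hs, fun Y N hN => ?_⟩
  rw [krSum, Finset.sum_comm, Finset.mul_sum, Finset.sum_smul]
  refine Finset.sum_congr rfl fun C _ => ?_
  simp only [listBlockProd, hN]
  rw [list_prod_sum_pairs (fun j α β => Y j α β (C (j, 0)) (C (j, 1)))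
    (fun _ α β => dxForm α * dxForm β), Finset.sum_mul, Finset.mul_sum, Finset.sum_smul]
  refine Finset.sum_congr rfl fun A _ => ?_
  rw [smul_mul_assoc, h, smul_smul]
  congr 1
  simp only [blockProd, Algebra.algebraMap_self, RingHom.id_apply]
  ring

end ExteriorBlocks

/-! ### The forms `Ψ` and the Lovelock tensor -/

section PsiForm

variable {m n : ℕ}

/-- Moving a product of two covectors past a third costs two signs; by induction such products are
central. -/
theorem commute_oneForm_mul_oneForm {E : Type*} [NormedAddCommGroup E] [NormedSpace ℝ E]
    (α β : E →L[ℝ] ℝ) (x : Forms E) : Commute (oneForm α * oneForm β) x := by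
  have hswap : ∀ a b : E →L[ℝ] ℝ, oneForm a * oneForm b = -(oneForm b * oneForm a) := fun a b =>
    eq_neg_of_add_eq_zero_left (ExteriorAlgebra.ι_add_mul_swap a b)
  induction x using ExteriorAlgebra.induction with
  | algebraMap r => exact Algebra.commute_algebraMap_right r _
  | ι c =>
    change oneForm α * oneForm β * oneForm c = oneForm c * (oneForm α * oneForm β)
    rw [mul_assoc, hswap β c, mul_neg, ← mul_assoc, hswap α c, neg_mul, neg_neg, mul_assoc]
  | mul a b ha hb => exact ha.mul_right hb
  | add a b ha hb => exact ha.add_right hb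

theorem commute_sum_dxForm (Y : Fin m → Fin m → ℝ) (x : Forms (Fin m → ℝ)) :
    Commute (∑ α, ∑ β, Y α β • (dxForm α * dxForm β)) x :=
  Commute.sum_left _ _ _ fun _ _ => Commute.sum_left _ _ _ fun _ _ =>
    (commute_oneForm_mul_oneForm _ _ x).smul_left _

theorem sum_conj_smul_dxForm (Q : Matrix (Fin m) (Fin m) ℝ)
    (Y : Fin m → Fin m → Matrix (Fin m) (Fin m) ℝ) (a b : Fin m) :
    ∑ α, ∑ β, (Q * Y α β * Q.transpose) a b • (dxForm α * dxForm β)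
      = ∑ x, ∑ y, (Q a x * Q b y) • ∑ α, ∑ β, Y α β x y • (dxForm α * dxForm β) := by
  simp only [Matrix.mul_apply, Matrix.transpose_apply, Finset.sum_mul, Finset.smul_sum,
    Finset.sum_smul, smul_smul]
  refine (Finset.sum_congr rfl fun α _ => Finset.sum_comm).trans ?_
  refine Finset.sum_comm.trans ?_
  refine (Finset.sum_congr rfl fun y _ => Finset.sum_congr rfl fun α _ => Finset.sum_comm).trans ?_
  refine (Finset.sum_congr rfl fun y _ => Finset.sum_comm).trans ?_
  refine Finset.sum_comm.trans ?_
  refine Finset.sum_congr rfl fun x _ => Finset.sum_congr rfl fun y _ =>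
    Finset.sum_congr rfl fun α _ => Finset.sum_congr rfl fun β _ => ?_
  congr 1
  ring

/-- Exchanging two blocks permutes upper and lower indices simultaneously, which preserves the delta
and the product of curvatures. -/
theorem lovPartial_eq_zero_block (X : Fin m → Fin m → Matrix (Fin m) (Fin m) ℝ) (k : Fin (n + 1))
    (μ ρ : Fin m) : lovPartial X (k, 1) μ ρ = lovPartial X ((0 : Fin (n + 1)), 1) μ ρ := by
  let e : Fin (n + 1) × Fin 2 ≃ Fin (n + 1) × Fin 2 :=
    (Equiv.swap k 0).prodCongr (Equiv.refl _)
  rw [lovPartial, ← krSum_comp_equiv e, lovPartial]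
  congr 1
  ext A B
  have h1 : (B ∘ e) (k, 1) = B (0, 1) := by simp [e]
  have h2 : Function.update (B ∘ e) (k, 1) μ = Function.update B (0, 1) μ ∘ e := by
    rw [Function.update_comp_equiv]
    congr 1
    simp [e]
  rw [h1, h2]
  split_ifs
  · rw [blockProd, blockProd, ← Equiv.prod_comp (Equiv.swap k 0)]
    exact Finset.prod_congr rfl fun j _ => by simp [blocks, e]
  · rfl

theorem sum_lovPartial_self (X : Fin m → Fin m → Matrix (Fin m) (Fin m) ℝ) (k : Fin n) :
    ∑ σ, lovPartial X (k, 1) σ σ = lovScalar n X := by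
  have h := krSum_update_mul X 1 k
  simp only [mul_one] at h
  rw [lovScalar]
  refine Eq.trans ?_ (h.symm.trans ?_)
  · refine Finset.sum_congr rfl fun σ _ => ?_
    rw [Fintype.sum_eq_single σ fun τ hτ => by rw [Matrix.one_apply_ne hτ.symm, zero_mul]]
    simp
  · congr 1
    ext A B
    exact congrArg (fun Q => blockProd Q B) (Function.update_eq_self k (blocks X A))

/-- The algebraic core of 1 ⇔ 2. The two rank-one matrices contribute Q(E g⁻¹)Qᵀ and its transpose,
and the scalar matrix contributes the trace of E, which is L. The coefficient 1/r is the one for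
which these combine to a multiple of the tensor built from δ L - 2r E. -/
theorem krSum_psi (X : Fin m → Fin m → Matrix (Fin m) (Fin m) ℝ)
    (hX : ∀ α β, (X α β).transpose = -X α β) {gi Q : Matrix (Fin m) (Fin m) ℝ}
    (hgi : gi.transpose = gi) (a b : Fin m) :
    (krSum fun A B : Fin (n + 1) × Fin 2 → Fin m => blockProd (Function.update (blocks X A) 0
      (X (A (0, 0)) (A (0, 1)) * (Matrix.vecMulVec (Q a) ((Q * gi) b)
        + Matrix.vecMulVec (Q b) ((Q * gi) a)
        - (1 / ((n + 1 : ℕ) : ℝ) * (Q * gi * Q.transpose) a b) • 1))) B)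
      = -(1 / (2 * ((n + 1 : ℕ) : ℝ))) * (Q * (Matrix.of fun μ ν =>
        ∑ ρ, (lovMixed (n + 1) X μ ρ * gi ρ ν + lovMixed (n + 1) X ν ρ * gi ρ μ))
          * Q.transpose) a b := by
  set E := lovPartial X ((0 : Fin (n + 1)), 1) with hE
  set L := lovScalar (n + 1) X with hL
  have hn : ((n + 1 : ℕ) : ℝ) ≠ 0 := by positivity
  have hmix : Matrix.of (lovMixed (n + 1) X)
      = L • (1 : Matrix (Fin m) (Fin m) ℝ) - (2 * ((n + 1 : ℕ) : ℝ)) • Matrix.of E := by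
    ext μ ρ
    simp only [Matrix.of_apply, Matrix.sub_apply, Matrix.smul_apply, Matrix.one_apply, smul_eq_mul]
    rw [lovMixed_eq X hX]
    simp only [lovPartial_eq_zero_block X, Finset.sum_const, Finset.card_univ, Fintype.card_fin,
      nsmul_eq_mul]
    rw [← hE, mul_assoc]
    congr 1
    split_ifs <;> simp [hL]
  have hT : (Matrix.of fun μ ν =>
        ∑ ρ, (lovMixed (n + 1) X μ ρ * gi ρ ν + lovMixed (n + 1) X ν ρ * gi ρ μ))
      = Matrix.of (lovMixed (n + 1) X) * gi + (Matrix.of (lovMixed (n + 1) X) * gi).transpose := by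
    ext μ ν
    simp only [Matrix.mul_apply, Matrix.add_apply, Matrix.transpose_apply, Matrix.of_apply,
      Finset.sum_add_distrib]
  have hvec : ∀ a b, ∑ σ, ∑ τ, Matrix.vecMulVec (Q a) ((Q * gi) b) σ τ * E σ τ
      = (Q * Matrix.of E * gi * Q.transpose) a b := by
    intro a b
    have h1 : Q * Matrix.of E * gi * Q.transpose = Q * Matrix.of E * (Q * gi).transpose := by
      rw [Matrix.transpose_mul, hgi, ← mul_assoc]
    rw [h1, mul_assoc, Matrix.mul_apply]
    refine Finset.sum_congr rfl fun σ _ => ?_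
    rw [Matrix.mul_apply, Finset.mul_sum]
    refine Finset.sum_congr rfl fun τ _ => ?_
    rw [Matrix.vecMulVec_apply, Matrix.transpose_apply, Matrix.of_apply]
    ring
  have hone : ∑ σ, ∑ τ, (1 : Matrix (Fin m) (Fin m) ℝ) σ τ * E σ τ = L := by
    rw [hL, ← sum_lovPartial_self X (0 : Fin (n + 1))]
    refine Finset.sum_congr rfl fun σ _ => ?_
    rw [Fintype.sum_eq_single σ fun τ hτ => by rw [Matrix.one_apply_ne hτ.symm, zero_mul]]
    simp [hE]
  have htr : (Q * (Matrix.of E * gi).transpose * Q.transpose) a b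
      = (Q * Matrix.of E * gi * Q.transpose) b a := by
    have : (Q * Matrix.of E * gi * Q.transpose).transpose
        = Q * (Matrix.of E * gi).transpose * Q.transpose := by
      simp only [Matrix.transpose_mul, Matrix.transpose_transpose, mul_assoc]
    rw [← this, Matrix.transpose_apply]
  rw [krSum_update_mul, ← hE, hT, hmix]
  simp only [Matrix.sub_apply, Matrix.add_apply, Matrix.smul_apply, smul_eq_mul, add_mul, sub_mul,
    Finset.sum_add_distrib, Finset.sum_sub_distrib, hvec, mul_assoc _ _ (E _ _), ← Finset.mul_sum,
    hone]
  simp only [sub_mul, Matrix.smul_mul, one_mul, Matrix.transpose_sub, Matrix.transpose_smul, hgi,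
    mul_add, mul_sub, add_mul, Matrix.mul_smul, Matrix.add_apply, Matrix.sub_apply,
    Matrix.smul_apply, smul_eq_mul, htr, ← mul_assoc]
  field_simp
  ring

theorem blockProd_smul_update (X : Fin m → Fin m → Matrix (Fin m) (Fin m) ℝ) (c : ℝ)
    (N : Matrix (Fin m) (Fin m) ℝ) (A B : Fin (n + 1) × Fin 2 → Fin m) :
    blockProd (fun j => (Fin.cons (fun α β => c • (X α β * N)) (fun _ α β => c • X α β) :
        Fin (n + 1) → Fin m → Fin m → Matrix (Fin m) (Fin m) ℝ) j (A (j, 0)) (A (j, 1))) B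
      = c ^ (n + 1) * blockProd (Function.update (blocks X A) 0
        (X (A (0, 0)) (A (0, 1)) * N)) B := by
  rw [blockProd, blockProd, Fin.prod_univ_succ, Fin.prod_univ_succ]
  simp only [Fin.cons_zero, Fin.cons_succ, Function.update_self, Matrix.smul_apply, smul_eq_mul,
    Finset.prod_mul_distrib, Finset.prod_const, Finset.card_univ, Fintype.card_fin, ne_eq,
    Fin.succ_ne_zero, not_false_eq_true, Function.update_of_ne, blocks]
  ring

/-- Ψ is linear in its bracket, and the bracket is the curvature block X multiplied on the right by
one matrix. Hence Ψ reduces to a contraction in which only the first block is modified. -/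
theorem map_Psi (s : Fin m → ℤˣ) (ψ : Forms (JetCoord m) →ₐ[ℝ] Forms (Fin m → ℝ))
    (z : JetCoord m) (hp : 2 * (n + 1) ≤ m) {gi : Matrix (Fin m) (Fin m) ℝ}
    (hgi : gi.transpose = gi) (X : Fin m → Fin m → Matrix (Fin m) (Fin m) ℝ)
    (hX : ∀ α β, (X α β).transpose = -X α β) (hP : (coframeMat z).det ≠ 0)
    (hη : eta s = coframeMat z * gi * (coframeMat z).transpose)
    (hθ : ∀ k, ψ (oneForm (theta k z)) = ∑ μ, coframeMat z k μ • dxForm μ)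
    (hΩ : ∀ a b, ψ (curvFormUp s a b z) = ∑ α, ∑ β,
      (coframeMat z * ((1 / 2 : ℝ) • X α β) * (coframeMat z).transpose) a b
        • (dxForm α * dxForm β)) :
    ∃ c : ℝ, c ≠ 0 ∧ ∀ a b, ψ (Psi s (n + 1) a b z) = (c * (coframeMat z * (Matrix.of fun μ ν =>
        ∑ ρ, (lovMixed (n + 1) X μ ρ * gi ρ ν + lovMixed (n + 1) X ν ρ * gi ρ μ))
          * (coframeMat z).transpose) a b) • volForm m := by
  set Q := coframeMat z with hQ
  have hp' : 2 + (n + n) ≤ m := by omega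
  obtain ⟨sg, hsg, hsum⟩ := exists_sign_sum_listBlockProd (n := n) hp'
  -- The factors: det Q from the change of frame, the reordering sign, one ½ for each curvature
  -- 2-form, and -1/(2r) from `krSum_psi`.
  refine ⟨Q.det * (sg * ((1 / 2) ^ (n + 1) * -(1 / (2 * ((n + 1 : ℕ) : ℝ))))), ?_, ?_⟩
  · have hn : ((n + 1 : ℕ) : ℝ) ≠ 0 := by positivity
    refine mul_ne_zero hP (mul_ne_zero hsg (mul_ne_zero (by positivity) ?_))
    exact neg_ne_zero.mpr (one_div_ne_zero (mul_ne_zero two_ne_zero hn))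
  intro a b
  -- With η = Q g⁻¹ Qᵀ, the entry (c, t) of Q X Nab Qᵀ is the coefficient of the bracket of Ψ^{ab}:
  -- the first rank-one matrix turns (Q X Qᵀ)^{ct} into (Q X Qᵀ)^{ca} η^{tb}.
  set Nab : Matrix (Fin m) (Fin m) ℝ := Matrix.vecMulVec (Q a) ((Q * gi) b)
        + Matrix.vecMulVec (Q b) ((Q * gi) a)
        - (1 / ((n + 1 : ℕ) : ℝ) * (Q * gi * Q.transpose) a b) • 1 with hNab
  let Y : Fin (n + 1) → Fin m → Fin m → Matrix (Fin m) (Fin m) ℝ :=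
    Fin.cons (fun α β => (1 / 2 : ℝ) • (X α β * Nab)) fun _ α β => (1 / 2 : ℝ) • X α β
  let N : Fin (n + 1) → Matrix (Fin m) (Fin m) (Forms (Fin m → ℝ)) := fun j =>
    Matrix.of fun x y => ∑ α, ∑ β, Y j α β x y • (dxForm α * dxForm β)
  let M : Fin (n + 1) → Matrix (Fin m) (Fin m) (Forms (Fin m → ℝ)) := fun j =>
    Matrix.of fun x y => ∑ α, ∑ β, (Q * Y j α β * Q.transpose) x y • (dxForm α * dxForm β)
  have hbracket : ∀ c t, ψ (eta s t b • curvFormUp s c a z + eta s t a • curvFormUp s c b z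
        - ((1 / ((n + 1 : ℕ) : ℝ)) * eta s a b) • curvFormUp s c t z) = M 0 c t := by
    intro c t
    have hY : ∀ α β, (Q * Y 0 α β * Q.transpose) c t
        = eta s t b * (Q * ((1 / 2 : ℝ) • X α β) * Q.transpose) c a
          + eta s t a * (Q * ((1 / 2 : ℝ) • X α β) * Q.transpose) c b
          - ((1 / ((n + 1 : ℕ) : ℝ)) * eta s a b)
            * (Q * ((1 / 2 : ℝ) • X α β) * Q.transpose) c t := by
      intro α β
      have hv : ∀ a b, (Q * (X α β * Matrix.vecMulVec (Q a) ((Q * gi) b)) * Q.transpose) c t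
          = (Q * gi * Q.transpose) t b * (Q * X α β * Q.transpose) c a := by
        intro a b
        rw [Matrix.mul_vecMulVec, Matrix.mul_vecMulVec, Matrix.vecMulVec_mul,
          Matrix.vecMulVec_apply, mul_comm]
        have h1 : (Q * gi * Q.transpose) t b = (Q * gi * Q.transpose) b t := by
          have : (Q * gi * Q.transpose).transpose = Q * gi * Q.transpose := by
            simp only [Matrix.transpose_mul, Matrix.transpose_transpose, hgi, mul_assoc]
          exact congrFun (congrFun this b) t
        rw [h1, Matrix.mulVec_mulVec]
        rfl
      simp only [Y, Fin.cons_zero, hNab, hη, Matrix.mul_smul, Matrix.smul_mul, mul_sub, mul_add,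
        sub_mul, add_mul, Matrix.sub_apply, Matrix.add_apply, Matrix.smul_apply, smul_eq_mul, hv,
        mul_one]
      ring
    simp only [M, Matrix.of_apply, hY, map_sub, map_add, map_smul, hΩ, Finset.smul_sum, smul_smul,
      sub_smul, add_smul, Finset.sum_sub_distrib, Finset.sum_add_distrib]
  have hprod : ∀ B : Fin (n + 1) × Fin 2 → Fin m,
      ψ (curvFormProd s (fun k : Fin n => B (k.succ, 0)) (fun k => B (k.succ, 1)) z)
        = (List.ofFn fun k : Fin n => M k.succ (B (k.succ, 0)) (B (k.succ, 1))).prod := by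
    intro B
    rw [curvFormProd, map_list_prod, List.map_ofFn]
    congr 2
    ext1 k
    rw [Function.comp_apply, hΩ]
    rfl
  have hsp : ∀ B : Fin (n + 1) × Fin 2 → Fin m,
      ψ (sparling (B ∘ indexOrder n) z)
        = sparlingOf (fun k => ψ (oneForm (theta k z))) (B ∘ indexOrder n) := by
    intro B
    simp only [sparling, sparlingOf, map_smul, map_sum, map_list_prod, List.map_ofFn]
    rfl
  -- In Ψ the Sparling form stands between the curvature forms; being of even degree, these can be
  -- collected in front of it.
  have hterm : ∀ B : Fin (n + 1) × Fin 2 → Fin m,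
      M 0 (B (0, 0)) (B (0, 1))
        * sparlingOf (fun k => ψ (oneForm (theta k z))) (B ∘ indexOrder n)
        * (List.ofFn fun k : Fin n => M k.succ (B (k.succ, 0)) (B (k.succ, 1))).prod
      = listBlockProd M B * sparlingOf (fun k => ψ (oneForm (theta k z))) (B ∘ indexOrder n) := by
    intro B
    rw [listBlockProd, List.ofFn_succ, List.prod_cons, mul_assoc, mul_assoc]
    congr 1
    refine (Commute.list_prod_left _ _ fun x hx => ?_).eq.symm
    obtain ⟨k, rfl⟩ := (List.mem_ofFn' _ _).mp hx
    exact commute_sum_dxForm _ _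
  have hPsi : ψ (Psi s (n + 1) a b z) = ∑ c, ∑ t, ∑ I : Fin n → Fin m, ∑ J : Fin n → Fin m,
      ψ (eta s t b • curvFormUp s c a z + eta s t a • curvFormUp s c b z
        - ((1 / ((n + 1 : ℕ) : ℝ)) * eta s a b) • curvFormUp s c t z)
      * ψ (sparling (Fin.append ![c, t] (Fin.append I J)) z) * ψ (curvFormProd s I J z) := by
    rw [Psi]
    simp only [map_sum, map_mul]
    rfl
  rw [hPsi, sum_splitIndices]
  simp only [hbracket, hprod, comp_indexOrder, hsp, hterm]
  rw [sum_listBlockProd_mul_sparlingOf Q hθ hp' (M := M) (N := N)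
    (fun j x y => sum_conj_smul_dxForm Q (Y j) x y), hsum Y N fun _ _ _ => rfl]
  simp only [Y, blockProd_smul_update, krSum_mul_left]
  rw [krSum_psi X hX hgi, smul_smul]
  congr 1
  ring

end PsiForm

/-! ### Connections in a moving frame -/

section MovingFrame

variable {R : Type*} [CommRing R] [Algebra ℝ R] {m : ℕ} {d : Fin m → Derivation ℝ R R}
  {F Q : Matrix (Fin m) (Fin m) R} {Γ : Fin m → Matrix (Fin m) (Fin m) R}

/-- The connection `Γ` in the frame `F` with dual coframe `Q`. -/
def frameConnection (d : Fin m → Derivation ℝ R R) (F Q : Matrix (Fin m) (Fin m) R)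
    (Γ : Fin m → Matrix (Fin m) (Fin m) R) (ν : Fin m) : Matrix (Fin m) (Fin m) R :=
  Q * (matDer (d ν) F + Γ ν * F)

/-- Curvature transforms by conjugation under a change of frame. The derivative of the coframe is
eliminated by dQ = -Q dF Q. -/
theorem riem_frameConnection (hd : ∀ i j f, d i (d j f) = d j (d i f)) (hFQ : F * Q = 1)
    (μ ν : Fin m) : riem d (frameConnection d F Q Γ) μ ν = Q * riem d Γ μ ν * F := by
  have hcomm : matDer (d μ) (matDer (d ν) F) = matDer (d ν) (matDer (d μ) F) := by
    ext i j
    exact hd _ _ _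
  have hW : ∀ μ ν, frameConnection d F Q Γ μ * frameConnection d F Q Γ ν
      = Q * matDer (d μ) F * Q * (matDer (d ν) F + Γ ν * F)
        + Q * Γ μ * (matDer (d ν) F + Γ ν * F) := by
    intro μ ν
    simp only [frameConnection]
    calc Q * (matDer (d μ) F + Γ μ * F) * (Q * (matDer (d ν) F + Γ ν * F))
        = Q * matDer (d μ) F * Q * (matDer (d ν) F + Γ ν * F)
          + Q * Γ μ * (F * Q) * (matDer (d ν) F + Γ ν * F) := by noncomm_ring
      _ = _ := by rw [hFQ, mul_one]
  rw [riem, hW, hW]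
  simp only [frameConnection, matDer_mul, matDer_add, matDer_inverse _ hFQ, riem]
  rw [hcomm]
  noncomm_ring

/-- If the connection matrix W in the frame satisfies WᵀH + HW = 0 for a constant H, then H is
parallel, and hence so is the metric QᵀHQ in coordinates. -/
theorem frame_compat {H : Matrix (Fin m) (Fin m) R} (hFQ : F * Q = 1) (hH : H * H = 1)
    (hHd : ∀ μ, matDer (d μ) H = 0) (ν : Fin m)
    (hmet : frameConnection d F Q Γ ν + H * (frameConnection d F Q Γ ν).transpose * H = 0) :
    matDer (d ν) (Q.transpose * H * Q)
      = (Γ ν).transpose * (Q.transpose * H * Q) + Q.transpose * H * Q * Γ ν := by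
  have hQF : Q * F = 1 := mul_eq_one_comm.mp hFQ
  set W := frameConnection d F Q Γ ν with hW
  have h1 : matDer (d ν) F = F * W - Γ ν * F := by
    rw [hW, frameConnection, ← mul_assoc, hFQ, one_mul, add_sub_cancel_right]
  have h2 : matDer (d ν) Q = Q * Γ ν - W * Q := by
    rw [matDer_inverse _ hFQ, h1]
    calc -(Q * (F * W - Γ ν * F) * Q) = Q * Γ ν * (F * Q) - (Q * F) * W * Q := by noncomm_ring
      _ = _ := by rw [hFQ, hQF, mul_one, one_mul]
  have h3 : W.transpose * H + H * W = 0 := by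
    have : H * (W + H * W.transpose * H) = 0 := by rw [hmet, mul_zero]
    rw [mul_add, ← mul_assoc, ← mul_assoc, hH, one_mul] at this
    rw [add_comm, this]
  have h4 : Q.transpose * W.transpose * H * Q + Q.transpose * H * W * Q = 0 := by
    calc _ = Q.transpose * (W.transpose * H + H * W) * Q := by noncomm_ring
      _ = 0 := by rw [h3, mul_zero, zero_mul]
  rw [matDer_mul, matDer_mul, matDer_transpose, hHd, h2, Matrix.transpose_sub,
    Matrix.transpose_mul, Matrix.transpose_mul, mul_zero, add_zero]
  calc ((Γ ν).transpose * Q.transpose - Q.transpose * W.transpose) * H * Q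
        + Q.transpose * H * (Q * Γ ν - W * Q)
      = (Γ ν).transpose * (Q.transpose * H * Q) + Q.transpose * H * Q * Γ ν
        - (Q.transpose * W.transpose * H * Q + Q.transpose * H * W * Q) := by noncomm_ring
    _ = _ := by rw [h4, sub_zero]

end MovingFrame

/-! ### Pullbacks of one-forms and of their exterior derivatives -/

section Pullback

variable {m : ℕ}

/-- The pullback of forms along `f` at the point `y`, as an algebra homomorphism. -/
def pullbackHom {E F : Type*} [NormedAddCommGroup E] [NormedSpace ℝ E] [NormedAddCommGroup F]
    [NormedSpace ℝ F] (f : E → F) (y : E) : Forms F →ₐ[ℝ] Forms E :=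
  ExteriorAlgebra.map (ContinuousLinearMap.precomp ℝ (fderiv ℝ f y)).toLinearMap

theorem pullbackHom_oneForm {E F : Type*} [NormedAddCommGroup E] [NormedSpace ℝ E]
    [NormedAddCommGroup F] [NormedSpace ℝ F] (f : E → F) (y : E) (α : F →L[ℝ] ℝ) :
    pullbackHom f y (oneForm α) = oneForm (α.comp (fderiv ℝ f y)) :=
  ExteriorAlgebra.map_apply_ι _ _

theorem oneForm_eq_sum (β : (Fin m → ℝ) →L[ℝ] ℝ) :
    oneForm β = ∑ μ, β (Pi.single μ 1) • dxForm μ := by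
  have h : β = ∑ μ, β (Pi.single μ 1) • (ContinuousLinearMap.proj μ : (Fin m → ℝ) →L[ℝ] ℝ) := by
    refine ContinuousLinearMap.ext fun v => ?_
    conv_lhs => rw [← Finset.univ_sum_single v]
    rw [map_sum, sum_apply]
    refine Finset.sum_congr rfl fun μ _ => ?_
    rw [smul_apply, ContinuousLinearMap.proj_apply, smul_eq_mul, mul_comm,
      ← smul_eq_mul, ← map_smul]
    congr 1
    ext i
    by_cases hi : i = μ
    · subst hi; simp
    · simp [hi]
  conv_lhs => rw [h]
  simp only [oneForm, map_sum, map_smul, dxForm]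

theorem oneForm_mul_oneForm (β γ : (Fin m → ℝ) →L[ℝ] ℝ) :
    oneForm β * oneForm γ
      = ∑ μ, ∑ ν, (β (Pi.single μ 1) * γ (Pi.single ν 1)) • (dxForm μ * dxForm ν) := by
  rw [oneForm_eq_sum β, oneForm_eq_sum γ, Finset.sum_mul_sum]
  refine Finset.sum_congr rfl fun μ _ => Finset.sum_congr rfl fun ν _ => ?_
  rw [smul_mul_smul_comm]

theorem sum_smul_dxForm_antisymm (k : Fin m → Fin m → ℝ) :
    ∑ μ, ∑ ν, k μ ν • (dxForm μ * dxForm ν)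
      = ∑ μ, ∑ ν, ((1 / 2 : ℝ) * (k μ ν - k ν μ)) • (dxForm μ * dxForm ν) := by
  have hswap : ∀ μ ν : Fin m, dxForm μ * dxForm ν = -(dxForm ν * dxForm μ) := fun μ ν =>
    eq_neg_of_add_eq_zero_left (ExteriorAlgebra.ι_add_mul_swap _ _)
  have h1 : ∑ μ, ∑ ν, k ν μ • (dxForm μ * dxForm ν) = -∑ μ, ∑ ν, k μ ν • (dxForm μ * dxForm ν) := by
    rw [Finset.sum_comm, ← Finset.sum_neg_distrib]
    refine Finset.sum_congr rfl fun μ _ => ?_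
    rw [← Finset.sum_neg_distrib]
    refine Finset.sum_congr rfl fun ν _ => ?_
    rw [hswap ν μ, smul_neg]
  have h2 : ∑ μ, ∑ ν, ((1 / 2 : ℝ) * (k μ ν - k ν μ)) • (dxForm μ * dxForm ν)
      = (1 / 2 : ℝ) • (∑ μ, ∑ ν, k μ ν • (dxForm μ * dxForm ν)
        - ∑ μ, ∑ ν, k ν μ • (dxForm μ * dxForm ν)) := by
    simp only [mul_smul, sub_smul, Finset.smul_sum, Finset.sum_sub_distrib, smul_sub]
  rw [h2, h1, sub_neg_eq_add, ← two_smul ℝ, smul_smul]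
  norm_num

theorem sum_smul_dxForm_eq_zero {k : Fin m → Fin m → ℝ} (hk : ∀ μ ν, k μ ν = k ν μ) :
    ∑ μ, ∑ ν, k μ ν • (dxForm μ * dxForm ν) = 0 := by
  rw [sum_smul_dxForm_antisymm]
  refine Finset.sum_eq_zero fun μ _ => Finset.sum_eq_zero fun ν _ => ?_
  rw [hk μ ν, sub_self, mul_zero, zero_smul]

/-- The pullback commutes with d: the second derivative of f is symmetric, so it drops out against
the antisymmetric dx^μ ∧ dx^ν. -/
theorem pullbackHom_dOne {κ : Type*} [Fintype κ] [DecidableEq κ] {f : (Fin m → ℝ) → κ → ℝ}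
    {y : Fin m → ℝ} (hf : ContDiffAt ℝ ∞ f y) {α : (κ → ℝ) → ((κ → ℝ) →L[ℝ] ℝ)}
    (hα : DifferentiableAt ℝ α (f y)) :
    pullbackHom f y (dOne α (f y)) = ∑ μ, ∑ ν,
      pderiv μ (fun x => α (f x) (fderiv ℝ f x (Pi.single ν 1))) y • (dxForm μ * dxForm ν) := by
  set f' := fderiv ℝ f y with hf'
  have hfd : HasFDerivAt f f' y := (hf.differentiableAt (by simp)).hasFDerivAt
  have hf2 : HasFDerivAt (fderiv ℝ f) (fderiv ℝ (fderiv ℝ f) y) y :=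
    ((hf.fderiv_right (m := ∞) (by simp)).differentiableAt (by simp)).hasFDerivAt
  have hsymm := hf.isSymmSndFDerivAt (by simpa using ENat.LEInfty.out)
  have hpd : ∀ μ ν, pderiv μ (fun x => α (f x) (fderiv ℝ f x (Pi.single ν 1))) y
      = fderiv ℝ α (f y) (f' (Pi.single μ 1)) (f' (Pi.single ν 1))
        + α (f y) (fderiv ℝ (fderiv ℝ f) y (Pi.single μ 1) (Pi.single ν 1)) := by
    intro μ ν
    have h1 := (hα.hasFDerivAt.comp y hfd).clm_apply
      (hf2.clm_apply (hasFDerivAt_const (Pi.single ν (1 : ℝ)) y))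
    have h2 : fderiv ℝ (fun x => α (f x) (fderiv ℝ f x (Pi.single ν 1))) y = _ := h1.fderiv
    rw [pderiv, h2]
    simp [add_comm, hf']
  simp only [hpd, add_smul, Finset.sum_add_distrib]
  rw [sum_smul_dxForm_eq_zero fun μ ν => congrArg (α (f y)) (hsymm _ _), add_zero]
  simp only [dOne, map_sum, map_mul, pullbackHom_oneForm, oneForm_mul_oneForm]
  refine Finset.sum_comm.trans (Finset.sum_congr rfl fun μ _ => ?_)
  refine Finset.sum_comm.trans (Finset.sum_congr rfl fun ν _ => ?_)
  rw [← Finset.sum_smul]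
  congr 1
  have hv : f' (Pi.single μ 1) = ∑ A, f' (Pi.single μ 1) A • Pi.single A (1 : ℝ) := by
    ext B
    simp [Finset.sum_apply, Pi.single_apply]
  conv_rhs => rw [hv]
  rw [map_sum, sum_apply]
  refine Finset.sum_congr rfl fun A _ => ?_
  rw [map_smul]
  rfl

end Pullback

/-! ### Sections of the jet bundle in coordinates -/

variable {m : ℕ}

theorem eta_mul_eta (s : Fin m → ℤˣ) : eta s * eta s = 1 := by
  rw [eta, Matrix.diagonal_mul_diagonal, ← Matrix.diagonal_one]
  congr 1
  ext a
  rw [← Int.cast_mul, ← Units.val_mul, Int.units_mul_self]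
  simp

theorem eta_transpose (s : Fin m → ℤˣ) : (eta s).transpose = eta s :=
  Matrix.diagonal_transpose _

/-- A smooth section of the jet bundle over an open subset `V` of the coordinate space. -/
structure JetField (V : Set (Fin m → ℝ)) where
  toFun : (Fin m → ℝ) → JetCoord m
  isOpen : IsOpen V
  contDiffOn : ContDiffOn ℝ ∞ toFun V
  base : ∀ y μ, toFun y (.inl μ) = y μ
  det_ne_zero : ∀ y ∈ V, (frameMat (toFun y)).det ≠ 0

namespace JetField

variable {V : Set (Fin m → ℝ)} (J : JetField V)

theorem contDiffOn_apply (A : JetIdx m) : ContDiffOn ℝ ∞ (fun y => J.toFun y A) V :=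
  contDiffOn_pi.mp J.contDiffOn A

/-- The partial derivatives as derivations of the algebra of smooth functions on `V`. -/
def der : Fin m → Derivation ℝ (smoothFun V) (smoothFun V) :=
  coordDer J.isOpen (ContinuousLinearMap.id ℝ (Fin m → ℝ))

theorem der_comm (i j : Fin m) (f : smoothFun V) : J.der i (J.der j f) = J.der j (J.der i f) :=
  dirDer_comm J.isOpen _ _ _

/-- The matrix `e^ν_k` of smooth functions. -/
def frame : Matrix (Fin m) (Fin m) (smoothFun V) :=
  smoothMat (fun y => frameMat (J.toFun y)) fun ν k => J.contDiffOn_apply (.inr (.inl (ν, k)))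

/-- The matrix `e^k_μ` of smooth functions. -/
def coframe : Matrix (Fin m) (Fin m) (smoothFun V) :=
  smoothMat (fun y => coframeMat (J.toFun y)) (contDiffOn_matrix_inv
    (fun ν k => J.contDiffOn_apply (.inr (.inl (ν, k)))) J.det_ne_zero)

/-- The matrix `(e^ν_{kσ})_{νk}` of smooth functions. -/
def frameDeriv (σ : Fin m) : Matrix (Fin m) (Fin m) (smoothFun V) :=
  smoothMat (fun y => Matrix.of fun ν k => frameDer (J.toFun y) ν k σ)
    fun ν k => J.contDiffOn_apply (.inr (.inr (ν, k, σ)))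

/-- The linear connection `Γ^μ_{νσ} = - e^k_ν e^μ_{kσ}`. -/
def conn (σ : Fin m) : Matrix (Fin m) (Fin m) (smoothFun V) :=
  -(J.frameDeriv σ * J.coframe)

/-- The matrix `η` of constant functions. -/
def etaMat (_J : JetField V) (s : Fin m → ℤˣ) : Matrix (Fin m) (Fin m) (smoothFun V) :=
  (eta s).map (algebraMap ℝ (smoothFun V))

/-- The metric `g_{μν}`. -/
def metricMat (s : Fin m → ℤˣ) : Matrix (Fin m) (Fin m) (smoothFun V) :=
  J.coframe.transpose * J.etaMat s * J.coframe

/-- The inverse metric `g^{μν}`. -/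
def metricInv (s : Fin m → ℤˣ) : Matrix (Fin m) (Fin m) (smoothFun V) :=
  J.frame * J.etaMat s * J.frame.transpose

theorem frame_mul_coframe : J.frame * J.coframe = 1 :=
  evalAt_matrix_ext fun p => by
    rw [map_evalAt_mul, Matrix.map_one _ (map_zero _) (map_one _)]
    exact Matrix.mul_nonsing_inv _ (isUnit_iff_ne_zero.mpr (J.det_ne_zero p p.2))

theorem coframe_mul_frame : J.coframe * J.frame = 1 := mul_eq_one_comm.mp J.frame_mul_coframe

theorem etaMat_mul_etaMat (s : Fin m → ℤˣ) : J.etaMat s * J.etaMat s = 1 := by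
  rw [etaMat, ← Matrix.map_mul, eta_mul_eta, Matrix.map_one _ (map_zero _) (map_one _)]

theorem etaMat_transpose (s : Fin m → ℤˣ) : (J.etaMat s).transpose = J.etaMat s := by
  rw [etaMat, ← Matrix.transpose_map, eta_transpose]

theorem etaMat_eval (s : Fin m → ℤˣ) (p : V) : (J.etaMat s).map (evalAt p) = eta s := rfl

theorem matDer_etaMat (s : Fin m → ℤˣ) (μ : Fin m) : matDer (J.der μ) (J.etaMat s) = 0 := by
  ext1 i j
  exact Derivation.map_algebraMap (J.der μ) (eta s i j)

theorem metricMat_transpose (s : Fin m → ℤˣ) : (J.metricMat s).transpose = J.metricMat s := by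
  simp only [metricMat, Matrix.transpose_mul, Matrix.transpose_transpose, etaMat_transpose,
    mul_assoc]

theorem metricMat_mul_metricInv (s : Fin m → ℤˣ) : J.metricMat s * J.metricInv s = 1 := by
  have h : J.coframe.transpose * J.frame.transpose = 1 := by
    rw [← Matrix.transpose_mul, frame_mul_coframe, Matrix.transpose_one]
  calc J.metricMat s * J.metricInv s
      = J.coframe.transpose * (J.etaMat s * (J.coframe * J.frame) * J.etaMat s)
        * J.frame.transpose := by simp only [metricMat, metricInv, mul_assoc]
    _ = 1 := by rw [coframe_mul_frame, mul_one, etaMat_mul_etaMat, mul_one, h]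

theorem fderiv_toFun_apply {y : Fin m → ℝ} (hy : y ∈ V) (v : Fin m → ℝ) (A : JetIdx m) :
    fderiv ℝ J.toFun y v A = fderiv ℝ (fun x => J.toFun x A) y v := by
  have h := (J.contDiffOn.contDiffAt (J.isOpen.mem_nhds hy)).differentiableAt (by simp)
  rw [fderiv_pi fun A => (differentiableAt_pi.mp h A)]
  rfl

theorem fderiv_base {y : Fin m → ℝ} (hy : y ∈ V) (ν σ : Fin m) :
    fderiv ℝ J.toFun y (Pi.single ν 1) (.inl σ) = if ν = σ then 1 else 0 := by
  have h : (fun x => J.toFun x (.inl σ)) = fun x => x σ := funext fun x => J.base x σ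
  rw [J.fderiv_toFun_apply hy, h, (hasFDerivAt_apply σ y).fderiv]
  simp [Pi.single_apply, eq_comm]

/-- The components of the pullback of the universal connection are those of the linear connection
in the moving frame. -/
theorem omega_apply (ν i j : Fin m) (y : Fin m → ℝ) (hy : y ∈ V) :
    omega i j (J.toFun y) (fderiv ℝ J.toFun y (Pi.single ν 1))
      = evalAt ⟨y, hy⟩ (frameConnection J.der J.frame J.coframe J.conn ν i j) := by
  have hF : ∀ μ, fderiv ℝ J.toFun y (Pi.single ν 1) (.inr (.inl (μ, j)))
      = evalAt ⟨y, hy⟩ (J.der ν (J.frame μ j)) := by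
    intro μ
    rw [J.fderiv_toFun_apply hy]
    exact (evalAt_dirDer_of_eq J.isOpen (Pi.single ν 1) (J.frame μ j)
      (F := fun x => J.toFun x (.inr (.inl (μ, j)))) (fun q => rfl) ⟨y, hy⟩).symm
  -- Since Q F = 1, Γ_ν F = -(e^μ_{kν}); this recovers the components e^i_μ (∂_ν e^μ_j - e^μ_{jν})
  -- of the universal connection.
  have hW : frameConnection J.der J.frame J.coframe J.conn ν
      = J.coframe * (matDer (J.der ν) J.frame - J.frameDeriv ν) := by
    rw [frameConnection, conn, Matrix.neg_mul, mul_assoc, coframe_mul_frame, mul_one, sub_eq_add_neg]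
  rw [hW, omega, sum_apply, Matrix.mul_apply, map_sum]
  refine Finset.sum_congr rfl fun μ _ => ?_
  rw [smul_apply, smul_eq_mul, map_mul, Matrix.sub_apply, map_sub, sub_apply, sum_apply]
  simp only [smul_apply, smul_eq_mul, dx, de, ContinuousLinearMap.proj_apply, J.fderiv_base hy, hF,
    mul_ite, mul_one, mul_zero, Finset.sum_ite_eq, Finset.mem_univ, if_true]
  rfl

/-- The torsion and metricity conditions characterize the Levi-Civita connection. -/
theorem isLeviCivita (s : Fin m → ℤˣ)
    (hT : ∀ y ∈ V, ∀ μ ν ρ, ∑ i, frameDer (J.toFun y) μ i ν * coframeMat (J.toFun y) i ρ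
      = ∑ i, frameDer (J.toFun y) μ i ρ * coframeMat (J.toFun y) i ν)
    (hω : ∀ y ∈ V, ∀ i j, pullback J.toFun (fun z => oneForm (omegaP s i j z)) y = 0) :
    IsLeviCivita J.der (J.metricMat s) (J.metricInv s) J.conn where
  comm := J.der_comm
  symm := J.metricMat_transpose s
  mul_inv := J.metricMat_mul_metricInv s
  torsion μ κ ρ := smoothFun.ext_eval fun p => by
    simp only [conn, Matrix.neg_apply, map_neg, Matrix.mul_apply, map_sum, map_mul]
    exact congrArg Neg.neg (hT p p.2 κ μ ρ)
  compat ν := by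
    refine frame_compat J.frame_mul_coframe (J.etaMat_mul_etaMat s) (J.matDer_etaMat s) ν ?_
    ext1 i j
    refine smoothFun.ext_eval fun p => ?_
    -- The component of σ^*ω_𝔭 along ∂_ν is ½ (W_ν + η W_νᵀ η), the combination whose vanishing
    -- `frame_compat` requires.
    have h1 : pullbackHom J.toFun p (oneForm (omegaP s i j (J.toFun p))) = 0 := hω p p.2 i j
    rw [pullbackHom_oneForm, oneForm, ExteriorAlgebra.ι_eq_zero_iff] at h1
    have h2 := congrArg (fun α => α (Pi.single ν (1 : ℝ))) h1
    simp only [ContinuousLinearMap.comp_apply, omegaP, smul_apply, add_apply, sum_apply,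
      J.omega_apply ν _ _ p p.2, zero_apply, smul_eq_mul] at h2
    have h3 := (mul_eq_zero.mp h2).resolve_left (by norm_num)
    rw [Matrix.add_apply, Matrix.mul_apply, Matrix.zero_apply, map_add, map_zero, map_sum, ← h3]
    congr 1
    refine Finset.sum_congr rfl fun p _ => ?_
    rw [map_mul, Matrix.mul_apply, map_sum, Finset.sum_mul]
    refine Finset.sum_congr rfl fun q _ => ?_
    have e1 : eta s j p = eta s p j := congrFun (congrFun (eta_transpose s) p) j
    have e2 : eta s q i = eta s i q := congrFun (congrFun (eta_transpose s) i) q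
    rw [map_mul, e1, e2, Matrix.transpose_apply]
    change eta s i q * _ * eta s p j = _
    ring

theorem coframe_eval (p : V) : J.coframe.map (evalAt p) = coframeMat (J.toFun p) := rfl

theorem differentiableAt_omega {y : Fin m → ℝ} (hy : y ∈ V) (i j : Fin m) :
    DifferentiableAt ℝ (omega i j) (J.toFun y) := by
  have h0 : ContDiff ℝ ∞ fun z : JetCoord m => (frameMat z).det := by
    rw [← contDiffOn_univ]
    exact contDiffOn_det fun ν k => (contDiff_apply ℝ ℝ _).contDiffOn
  have hO : IsOpen {z : JetCoord m | (frameMat z).det ≠ 0} :=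
    isOpen_ne.preimage h0.continuous
  have hQ : ∀ μ, DifferentiableAt ℝ (fun z : JetCoord m => coframeMat z i μ) (J.toFun y) := fun μ =>
    ((contDiffOn_matrix_inv (Gf := fun z : JetCoord m => frameMat z)
      (O := {z | (frameMat z).det ≠ 0}) (fun ν k => (contDiff_apply ℝ ℝ _).contDiffOn)
      (fun _ h => h) i μ).contDiffAt (hO.mem_nhds (J.det_ne_zero y hy))).differentiableAt (by simp)
  have hD : ∀ μ σ, DifferentiableAt ℝ (fun z : JetCoord m => frameDer z μ j σ) (J.toFun y) :=
    fun μ σ => differentiableAt_apply _ _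
  unfold omega
  refine DifferentiableAt.fun_sum fun μ _ => (hQ μ).fun_smul ?_
  refine (differentiableAt_const _).fun_sub (DifferentiableAt.fun_sum fun σ _ => ?_)
  exact (hD μ σ).fun_smul (differentiableAt_const _)

/-- The pulled back form has coefficients ∂_μ W_ν + W_μ W_ν. Their antisymmetrization is half the
curvature of W, which is conjugate to that of Γ. -/
theorem pullbackHom_curvForm (p : V) (i j : Fin m) :
    pullbackHom J.toFun p (curvForm i j (J.toFun p)) = ∑ μ, ∑ ν,
      evalAt p (algebraMap ℝ _ (1 / 2) * (J.coframe * riem J.der J.conn μ ν * J.frame) i j)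
        • (dxForm μ * dxForm ν) := by
  set W := frameConnection J.der J.frame J.coframe J.conn with hW
  have hfp : ContDiffAt ℝ ∞ J.toFun p := J.contDiffOn.contDiffAt (J.isOpen.mem_nhds p.2)
  have hd : ∀ μ ν, pderiv μ (fun x => omega i j (J.toFun x)
      (fderiv ℝ J.toFun x (Pi.single ν 1))) p = evalAt p (matDer (J.der μ) (W ν) i j) :=
    fun μ ν => pderiv_eq_evalAt (T := fun x => x) J.isOpen (fun x => hasFDerivAt_id x) μ
      (fun x hx => J.omega_apply ν i j x hx) p.2
  have h1 : pullbackHom J.toFun p (curvForm i j (J.toFun p)) = ∑ μ, ∑ ν,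
      evalAt p ((matDer (J.der μ) (W ν) + W μ * W ν) i j) • (dxForm μ * dxForm ν) := by
    rw [curvForm, map_add, pullbackHom_dOne hfp (J.differentiableAt_omega p.2 i j)]
    simp only [map_sum, map_mul, pullbackHom_oneForm, oneForm_mul_oneForm,
      ContinuousLinearMap.comp_apply, J.omega_apply _ _ _ p p.2, hd, Matrix.add_apply, map_add,
      add_smul, Finset.sum_add_distrib, Matrix.mul_apply, Finset.sum_smul]
    congr 1
    rw [Finset.sum_comm]
    exact Finset.sum_congr rfl fun μ _ => Finset.sum_comm
  rw [h1, sum_smul_dxForm_antisymm]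
  refine Finset.sum_congr rfl fun μ _ => Finset.sum_congr rfl fun ν _ => ?_
  congr 1
  rw [← riem_frameConnection J.der_comm J.frame_mul_coframe, map_mul, AlgHom.commutes,
    ← map_sub, ← hW, riem, ← Matrix.sub_apply, add_sub_add_comm]
  rfl

/-- Since F η = g⁻¹ Qᵀ, raising the frame index with η turns Q R F into Q (R g⁻¹) Qᵀ. -/
theorem pullbackHom_curvFormUp (s : Fin m → ℤˣ) (p : V) (a b : Fin m) :
    pullbackHom J.toFun p (curvFormUp s a b (J.toFun p)) = ∑ α, ∑ β,
      (coframeMat (J.toFun p)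
        * ((1 / 2 : ℝ) • (riemUp J.der (J.metricInv s) J.conn α β).map (evalAt p))
        * (coframeMat (J.toFun p)).transpose) a b • (dxForm α * dxForm β) := by
  have hFη : J.frame * J.etaMat s = J.metricInv s * J.coframe.transpose := by
    rw [metricInv, mul_assoc _ _ J.coframe.transpose, ← Matrix.transpose_mul, coframe_mul_frame,
      Matrix.transpose_one, mul_one]
  have key : ∀ α β, (coframeMat (J.toFun p)
        * ((1 / 2 : ℝ) • (riemUp J.der (J.metricInv s) J.conn α β).map (evalAt p))
        * (coframeMat (J.toFun p)).transpose)
      = (1 / 2 : ℝ) • ((J.coframe * riem J.der J.conn α β * J.frame).map (evalAt p) * eta s) := by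
    intro α β
    rw [Matrix.mul_smul, Matrix.smul_mul, ← J.coframe_eval, ← J.etaMat_eval s p,
      ← Matrix.transpose_map, ← map_evalAt_mul, ← map_evalAt_mul, ← map_evalAt_mul,
      mul_assoc _ J.frame, hFη, riemUp]
    simp only [mul_assoc]
  rw [curvFormUp, map_sum]
  simp only [map_smul, pullbackHom_curvForm, key, Finset.smul_sum, smul_smul]
  rw [Finset.sum_comm]
  refine Finset.sum_congr rfl fun α _ => ?_
  rw [Finset.sum_comm]
  refine Finset.sum_congr rfl fun β _ => ?_
  rw [← Finset.sum_smul, Matrix.smul_apply, Matrix.mul_apply, smul_eq_mul, Finset.mul_sum]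
  congr 1
  refine Finset.sum_congr rfl fun q _ => ?_
  have e1 : eta s b q = eta s q b := congrFun (congrFun (eta_transpose s) q) b
  rw [e1, map_mul, AlgHom.commutes, Matrix.map_apply]
  simp only [Algebra.algebraMap_self, RingHom.id_apply]
  ring

theorem pullbackHom_theta (p : V) (k : Fin m) :
    pullbackHom J.toFun p (oneForm (theta k (J.toFun p)))
      = ∑ μ, coframeMat (J.toFun p) k μ • dxForm μ := by
  rw [pullbackHom_oneForm, oneForm_eq_sum]
  refine Finset.sum_congr rfl fun ν _ => ?_
  congr 1
  simp only [ContinuousLinearMap.comp_apply, theta, sum_apply, smul_apply, smul_eq_mul, dx,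
    ContinuousLinearMap.proj_apply, J.fderiv_base p.2, mul_ite, mul_one, mul_zero,
    Finset.sum_ite_eq, Finset.mem_univ, if_true]

theorem map_evalAt_lovMixed (r : ℕ) (X : Fin m → Fin m → Matrix (Fin m) (Fin m) (smoothFun V))
    (p : V) (μ ρ : Fin m) :
    evalAt p (lovMixed r X μ ρ) = lovMixed r (fun α β => (X α β).map (evalAt p)) μ ρ := by
  simp only [lovMixed, map_sum, map_mul, AlgHom.commutes, blockProd, map_prod, blocks,
    Matrix.map_apply]

theorem pullback_Psi_eq_zero_iff (s : Fin m → ℤˣ) {n : ℕ} (hn : 2 * (n + 1) ≤ m)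
    (hLC : IsLeviCivita J.der (J.metricMat s) (J.metricInv s) J.conn) (p : V) :
    (∀ a b, pullback J.toFun (Psi s (n + 1) a b) p = 0) ↔
      ∀ μ ν, evalAt p (∑ ρ, (lovMixed (n + 1) (riemUp J.der (J.metricInv s) J.conn) μ ρ
          * J.metricInv s ρ ν
        + lovMixed (n + 1) (riemUp J.der (J.metricInv s) J.conn) ν ρ * J.metricInv s ρ μ)) = 0 := by
  have hdet : IsUnit (coframeMat (J.toFun p)).det :=
    Matrix.isUnit_nonsing_inv_det _ (isUnit_iff_ne_zero.mpr (J.det_ne_zero p p.2))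
  obtain ⟨c, hc, h⟩ := map_Psi s (pullbackHom J.toFun p) (J.toFun p) hn
    (gi := (J.metricInv s).map (evalAt p)) (by rw [← Matrix.transpose_map, hLC.inv_symm])
    (fun α β => (riemUp J.der (J.metricInv s) J.conn α β).map (evalAt p))
    (fun α β => by
      rw [← Matrix.transpose_map, riemUp, hLC.riem_mul_inv_antisymm]
      ext i j
      exact map_neg (evalAt p) _) hdet.ne_zero
    (by
      rw [← J.coframe_eval, ← J.etaMat_eval s p, ← Matrix.transpose_map, ← map_evalAt_mul,
        ← map_evalAt_mul, metricInv]
      congr 1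
      have h1 : J.frame.transpose * J.coframe.transpose = 1 := by
        rw [← Matrix.transpose_mul, coframe_mul_frame, Matrix.transpose_one]
      simp only [mul_assoc, h1, mul_one]
      rw [← mul_assoc, coframe_mul_frame, one_mul])
    (J.pullbackHom_theta p) (J.pullbackHom_curvFormUp s p)
  have hT : ∀ μ ν, evalAt p (∑ ρ, (lovMixed (n + 1) (riemUp J.der (J.metricInv s) J.conn) μ ρ
          * J.metricInv s ρ ν
        + lovMixed (n + 1) (riemUp J.der (J.metricInv s) J.conn) ν ρ * J.metricInv s ρ μ))
      = (Matrix.of fun μ ν => ∑ ρ, (lovMixed (n + 1)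
          (fun α β => (riemUp J.der (J.metricInv s) J.conn α β).map (evalAt p)) μ ρ
            * (J.metricInv s).map (evalAt p) ρ ν
          + lovMixed (n + 1)
          (fun α β => (riemUp J.der (J.metricInv s) J.conn α β).map (evalAt p)) ν ρ
            * (J.metricInv s).map (evalAt p) ρ μ)) μ ν := by
    intro μ ν
    simp only [map_sum, map_add, map_mul, map_evalAt_lovMixed, Matrix.of_apply, Matrix.map_apply]
  simp only [hT]
  have hPsi : ∀ a b, pullback J.toFun (Psi s (n + 1) a b) p
      = pullbackHom J.toFun p (Psi s (n + 1) a b (J.toFun p)) := fun _ _ => rfl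
  simp only [hPsi, h]
  set T := Matrix.of fun μ ν => ∑ ρ, (lovMixed (n + 1)
          (fun α β => (riemUp J.der (J.metricInv s) J.conn α β).map (evalAt p)) μ ρ
            * (J.metricInv s).map (evalAt p) ρ ν
          + lovMixed (n + 1)
          (fun α β => (riemUp J.der (J.metricInv s) J.conn α β).map (evalAt p)) ν ρ
            * (J.metricInv s).map (evalAt p) ρ μ)
  set Q := coframeMat (J.toFun p)
  -- The form of top degree is c (Q T Qᵀ)^{ab} vol with c ≠ 0 and vol ≠ 0, and the invertible Q
  -- cancels on both sides of T.
  constructor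
  · intro h0
    have h1 : Q * T * Q.transpose = 0 := by
      ext a b
      have h2 := (smul_eq_zero.mp (h0 a b)).resolve_right volForm_ne_zero
      exact (mul_eq_zero.mp h2).resolve_left hc
    have hQ : IsUnit Q := (Matrix.isUnit_iff_isUnit_det Q).mpr hdet
    have hQt : IsUnit Q.transpose := (Matrix.isUnit_transpose Q).mpr hQ
    have h2 : T = 0 := hQ.mul_right_eq_zero.mp (hQt.mul_left_eq_zero.mp h1)
    intro μ ν
    rw [h2, Matrix.zero_apply]
  · intro h0 a b
    have h2 : T = 0 := Matrix.ext h0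
    rw [h2, mul_zero, zero_mul, Matrix.zero_apply, mul_zero, zero_smul]

end JetField

/-! ### From sections on the manifold to jet fields in a chart. -/

namespace JetSection

variable {m : ℕ} {M : Type*} [TopologicalSpace M] [ChartedSpace (Fin m → ℝ) M]
  [IsManifold 𝓘(ℝ, Fin m → ℝ) ∞ M] {U : Set M} (σ : JetSection m M U)
  {φ : OpenPartialHomeomorph M (Fin m → ℝ)}

theorem isOpen_dom (hU : IsOpen U) : IsOpen (σ.dom φ) :=
  φ.symm.isOpen_inter_preimage hU

/-- The differential of a chart is injective, so it maps the frame at φ⁻¹ y to independent vectors,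
the columns of the matrix e^ν_k. -/
theorem det_frameMat_coord_ne_zero (hφ : φ ∈ IsManifold.maximalAtlas 𝓘(ℝ, Fin m → ℝ) ∞ M)
    {y : Fin m → ℝ} (hy : y ∈ σ.dom φ) : (frameMat (σ.coord φ y)).det ≠ 0 := by
  have hφ1 : φ ∈ IsManifold.maximalAtlas 𝓘(ℝ, Fin m → ℝ) 1 M :=
    IsManifold.maximalAtlas_subset_of_le (by simp) hφ
  have hmd : φ.MDifferentiable 𝓘(ℝ, Fin m → ℝ) 𝓘(ℝ, Fin m → ℝ) :=
    ⟨fun x hx => (mdifferentiableAt_of_mem_maximalAtlas hφ1 hx).mdifferentiableWithinAt,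
      fun x hx => (mdifferentiableAt_symm_of_mem_maximalAtlas hφ1 hx).mdifferentiableWithinAt⟩
  have hinj := hmd.mfderiv_injective (φ.map_target hy.1)
  have hli := (σ.linearIndependent_S (φ.symm y) hy.2).map' (mfderiv 𝓘(ℝ, Fin m → ℝ)
    𝓘(ℝ, Fin m → ℝ) φ (φ.symm y)).toLinearMap (LinearMap.ker_eq_bot.mpr hinj)
  have hcol : LinearIndependent ℝ (frameMat (σ.coord φ y)).col := hli
  rw [Matrix.linearIndependent_cols_iff_isUnit, Matrix.isUnit_iff_isUnit_det] at hcol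
  exact hcol.ne_zero

/-- The section in the chart `φ`. -/
def toJetField (hU : IsOpen U) (hφ : φ ∈ IsManifold.maximalAtlas 𝓘(ℝ, Fin m → ℝ) ∞ M) :
    JetField (σ.dom φ) where
  toFun := σ.coord φ
  isOpen := σ.isOpen_dom hU
  contDiffOn := σ.smooth φ hφ
  base _ _ := rfl
  det_ne_zero _ hy := σ.det_frameMat_coord_ne_zero hφ hy

variable {σ}

theorem metric_eq_evalAt (hU : IsOpen U)
    (hφ : φ ∈ IsManifold.maximalAtlas 𝓘(ℝ, Fin m → ℝ) ∞ M) (s : Fin m → ℤˣ) (p : σ.dom φ) :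
    σ.metric s φ p = ((σ.toJetField hU hφ).metricMat s).map (evalAt p) := by
  rw [JetField.metricMat, map_evalAt_mul, map_evalAt_mul, Matrix.transpose_map,
    JetField.coframe_eval, JetField.etaMat_eval]
  ext μ ν
  simp only [metric, Matrix.of_apply, Matrix.mul_apply, Matrix.transpose_apply, Finset.sum_mul]
  exact Finset.sum_comm

theorem metric_inv_eq_evalAt (hU : IsOpen U)
    (hφ : φ ∈ IsManifold.maximalAtlas 𝓘(ℝ, Fin m → ℝ) ∞ M) (s : Fin m → ℤˣ) (p : σ.dom φ) :
    (σ.metric s φ p)⁻¹ = ((σ.toJetField hU hφ).metricInv s).map (evalAt p) := by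
  refine Matrix.inv_eq_right_inv ?_
  rw [metric_eq_evalAt hU hφ, ← map_evalAt_mul, JetField.metricMat_mul_metricInv,
    Matrix.map_one _ (map_zero _) (map_one _)]

theorem connection_eq_evalAt (hU : IsOpen U)
    (hφ : φ ∈ IsManifold.maximalAtlas 𝓘(ℝ, Fin m → ℝ) ∞ M) (μ ν ρ : Fin m) (p : σ.dom φ) :
    σ.connection φ μ ν ρ p = evalAt p ((σ.toJetField hU hφ).conn ρ μ ν) := by
  rw [connection, JetField.conn, Matrix.neg_apply, map_neg, Matrix.mul_apply, map_sum]
  congr 1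
  refine Finset.sum_congr rfl fun k _ => ?_
  rw [map_mul, mul_comm]
  rfl

theorem isLeviCivita (hU : IsOpen U)
    (hφ : φ ∈ IsManifold.maximalAtlas 𝓘(ℝ, Fin m → ℝ) ∞ M) {s : Fin m → ℤˣ}
    (hT : σ.Torsionless) (hω : σ.Metricity s) :
    IsLeviCivita (σ.toJetField hU hφ).der ((σ.toJetField hU hφ).metricMat s)
      ((σ.toJetField hU hφ).metricInv s) (σ.toJetField hU hφ).conn :=
  (σ.toJetField hU hφ).isLeviCivita s (hT φ hφ) (hω φ hφ)

theorem pullback_Psi_eq_zero_iff_lovelockTensor (hU : IsOpen U)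
    (hφ : φ ∈ IsManifold.maximalAtlas 𝓘(ℝ, Fin m → ℝ) ∞ M) {s : Fin m → ℤˣ} (hT : σ.Torsionless)
    (hω : σ.Metricity s) {r : ℕ} (hr : 1 ≤ r) (hrm : 2 * r ≤ m) {y : Fin m → ℝ}
    (hy : y ∈ σ.dom φ) :
    (∀ a b, pullback (σ.coord φ) (Psi s r a b) y = 0) ↔
      ∀ μ ν, lovelockTensor r (σ.metric s φ) (σ.connection φ) μ ν y = 0 := by
  -- The first curvature factor is split off, so that r - 1 becomes n without truncated subtraction.
  obtain ⟨n, rfl⟩ : ∃ n, r = n + 1 := ⟨r - 1, by omega⟩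
  refine ((σ.toJetField hU hφ).pullback_Psi_eq_zero_iff s hrm (isLeviCivita hU hφ hT hω)
    ⟨y, hy⟩).trans (forall₂_congr fun μ ν => ?_)
  rw [lovelockTensor_eq_evalAt (T := fun x => x) (σ.isOpen_dom hU) (fun x => hasFDerivAt_id x)
    (fun x hx => metric_inv_eq_evalAt hU hφ s ⟨x, hx⟩)
    (fun μ ν ρ x hx => connection_eq_evalAt hU hφ μ ν ρ ⟨x, hx⟩) (n + 1) μ ν hy]
  rfl

/-- Uniqueness of the Levi-Civita connection. Condition 2 uses the connection of σ, whereas the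
Lagrangian in condition 3 uses the Christoffel symbols of g. -/
theorem lovelockTensor_connection (hU : IsOpen U)
    (hφ : φ ∈ IsManifold.maximalAtlas 𝓘(ℝ, Fin m → ℝ) ∞ M) {s : Fin m → ℤˣ} (hT : σ.Torsionless)
    (hω : σ.Metricity s) (r : ℕ) (μ ν : Fin m) {y : Fin m → ℝ} (hy : y ∈ σ.dom φ) :
    lovelockTensor r (σ.metric s φ) (σ.connection φ) μ ν y
      = lovelockTensor r (σ.metric s φ) (christoffel (σ.metric s φ)) μ ν y := by
  have hgi := fun x (hx : x ∈ σ.dom φ) => metric_inv_eq_evalAt hU hφ s ⟨x, hx⟩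
  have hid : ∀ x : Fin m → ℝ, HasFDerivAt (fun x => x) (ContinuousLinearMap.id ℝ _) x :=
    fun x => hasFDerivAt_id x
  rw [lovelockTensor_eq_evalAt (T := fun x => x) (σ.isOpen_dom hU) hid hgi
      (fun μ ν ρ x hx => connection_eq_evalAt hU hφ μ ν ρ ⟨x, hx⟩) r μ ν hy,
    lovelockTensor_eq_evalAt (T := fun x => x) (σ.isOpen_dom hU) hid hgi
      (fun μ ν ρ x hx => christoffel_eq_evalAt (σ.isOpen_dom hU) hid
        (fun x hx => metric_eq_evalAt hU hφ s ⟨x, hx⟩) hgi μ ν ρ hx) r μ ν hy,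
    (isLeviCivita hU hφ hT hω).eq_christoffelMat]
  rfl

theorem lovelockTensor_eq_zero_iff_extremal (hU : IsOpen U)
    (hφ : φ ∈ IsManifold.maximalAtlas 𝓘(ℝ, Fin m → ℝ) ∞ M) {s : Fin m → ℤˣ} (hT : σ.Torsionless)
    (hω : σ.Metricity s) (r : ℕ) :
    (∀ y ∈ σ.dom φ, ∀ μ ν, lovelockTensor r (σ.metric s φ) (σ.connection φ) μ ν y = 0) ↔
      IsLovelockExtremal r (σ.metric s φ) (σ.dom φ) := by
  rw [isLovelockExtremal_iff (σ.isOpen_dom hU) ?_ ?_ ?_ r]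
  · exact forall₂_congr fun y hy => forall₂_congr fun μ ν => by
      rw [lovelockTensor_connection hU hφ hT hω r μ ν hy]
  · intro i j
    exact smoothFun.contDiffOn_of_eq ((σ.toJetField hU hφ).metricMat s i j) fun p => by
      rw [metric_eq_evalAt hU hφ s p, Matrix.map_apply]
  · intro y hy h0
    have h := congrArg Matrix.det (congrArg (fun N => N.map (evalAt (⟨y, hy⟩ : σ.dom φ)))
      ((σ.toJetField hU hφ).metricMat_mul_metricInv s))
    simp only [map_evalAt_mul] at h
    rw [← metric_eq_evalAt hU hφ s ⟨y, hy⟩, Matrix.det_mul, h0, zero_mul,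
      Matrix.map_one _ (map_zero _) (map_one _), Matrix.det_one] at h
    exact zero_ne_one h
  · intro y hy
    rw [metric_eq_evalAt hU hφ s ⟨y, hy⟩, ← Matrix.transpose_map, JetField.metricMat_transpose]

end JetSection

end Lovelock

end

open Lovelock in
theorem mainTheorem3 {m : ℕ} {M : Type*} [TopologicalSpace M] [ChartedSpace (Fin m → ℝ) M]
    [IsManifold 𝓘(ℝ, Fin m → ℝ) ∞ M] (s : Fin m → ℤˣ) (r : ℕ) (hr : 1 ≤ r) (hrm : 2 * r ≤ m)
    (U : Set M) (hU : IsOpen U) (σ : JetSection m M U)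
    (hT : σ.Torsionless) (hω : σ.Metricity s) :
    List.TFAE [
      ∀ φ ∈ IsManifold.maximalAtlas 𝓘(ℝ, Fin m → ℝ) ∞ M, ∀ y ∈ σ.dom φ, ∀ a b : Fin m,
        pullback (σ.coord φ) (Psi s r a b) y = 0,
      ∀ φ ∈ IsManifold.maximalAtlas 𝓘(ℝ, Fin m → ℝ) ∞ M, ∀ y ∈ σ.dom φ, ∀ μ ν : Fin m,
        lovelockTensor r (σ.metric s φ) (σ.connection φ) μ ν y = 0,
      ∀ φ ∈ IsManifold.maximalAtlas 𝓘(ℝ, Fin m → ℝ) ∞ M,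
        IsLovelockExtremal r (σ.metric s φ) (σ.dom φ)] := by
  have h12 : ∀ φ ∈ IsManifold.maximalAtlas 𝓘(ℝ, Fin m → ℝ) ∞ M, ∀ y ∈ σ.dom φ, _ :=
    fun φ hφ y hy => JetSection.pullback_Psi_eq_zero_iff_lovelockTensor hU hφ hT hω hr hrm hy
  have h23 : ∀ φ ∈ IsManifold.maximalAtlas 𝓘(ℝ, Fin m → ℝ) ∞ M, _ :=
    fun φ hφ => JetSection.lovelockTensor_eq_zero_iff_extremal hU hφ hT hω r
  tfae_have 1 ↔ 2 := forall₂_congr fun φ hφ => forall₂_congr (h12 φ hφ)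
  tfae_have 2 ↔ 3 := forall₂_congr h23
  tfae_finish
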